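/- Let $N\ge 2$, and let $(H_n)_{n\ge0}$ be Hermite polynomials, i.e. real polynomials with $\deg H_n=n$ that are pairwise orthogonal on $\mathbb R$ with respect to $e^{-x^2}\,dx$. **Setting.** For $i<j$ put $\boldsymbol\alpha_{j,i}=\mathbf e_j-\mathbf e_i\in\mathbb R^N$ (the positive roots of type $A_{N-1}$), $w_\beta(\mathbf x)=\prod_{i<j}|x_j-x_i|^{\beta}$, $c_\beta=\int_{\mathbb R^N}e^{-\|\mathbf x\|^2/2}w_\beta(\mathbf x)\,d\mathbf x$ and $C_W=\{x_1\le\dots\le x_N\}$. The jump rate at time $1$ of the Dunkl jump process of type $A_{N-1}$ (all multiplicities $\beta/2$) started from $\mathbf 0$ is $$\lambda_\beta(\boldsymbol\alpha)=\frac{\beta\|\boldsymbol\alpha\|^2}{4}\int_{C_W}\frac{1}{(\boldsymbol\alpha\cdot\mathbf x)^2}\,\frac{N!}{c_\beta}\,e^{-\|\mathbf x\|^2/2}w_\beta(\mathbf x)\,d\mathbf x ,$$ and its rate matrix on $S_N$ is $M_{\tau\nu}(\beta)=\sum_{i<j}\lambda_\beta(\boldsymbol\alpha_{j,i})\,(\delta_{\tau\sigma_{j,i},\nu}-\delta_{\tau,\nu})$,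 where $\sigma_{j,i}$ is the transposition of $i$ and $j$. On $\bigotimes_{i=1}^N\mathbb C^N$ write $|\mathbf n\rangle=|n_1\rangle\otimes\dots\otimes|n_N\rangle$. Let $\tilde{\mathcal H}$ be the span of the vectors $|\rho\rangle=|\rho(1),\dots,\rho(N)\rangle$, $\rho\in S_N$, and for $f:S_N\to\mathbb C$ put $|f\rangle=\sum_\nu f(\nu)|\nu\rangle$. Let $\hat P_{j,i}$ exchange the tensor factors $i$ and $j$. Let $J^{(j,l)}$, $1\le j,l\le N$, be the $N\times N$ matrices $$J^{(j,l)}=\begin{cases}\tfrac12\big(|j\rangle\langle l|+|l\rangle\langle j|\big), & j<l,\\ \tfrac{\sqrt{-1}}2\big(|l\rangle\langle j|-|j\rangle\langle l|\big), & l<j,\\ \tfrac1{\sqrt{2j(j+1)}}\big(\sum_{m=1}^j|m\rangle\langle m|-j|j+1\rangle\langle j+1|\big), & j=l\le N-1,\\ 0, & j=l=N,\end{cases}$$ let $J^{(j,l)}_m$ be $J^{(j,l)}$ acting on the $m$-th factor, and let $f^{[a,b,c]}=2\operatorname{Tr}\big([J^a,J^b]J^c\big)$ for labels $a,b,c\in\{1,\dots,N\}^2$.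 **Statement.** $H_N$ has exactly $N$ distinct zeros, all of them real; let $z_1<\dots<z_N$ be these zeros. 1. (Frozen limit.) As $\beta\to\infty$, $\lambda_\beta(\boldsymbol\alpha_{j,i})\to\frac1{2(z_j-z_i)^2}$ for all $i<j$. Hence $M(\beta)$ converges to the matrix $M^{(0)}$ with these rates, which acts by $$(M^{(0)}f)(\tau)=\frac12\sum_{i<j}\frac{f(\tau\sigma_{j,i})}{(z_j-z_i)^2}-\frac{N(N-1)}8f(\tau).$$ 2. (Spin chain.) Let $\hat H_{PF}=\sum_{i<j}(z_j-z_i)^{-2}\hat P_{j,i}$ be the Polychronakos–Frahm Hamiltonian. The map $f\mapsto|f\rangle$ is a linear isomorphism onto $\tilde{\mathcal H}$, $\hat H_{PF}$ maps $\tilde{\mathcal H}$ into itself, and $|M^{(0)}f\rangle=\big(\tfrac12\hat H_{PF}-\tfrac{N(N-1)}8\big)|f\rangle$ for every $f$. 3. (Spectrum.) The largest eigenvalue of $M^{(0)}$ is $0$, and its eigenspace consists of the constant functions. The largest nonzero eigenvalue, i.e. the least negative one, is $-\frac12$, and its eigenspace has dimension exactly $N-1$. 4. (Ladder operators.) One has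 $[J^a,J^b]=\sum_cf^{[a,b,c]}J^c$ for all labels $a,b$. For every label $a$ put $$\hat K^{a}=\sum_{m}z_mJ^{a}_m,\qquad \hat L^{a}=\sum_{b,c}\sum_{m\ne n}\frac{f^{[a,b,c]}}{z_m-z_n}J^b_mJ^c_n,\qquad \hat M=\tfrac12\hat H_{PF}.$$ Then $[\hat M,\hat K^a]=\frac12\hat L^a$ and $[\hat M,\hat L^a]=\frac12\hat K^a$. Consequently $\hat M\phi=r\phi$ implies $\hat M(\hat K^a\pm\hat L^a)\phi=(r\pm\frac12)(\hat K^a\pm\hat L^a)\phi$. The operators $\hat K^{(j,j)}\pm\hat L^{(j,j)}$ map $\tilde{\mathcal H}$ into itself. For $j\neq l$, $\hat K^{(j,l)}+\hat L^{(j,l)}$ does not map $\tilde{\mathcal H}$ into itself, and neither does $\hat K^{(j,l)}-\hat L^{(j,l)}$ if $N\ge3$. For $|\Omega\rangle=(N!)^{-1/2}\sum_\rho|\rho\rangle$ one has $\hat M|\Omega\rangle=\frac{N(N-1)}8|\Omega\rangle$. The vector $(\hat K^{(j,l)}-\hat L^{(j,l)})|\Omega\rangle$ is a nonzero element of $\tilde{\mathcal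 H}$ if and only if $j=l\le N-1$. The $N-1$ vectors $(\hat K^{(j,j)}-\hat L^{(j,j)})|\Omega\rangle$, $1\le j\le N-1$, form a basis of $\{\phi\in\tilde{\mathcal H}:\hat M\phi=(\frac{N(N-1)}8-\frac12)\phi\}$, which is the eigenspace of $M^{(0)}$ for $-\frac12$ under $f\mapsto|f\rangle$ (complex-valued $f$). -/

import Mathlib

open Filter Topology MeasureTheory
open scoped TensorProduct Polynomial

noncomputable section

namespace DunklA

/-- A family of Hermite polynomials: `H n` has degree `n`, and the family is orthogonal on `ℝ`
with respect to `exp (-x ^ 2)` (the normalization is left free). -/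
def IsHermiteFamily (H : ℕ → ℝ[X]) : Prop :=
  (∀ n, (H n).degree = n) ∧
    ∀ m n, m ≠ n → ∫ x : ℝ, (H m).eval x * (H n).eval x * Real.exp (-x ^ 2) = 0

/-! ### Jump rates of the Dunkl jump process of type `A_{N-1}` started at the origin -/

/-- The root `α_{j,i} = e_j - e_i`. -/
def root {N : ℕ} (j i : Fin N) : EuclideanSpace ℝ (Fin N) :=
  EuclideanSpace.single j 1 - EuclideanSpace.single i 1

/-- The pairs `(i, j)` with `i < j`; they index the positive roots `α_{j,i}`. -/
def posPairs (N : ℕ) : Finset (Fin N × Fin N) :=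
  Finset.univ.filter fun p => p.1 < p.2

/-- The closed Weyl chamber `x_1 ≤ ⋯ ≤ x_N`. -/
def weylChamber (N : ℕ) : Set (EuclideanSpace ℝ (Fin N)) :=
  {x | ∀ p ∈ posPairs N, 0 ≤ inner ℝ (root p.2 p.1) x}

/-- The weight `w_β(x) = ∏_{α > 0} |α · x| ^ β` (all multiplicities `k(α)` equal to one). -/
def weight {N : ℕ} (β : ℝ) (x : EuclideanSpace ℝ (Fin N)) : ℝ :=
  ∏ p ∈ posPairs N, |inner ℝ (root p.2 p.1) x| ^ β

/-- The normalization constant `c_β`. -/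
def normConst (N : ℕ) (β : ℝ) : ℝ :=
  ∫ x : EuclideanSpace ℝ (Fin N), Real.exp (-‖x‖ ^ 2 / 2) * weight β x

/-- The transition density `p(t, y | 0)` of the Dunkl process started at the origin
(the Dunkl kernel is normalized by `E_β(0, y) = 1`). -/
def originDensity {N : ℕ} (β t : ℝ) (y : EuclideanSpace ℝ (Fin N)) : ℝ :=
  Real.exp (-‖y‖ ^ 2 / (2 * t)) / (normConst N β * t ^ ((N : ℝ) / 2)) *
    weight β ((Real.sqrt t)⁻¹ • y)

/-- The density `∑_{ρ ∈ W} p(t, y | ρ 0)` of the radial part; every `ρ` fixes the origin. -/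
def radialDensity {N : ℕ} (β t : ℝ) (y : EuclideanSpace ℝ (Fin N)) : ℝ :=
  ∑ _ρ : Equiv.Perm (Fin N), originDensity β t y

/-- The jump rate `λ_β(t, α | 0)`. -/
def jumpRate {N : ℕ} (β t : ℝ) (α : EuclideanSpace ℝ (Fin N)) : ℝ :=
  β * ‖α‖ ^ 2 / 4 *
    ∫ x in weylChamber N, 1 / (inner ℝ α x) ^ 2 * radialDensity β t x

/-- The matrix `∑_{i<j} rate j i δ_{τ σ_{j,i}, ν} - (∑_{i<j} rate j i) δ_{τ, ν}` on `S_N` of the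
master equation, where `rate j i` is the rate of the jumps along `α_{j,i}`. -/
def transitionMatrix {N : ℕ} (rate : Fin N → Fin N → ℝ) :
    Matrix (Equiv.Perm (Fin N)) (Equiv.Perm (Fin N)) ℝ :=
  Matrix.of fun τ ν =>
    (∑ p ∈ posPairs N, rate p.2 p.1 * if τ * Equiv.swap p.2 p.1 = ν then 1 else 0) -
      (∑ p ∈ posPairs N, rate p.2 p.1) * if τ = ν then 1 else 0

/-- The transition matrix `M(β)` built from the rates `λ_β(1, α | 0)`. -/
def dunklMatrix (N : ℕ) (β : ℝ) : Matrix (Equiv.Perm (Fin N)) (Equiv.Perm (Fin N)) ℝ :=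
  transitionMatrix fun j i => jumpRate β 1 (root j i)

/-- The transition matrix with the rates `1 / (2 (z_j - z_i) ^ 2)`. -/
def frozenMatrix {N : ℕ} (z : Fin N → ℝ) :
    Matrix (Equiv.Perm (Fin N)) (Equiv.Perm (Fin N)) ℝ :=
  transitionMatrix fun j i => 1 / (2 * (z j - z i) ^ 2)

/-! ### The Polychronakos–Frahm spin chain -/

/-- The space `⊗_{i=1}^N ℂ^N` of `N` spins with `N` states each. -/
abbrev SpinSpace (N : ℕ) : Type :=
  ⨂[ℂ] _i : Fin N, (Fin N → ℂ)

/-- The vector `|n_1⟩ ⊗ ⋯ ⊗ |n_N⟩`. -/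
def ket {N : ℕ} (n : Fin N → Fin N) : SpinSpace N :=
  PiTensorProduct.tprod ℂ fun i => (Pi.single (n i) 1 : Fin N → ℂ)

/-- The subspace spanned by the vectors `|ρ⟩`, `ρ ∈ S_N`. -/
def permSpace (N : ℕ) : Submodule ℂ (SpinSpace N) :=
  Submodule.span ℂ (Set.range fun ρ : Equiv.Perm (Fin N) => ket (ρ : Fin N → Fin N))

/-- The vector `|f⟩ = ∑_ν f(ν) |ν⟩` of a function `f` on `S_N`. -/
def funKet (N : ℕ) : (Equiv.Perm (Fin N) → ℂ) →ₗ[ℂ] SpinSpace N :=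
  Fintype.linearCombination ℂ fun ρ : Equiv.Perm (Fin N) => ket (ρ : Fin N → Fin N)

/-- The exchange operator `P_{m,n}` of the tensor factors `m` and `n`. -/
def exchange {N : ℕ} (m n : Fin N) : Module.End ℂ (SpinSpace N) :=
  (PiTensorProduct.reindex ℂ (fun _ : Fin N => (Fin N → ℂ)) (Equiv.swap m n)).toLinearMap

/-- The Polychronakos–Frahm Hamiltonian `∑_{i<j} P_{j,i} / (z_j - z_i) ^ 2`. -/
def pfHamiltonian {N : ℕ} (z : Fin N → ℝ) : Module.End ℂ (SpinSpace N) :=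
  ∑ p ∈ posPairs N, ((1 / (z p.2 - z p.1) ^ 2 : ℝ) : ℂ) • exchange p.2 p.1

/-- The operator `M̂`, half the Polychronakos–Frahm Hamiltonian. -/
def hatM {N : ℕ} (z : Fin N → ℝ) : Module.End ℂ (SpinSpace N) :=
  (1 / 2 : ℂ) • pfHamiltonian z

/-! ### The `su(N)` generators and the ladder operators -/

/-- The `su(N)` matrices `J^{(j,l)}`. The indices are counted from zero, so that `j` stands for the
label `j + 1`; the matrix with the last label `(N, N)` is zero. -/
def suGen {N : ℕ} (a : Fin N × Fin N) : Matrix (Fin N) (Fin N) ℂ :=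
  if a.1 < a.2 then
    (1 / 2 : ℂ) • (Matrix.single a.1 a.2 1 + Matrix.single a.2 a.1 1)
  else if a.2 < a.1 then
    (Complex.I / 2) • (Matrix.single a.2 a.1 1 - Matrix.single a.1 a.2 1)
  else if (a.1 : ℕ) + 1 < N then
    ((1 / Real.sqrt (2 * ((a.1 : ℝ) + 1) * ((a.1 : ℝ) + 2)) : ℝ) : ℂ) •
      Matrix.diagonal fun m : Fin N =>
        if (m : ℕ) ≤ a.1 then (1 : ℂ)
        else if (m : ℕ) = a.1 + 1 then -(((a.1 : ℕ) : ℂ) + 1) else 0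
  else 0

/-- The structure constants `f^{[a,b,c]} = 2 Tr([J^a, J^b] J^c)`. -/
def structConst {N : ℕ} (a b c : Fin N × Fin N) : ℂ :=
  2 * (⁅suGen a, suGen b⁆ * suGen c).trace

/-- The matrix `A` acting on the tensor factor `m`, as the identity on the other factors. -/
def siteOp {N : ℕ} (m : Fin N) (A : Matrix (Fin N) (Fin N) ℂ) : Module.End ℂ (SpinSpace N) :=
  PiTensorProduct.map fun i : Fin N => if i = m then Matrix.toLin' A else LinearMap.id

/-- The operator `K^{(j,l)} = ∑_m z_m J_m^{(j,l)}`. -/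
def ladderK {N : ℕ} (z : Fin N → ℝ) (a : Fin N × Fin N) : Module.End ℂ (SpinSpace N) :=
  ∑ m, (z m : ℂ) • siteOp m (suGen a)

/-- The operator
`L^{(j,l)} = ∑_{b,c} ∑_{m ≠ n} f^{[(j,l),b,c]} / (z_m - z_n) J_m^b J_n^c`. -/
def ladderL {N : ℕ} (z : Fin N → ℝ) (a : Fin N × Fin N) : Module.End ℂ (SpinSpace N) :=
  ∑ b, ∑ c, ∑ m, ∑ n ∈ Finset.univ.erase m,
    (structConst a b c / ((z m : ℂ) - (z n : ℂ))) • (siteOp m (suGen b) * siteOp n (suGen c))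

/-- The symmetric state `∑_ρ (N!)^{-1/2} |ρ⟩`. -/
def symState (N : ℕ) : SpinSpace N :=
  funKet N fun _ => ((1 / Real.sqrt (Nat.factorial N) : ℝ) : ℂ)

/-- The vector `(K^{(j,j)} - L^{(j,j)}) |symmetric state⟩`, for the label `j + 1 = 1, …, N - 1`. -/
def loweredState {N : ℕ} (z : Fin N → ℝ) (j : Fin (N - 1)) : SpinSpace N :=
  (ladderK z (j.castLE (Nat.sub_le N 1), j.castLE (Nat.sub_le N 1)) -
    ladderL z (j.castLE (Nat.sub_le N 1), j.castLE (Nat.sub_le N 1))) (symState N)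

end DunklA

end

open DunklA

/-!
Everything is governed by the points `z_1 < ⋯ < z_N` at which
`exp (-‖x‖ ^ 2 / 2) ∏_{i < j} (x_j - x_i)` is largest on the Weyl chamber.

**The points.** At a maximum the logarithmic derivatives vanish, which is the Stieltjes equilibrium
`∑_{j ≠ i} 1 / (z_i - z_j) = z_i` (`isNode_of_isMaxOn`). Then `∏ (X - z_i)` solves the Hermite
differential equation, and the symmetry of the Hermite operator for the weight `exp (-x ^ 2)` makes
it orthogonal to all polynomials of lower degree. So it is proportional to `H_N`
(`IsHermiteFamily.eq_nodePoly`): the maximizer consists of the zeros of `H_N`, and it is unique.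
This gives the existence, reality and simplicity of the zeros as well.

**The frozen limit.** After rescaling by `√β`, the rate is `1 / 2` times the mean of
`1 / (x_j - x_i) ^ 2` for the density proportional to the power `β` of the weight (`jumpRate_eq`).
By Laplace's method this density concentrates at the maximizer (`tendsto_jumpRate`).

**The spectrum.** On functions of a permutation the limiting generator exchanges particles. Its
commutator with multiplication by the position of a particle is computed from the equilibrium
condition (`frozenGen_position_mul`): a position lowers the eigenvalue by `1 / 2`, up to terms of
lower degree. Hence the generator is triangular for the filtration by the degree in the positions,
with diagonal entries `-k / 2` (`frozenGen_add_mem`). Every function on `S_N` is a polynomial in the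
positions, so the eigenvalues are among the `-k / 2`; the eigenspaces for `k = 0` and `k = 1` are
the constants and the span of the positions, whose only relation is that their sum vanishes.

**The ladder operators.** The Fierz identity for the `su(N)` generators turns `L^a` into the hopping
operator `-∑_{m ≠ n} (z_m - z_n)⁻¹ J^a_m P_{m,n}` (`ladderL_eq`). The commutator with `K^a` is then
immediate, and the commutator with `L^a` reduces to the sum rule
`∑_{j ≠ i} (z_i - z_j)⁻³ = z_i / 2` (`IsNode.sum_inv_cube`). On the symmetric state the exchange
operators are trivial, and the equilibrium condition gives `L^a = -K^a` there; so the lowered state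
with a diagonal label is a linear function of the positions, and completeness of the diagonal
generators makes these states a basis of the span of the positions. An off-diagonal generator always
repeats a label, so it leads out of the span of the permutation kets unless it gives zero. For
`K^a ± L^a` the coefficient of such a ket is proportional to `z_m ± (z_m - z_n)⁻¹`
(`coord_ladder_ket`), which cannot vanish for all `m ≠ n`, except for the minus sign and `N = 2`.
-/

namespace DunklA

/-! ### Sum rules for points in Stieltjes equilibrium -/

section Nodes

variable {K : Type*} [Field K] {N : ℕ}

/-- Distinct points in Stieltjes equilibrium: `∑_{j ≠ i} 1 / (z_i - z_j) = z_i` for every `i`. The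
term `j = i` may stay in the sum, because the inverse of zero is zero. The field is left general,
since the configuration is used over `ℝ` for the rates and over `ℂ` for the spin chain. -/
def IsNode (z : Fin N → K) : Prop :=
  Function.Injective z ∧ ∀ i, ∑ j, (z i - z j)⁻¹ = z i

theorem inv_sub_antisymm (z : Fin N → K) (i j : Fin N) : (z i - z j)⁻¹ = -(z j - z i)⁻¹ := by
  rw [← neg_sub, inv_neg]

theorem sum_posPairs_add_self {E : Type*} [AddCommMonoid E] (g : Fin N → Fin N → E)
    (hs : ∀ i j, g i j = g j i) (h0 : ∀ i, g i i = 0) :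
    ∑ p ∈ posPairs N, g p.1 p.2 + ∑ p ∈ posPairs N, g p.1 p.2 = ∑ i, ∑ j, g i j := by
  rw [← Fintype.sum_prod_type' (f := g), ← Finset.sum_filter_add_sum_filter_not
    Finset.univ (fun p : Fin N × Fin N => p.1 < p.2)]
  congr 1
  rw [← Finset.sum_filter_add_sum_filter_not
    (Finset.univ.filter fun p : Fin N × Fin N => ¬ p.1 < p.2) (fun p => p.2 < p.1)]
  rw [Finset.sum_eq_zero (s := Finset.filter (fun p : Fin N × Fin N => ¬ p.2 < p.1) _), add_zero]
  · refine Finset.sum_nbij' Prod.swap Prod.swap ?_ ?_ ?_ ?_ ?_ <;> simp [posPairs]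
    · intro a b h; exact ⟨h.le, h⟩
    · intro a b _; exact hs a b
  · rintro ⟨a, b⟩ h
    simp only [Finset.mem_filter, Finset.mem_univ, true_and, not_lt] at h
    rw [le_antisymm h.2 h.1]; exact h0 _

theorem two_mul_sum_posPairs (g : Fin N → Fin N → K) (hs : ∀ i j, g i j = g j i)
    (h0 : ∀ i, g i i = 0) : 2 * ∑ p ∈ posPairs N, g p.1 p.2 = ∑ i, ∑ j, g i j := by
  rw [two_mul, sum_posPairs_add_self g hs h0]

theorem IsNode.ofReal {z : Fin N → ℝ} (hz : IsNode z) : IsNode fun i => (z i : ℂ) := by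
  refine ⟨fun i j h => hz.1 (Complex.ofReal_injective h), fun i => ?_⟩
  have h := congrArg (fun x : ℝ => (x : ℂ)) (hz.2 i)
  simpa using h

theorem IsNode.sum_eq_zero [CharZero K] {z : Fin N → K} (hz : IsNode z) : ∑ i, z i = 0 := by
  have h : ∑ i, z i = -∑ i, z i := by
    calc ∑ i, z i = ∑ i, ∑ j, (z i - z j)⁻¹ := by simp_rw [hz.2]
      _ = ∑ j, ∑ i, (z i - z j)⁻¹ := Finset.sum_comm
      _ = -∑ i, z i := by
        rw [← Finset.sum_neg_distrib]
        refine Finset.sum_congr rfl fun j _ => ?_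
        conv_rhs => rw [← hz.2 j, ← Finset.sum_neg_distrib]
        exact Finset.sum_congr rfl fun i _ => inv_sub_antisymm z i j
  exact self_eq_neg.mp h

/-- For distinct points `z_i`, `z_j`, `z_k` the cyclic sum of products of inverse differences
vanishes; the right-hand side lists what is left, with `0⁻¹ = 0`, when points coincide. -/
theorem inv_sub_mul_cyclic {z : Fin N → K} (hz : Function.Injective z) (i j k : Fin N) :
    (z i - z j)⁻¹ * (z i - z k)⁻¹ + (z j - z k)⁻¹ * (z j - z i)⁻¹
        + (z k - z i)⁻¹ * (z k - z j)⁻¹ =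
      (if i = j then ((z i - z k)⁻¹) ^ 2 else 0) + (if j = k then ((z j - z i)⁻¹) ^ 2 else 0)
        + (if k = i then ((z k - z j)⁻¹) ^ 2 else 0) := by
  by_cases hij : i = j
  · subst hij
    by_cases hik : i = k
    · subst hik; simp
    · simp only [hik, Ne.symm hik, if_true, if_false, sub_self, inv_zero, inv_sub_antisymm z k i]
      ring
  by_cases hjk : j = k
  · subst hjk
    simp only [hij, Ne.symm hij, if_true, if_false, sub_self, inv_zero, inv_sub_antisymm z j i]
    ring
  by_cases hki : k = i
  · subst hki
    simp only [hij, hjk, if_true, if_false, sub_self, inv_zero, inv_sub_antisymm z j k]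
    ring
  have h1 : z i - z j ≠ 0 := sub_ne_zero.mpr fun h => hij (hz h)
  have h2 : z j - z k ≠ 0 := sub_ne_zero.mpr fun h => hjk (hz h)
  have h3 : z k - z i ≠ 0 := sub_ne_zero.mpr fun h => hki (hz h)
  simp only [hij, hjk, hki, if_false]
  rw [inv_sub_antisymm z i k, inv_sub_antisymm z j i, inv_sub_antisymm z k j]
  field_simp
  ring

/-- Both sides equal `∑ z_i ^ 2`, computed from the equilibrium condition in two ways: as the square
of `∑_j 1 / (z_i - z_j)`, and as `∑_j z_i / (z_i - z_j)`. -/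
theorem IsNode.sum_inv_sq [CharZero K] {z : Fin N → K} (hz : IsNode z) :
    ∑ i, ∑ j, ((z i - z j)⁻¹) ^ 2 = (N : K) * (N - 1) / 2 := by
  set w : Fin N → Fin N → K := fun i j => (z i - z j)⁻¹ with hw
  have hanti : ∀ i j, w i j = -w j i := fun i j => inv_sub_antisymm z i j
  -- first way: the triple sum of products of two inverse differences collapses to squares
  have hT : ∑ i, z i ^ 2 = ∑ i, ∑ j, ∑ k, w i j * w i k := by
    refine Finset.sum_congr rfl fun i _ => ?_
    rw [← Finset.sum_mul_sum, hz.2 i, sq]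
  have h3 : 3 * ∑ i, z i ^ 2 = 3 * ∑ i, ∑ j, w i j ^ 2 := by
    have e1 : ∑ i, ∑ j, ∑ k, w i j * w i k = ∑ i, ∑ j, ∑ k, w j k * w j i := by
      rw [Finset.sum_comm]
      refine Finset.sum_congr rfl fun i _ => Finset.sum_congr rfl fun j _ =>
        Finset.sum_congr rfl fun k _ => mul_comm _ _
    have e2 : ∑ i, ∑ j, ∑ k, w i j * w i k = ∑ i, ∑ j, ∑ k, w k i * w k j := by
      rw [Finset.sum_comm]
      rw [show ∑ i, ∑ j, ∑ k, w k i * w k j = ∑ i, ∑ k, ∑ j, w k i * w k j from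
        Finset.sum_congr rfl fun i _ => Finset.sum_comm]
    calc 3 * ∑ i, z i ^ 2
        = ∑ i, ∑ j, ∑ k, (w i j * w i k + w j k * w j i + w k i * w k j) := by
          simp only [Finset.sum_add_distrib]
          rw [← e1, ← e2, hT]; ring
      _ = ∑ i, ∑ j, ∑ k, ((if i = j then (w i k) ^ 2 else 0) + (if j = k then (w j i) ^ 2 else 0)
            + (if k = i then (w k j) ^ 2 else 0)) := by
          simp only [hw, inv_sub_mul_cyclic hz.1]
      _ = 3 * ∑ i, ∑ j, w i j ^ 2 := by
          simp only [Finset.sum_add_distrib, Finset.sum_ite_eq, Finset.sum_ite_eq',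
            Finset.mem_univ, if_true]
          have a1 : ∑ i, ∑ j, ∑ k, (if i = j then (w i k) ^ 2 else 0) = ∑ i, ∑ j, w i j ^ 2 := by
            refine Finset.sum_congr rfl fun i _ => ?_
            rw [Finset.sum_comm]; simp
          rw [a1, Finset.sum_comm (f := fun i j => w j i ^ 2)]
          ring
  have h4 : ∑ i, z i ^ 2 = ∑ i, ∑ j, w i j ^ 2 := mul_left_cancel₀ (by norm_num) h3
  -- second way: antisymmetrize `z_i / (z_i - z_j)`
  have h5 : 2 * ∑ i, z i ^ 2 = (N : K) * (N - 1) := by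
    have b1 : ∑ i, z i ^ 2 = ∑ i, ∑ j, z i * w i j := by
      refine Finset.sum_congr rfl fun i _ => ?_
      rw [← Finset.mul_sum, hz.2 i, sq]
    have b2 : ∑ i, z i ^ 2 = ∑ i, ∑ j, -(z j * w i j) := by
      rw [b1, Finset.sum_comm]
      exact Finset.sum_congr rfl fun i _ => Finset.sum_congr rfl fun j _ => by
        rw [hanti j i]; ring
    calc 2 * ∑ i, z i ^ 2 = ∑ i, ∑ j, (z i * w i j + -(z j * w i j)) := by
          simp only [Finset.sum_add_distrib]
          rw [← b1, ← b2]; ring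
      _ = ∑ i : Fin N, ∑ j : Fin N, (1 - if i = j then (1 : K) else 0) := by
          refine Finset.sum_congr rfl fun i _ => Finset.sum_congr rfl fun j _ => ?_
          by_cases hij : i = j
          · subst hij; simp
          · have : z i - z j ≠ 0 := sub_ne_zero.mpr fun h => hij (hz.1 h)
            rw [if_neg hij, sub_zero, ← mul_inv_cancel₀ this]; ring
      _ = (N : K) * (N - 1) := by
          simp [Finset.sum_sub_distrib, mul_sub]
  rw [← h4, ← h5]; ring

/-- Writing `z_i - z_j` as the difference of two equilibrium sums expresses `1 / (z_i - z_j)` by its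
cube and by terms `1 / ((z_i - z_j) (z_i - z_k) (z_j - z_k))`, which cancel in pairs. -/
theorem IsNode.sum_inv_cube [CharZero K] {z : Fin N → K} (hz : IsNode z) (i : Fin N) :
    ∑ j, ((z i - z j)⁻¹) ^ 3 = z i / 2 := by
  set w : Fin N → Fin N → K := fun i j => (z i - z j)⁻¹ with hw
  have hself : ∀ i, w i i = 0 := fun i => by simp [hw]
  have hanti : ∀ i j, w i j = -w j i := fun i j => inv_sub_antisymm z i j
  have key : ∀ j, w i j = 2 * w i j ^ 3 - ∑ k, w i j * w i k * w j k := by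
    intro j
    by_cases hij : i = j
    · subst hij; simp [hself]
    have hne : z i - z j ≠ 0 := sub_ne_zero.mpr fun h => hij (hz.1 h)
    have e : z i - z j = ∑ k, (w i k - w j k) := by
      rw [Finset.sum_sub_distrib, hz.2 i, hz.2 j]
    have e2 : ∀ k, w i j ^ 2 * (w i k - w j k) =
        (if k = j then w i j ^ 3 else 0) + (if k = i then w i j ^ 3 else 0)
          - w i j * w i k * w j k := by
      intro k
      by_cases hkj : k = j
      · subst hkj; simp [hself, Ne.symm hij]; ring
      by_cases hki : k = i
      · subst hki; simp [hself, hij]; rw [hanti j k]; ring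
      have h2 : z i - z k ≠ 0 := sub_ne_zero.mpr fun h => hki (hz.1 h).symm
      have h3 : z j - z k ≠ 0 := sub_ne_zero.mpr fun h => hkj (hz.1 h).symm
      simp only [hkj, hki, if_false, hw]
      field_simp
      ring
    calc w i j = w i j ^ 2 * (z i - z j) := by simp only [hw]; field_simp
      _ = ∑ k, w i j ^ 2 * (w i k - w j k) := by rw [← Finset.mul_sum, ← e]
      _ = _ := by
        simp only [e2, Finset.sum_sub_distrib, Finset.sum_add_distrib, Finset.sum_ite_eq',
          Finset.mem_univ, if_true]
        ring
  have hz0 : ∑ j, ∑ k, w i j * w i k * w j k = 0 := by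
    refine self_eq_neg.mp ?_
    conv_lhs => rw [Finset.sum_comm]
    rw [← Finset.sum_neg_distrib]
    refine Finset.sum_congr rfl fun j _ => ?_
    rw [← Finset.sum_neg_distrib]
    refine Finset.sum_congr rfl fun k _ => ?_
    rw [hanti k j]; ring
  have := hz.2 i
  change ∑ j, w i j = z i at this
  rw [Finset.sum_congr rfl fun j _ => key j, Finset.sum_sub_distrib, hz0, ← Finset.mul_sum] at this
  linear_combination this / 2

theorem IsNode.sum_posPairs [CharZero K] {z : Fin N → K} (hz : IsNode z) :
    ∑ p ∈ posPairs N, ((z p.2 - z p.1)⁻¹) ^ 2 = (N : K) * (N - 1) / 4 := by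
  have := two_mul_sum_posPairs (fun i j => ((z j - z i)⁻¹) ^ 2)
    (fun i j => by rw [inv_sub_antisymm z i j]; ring) (fun i => by simp)
  rw [Finset.sum_comm, hz.sum_inv_sq] at this
  linear_combination this / 2

end Nodes

/-! ### Spectrum of the frozen generator -/

section Spectrum

variable {K : Type*} {N : ℕ}

/-- The coordinate function `τ ↦ z_{τ⁻¹(i)}` on permutations: if the particle `τ(m)` sits at the
site `z_m`, this is the position of the particle `i`. -/
def position (z : Fin N → K) (i : Fin N) : Equiv.Perm (Fin N) → K := fun τ => z (τ⁻¹ i)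

theorem position_swap_mul (z : Fin N → K) (i j m : Fin N) (τ : Equiv.Perm (Fin N)) :
    position z m (Equiv.swap i j * τ) = position z (Equiv.swap i j m) τ := by
  simp [position, mul_inv_rev]

theorem position_injective {z : Fin N → K} (hz : Function.Injective z) (τ : Equiv.Perm (Fin N)) :
    Function.Injective fun i => position z i τ := fun _ _ h => τ⁻¹.injective (hz h)

variable [Field K]

/-- The difference quotient of a function on permutations along the exchange of the particles `i`
and `j`. It is zero for `i = j`, because `0⁻¹ = 0`. -/
def dividedDiff (z : Fin N → K) (i j : Fin N) :
    (Equiv.Perm (Fin N) → K) →ₗ[K] (Equiv.Perm (Fin N) → K) where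
  toFun f τ := (position z i τ - position z j τ)⁻¹ * (f (Equiv.swap i j * τ) - f τ)
  map_add' f g := by ext τ; simp; ring
  map_smul' c f := by ext τ; simp; ring

theorem dividedDiff_apply (z : Fin N → K) (i j : Fin N) (f : Equiv.Perm (Fin N) → K)
    (τ : Equiv.Perm (Fin N)) : dividedDiff z i j f τ =
      (position z i τ - position z j τ)⁻¹ * (f (Equiv.swap i j * τ) - f τ) := rfl

/-- The generator of the frozen jump process, written with particle labels: the particles `i` and
`j` are exchanged at the rate `1 / (2 (x_i - x_j) ^ 2)`, where `x_i` is the position of `i`. The sum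
runs over ordered pairs, whence the factor `1 / 4`. Over a general field it also serves as the
complexification. -/
def frozenGen (z : Fin N → K) :
    (Equiv.Perm (Fin N) → K) →ₗ[K] (Equiv.Perm (Fin N) → K) where
  toFun f τ := 1 / 4 * ∑ i, ∑ j, ((position z i τ - position z j τ)⁻¹) ^ 2 *
    (f (Equiv.swap i j * τ) - f τ)
  map_add' f g := by
    ext τ
    simp only [Pi.add_apply, ← mul_add, ← Finset.sum_add_distrib]
    congr 1
    exact Finset.sum_congr rfl fun i _ => Finset.sum_congr rfl fun j _ => by ring
  map_smul' c f := by
    ext τ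
    simp only [Pi.smul_apply, smul_eq_mul, RingHom.id_apply, Finset.mul_sum]
    exact Finset.sum_congr rfl fun i _ => Finset.sum_congr rfl fun j _ => by ring

theorem frozenGen_apply (z : Fin N → K) (f : Equiv.Perm (Fin N) → K)
    (τ : Equiv.Perm (Fin N)) : frozenGen z f τ =
      1 / 4 * ∑ i, ∑ j, ((position z i τ - position z j τ)⁻¹) ^ 2 *
        (f (Equiv.swap i j * τ) - f τ) := rfl

/-- The same generator with exchanges of sites, that is, right multiplication by transpositions. -/
theorem frozenGen_apply_eq_sum_posPairs [CharZero K] (z : Fin N → K)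
    (f : Equiv.Perm (Fin N) → K) (τ : Equiv.Perm (Fin N)) : frozenGen z f τ =
      1 / 2 * ∑ p ∈ posPairs N, ((z p.2 - z p.1)⁻¹) ^ 2 * (f (τ * Equiv.swap p.2 p.1) - f τ) := by
  have h := two_mul_sum_posPairs
    (fun a b => ((z b - z a)⁻¹) ^ 2 * (f (τ * Equiv.swap b a) - f τ))
    (fun i j => by rw [inv_sub_antisymm z i j, Equiv.swap_comm]; ring) (fun i => by simp)
  have h2 : ∑ i, ∑ j, ((position z i τ - position z j τ)⁻¹) ^ 2 *
        (f (Equiv.swap i j * τ) - f τ) =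
      ∑ a, ∑ b, ((z b - z a)⁻¹) ^ 2 * (f (τ * Equiv.swap b a) - f τ) := by
    rw [← Equiv.sum_comp τ]
    refine Finset.sum_congr rfl fun a _ => ?_
    rw [← Equiv.sum_comp τ]
    refine Finset.sum_congr rfl fun b _ => ?_
    have hinv : ∀ c, τ⁻¹ (τ c) = c := τ.symm_apply_apply
    simp only [position, hinv]
    rw [inv_sub_antisymm z a b, Equiv.swap_comm, Equiv.mul_swap_eq_swap_mul]; ring
  rw [frozenGen_apply, h2, ← h]; ring

theorem IsNode.sum_inv_position {z : Fin N → K} (hz : IsNode z) (m : Fin N)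
    (τ : Equiv.Perm (Fin N)) :
    ∑ j, (position z m τ - position z j τ)⁻¹ = position z m τ := by
  simp only [position]
  rw [Equiv.sum_comp τ⁻¹ (fun j => (z (τ⁻¹ m) - z j)⁻¹), hz.2]

/-- The product rule for divided differences. -/
theorem dividedDiff_position_mul {z : Fin N → K} (hz : Function.Injective z) (i j m : Fin N)
    (f : Equiv.Perm (Fin N) → K) :
    dividedDiff z i j (position z m * f) =
      position z (Equiv.swap i j m) * dividedDiff z i j f +
        (if i = j then (0 : K) else if m = i then -1 else if m = j then 1 else 0) • f := by
  ext τ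
  simp only [dividedDiff_apply, Pi.mul_apply, Pi.add_apply, Pi.smul_apply, smul_eq_mul,
    position_swap_mul]
  by_cases hij : i = j
  · subst hij; simp
  have hne : position z i τ - position z j τ ≠ 0 :=
    sub_ne_zero.mpr fun h => hij (position_injective hz τ h)
  rw [if_neg hij]
  by_cases hmi : m = i
  · subst hmi
    rw [Equiv.swap_apply_left, if_pos rfl]; field_simp; ring
  by_cases hmj : m = j
  · subst hmj
    rw [Equiv.swap_apply_right, if_neg hmi, if_pos rfl]; field_simp; ring
  · rw [Equiv.swap_apply_of_ne_of_ne hmi hmj, if_neg hmi, if_neg hmj]; ring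

/-- The commutator of the generator with a position: by the equilibrium condition, multiplication
by a position lowers the eigenvalue by `1 / 2`, up to divided differences, which lower the
degree. -/
theorem frozenGen_position_mul [CharZero K] {z : Fin N → K} (hz : IsNode z) (m : Fin N)
    (f : Equiv.Perm (Fin N) → K) :
    frozenGen z (position z m * f) = position z m * frozenGen z f -
      (1 / 2 : K) • (position z m * f) - (1 / 2 : K) • ∑ j, dividedDiff z m j f := by
  ext τ
  simp only [Pi.sub_apply, Pi.mul_apply, Pi.smul_apply, smul_eq_mul, Finset.sum_apply,
    frozenGen_apply, dividedDiff_apply, position_swap_mul]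
  set X : Fin N → K := fun i => position z i τ
  have hXinj : Function.Injective X := position_injective hz.1 τ
  have hsum : ∑ j, (X m - X j)⁻¹ = X m := hz.sum_inv_position m τ
  change 1 / 4 * ∑ i, ∑ j, ((X i - X j)⁻¹) ^ 2 *
      (X (Equiv.swap i j m) * f (Equiv.swap i j * τ) - X m * f τ) =
    X m * (1 / 4 * ∑ i, ∑ j, ((X i - X j)⁻¹) ^ 2 * (f (Equiv.swap i j * τ) - f τ)) -
      1 / 2 * (X m * f τ) - 1 / 2 * ∑ j, (X m - X j)⁻¹ * (f (Equiv.swap m j * τ) - f τ)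
  -- only the pairs that contain `m` contribute to the commutator with the position of `m`
  have key : ∀ i j, ((X i - X j)⁻¹) ^ 2 *
      (X (Equiv.swap i j m) * f (Equiv.swap i j * τ) - X m * f τ) =
      X m * (((X i - X j)⁻¹) ^ 2 * (f (Equiv.swap i j * τ) - f τ))
        - (if i = m then (X m - X j)⁻¹ * f (Equiv.swap m j * τ) else 0)
        - (if j = m then (X m - X i)⁻¹ * f (Equiv.swap m i * τ) else 0) := by
    intro i j
    by_cases hij : i = j
    · subst hij
      by_cases him : i = m
      · subst him; simp
      · simp [him]
    have hne : X i - X j ≠ 0 := sub_ne_zero.mpr fun h => hij (hXinj h)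
    by_cases him : i = m
    · subst him
      rw [if_pos rfl, if_neg (Ne.symm hij), Equiv.swap_apply_left]; field_simp; ring
    by_cases hjm : j = m
    · subst hjm
      rw [if_pos rfl, if_neg hij, Equiv.swap_apply_right, Equiv.swap_comm i j,
        inv_sub_antisymm X j i]
      field_simp; ring
    · rw [if_neg him, if_neg hjm, Equiv.swap_apply_of_ne_of_ne (Ne.symm him) (Ne.symm hjm)]; ring
  simp only [key, Finset.sum_sub_distrib, ← Finset.mul_sum, Finset.sum_ite_eq', Finset.mem_univ,
    if_true, mul_sub, ← Finset.sum_mul, hsum]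
  have e1 : ∑ i, ∑ j, (if i = m then (X m - X j)⁻¹ * f (Equiv.swap m j * τ) else 0) =
      ∑ j, (X m - X j)⁻¹ * f (Equiv.swap m j * τ) := by
    rw [Finset.sum_comm]; simp
  rw [e1]; ring

/-- The functions on permutations that are polynomials of degree at most `k` in the positions. -/
def positionFiltration (z : Fin N → K) : ℕ → Submodule K (Equiv.Perm (Fin N) → K)
  | 0 => Submodule.span K {1}
  | k + 1 => positionFiltration z k ⊔
      ⨆ i, (positionFiltration z k).map (LinearMap.mulLeft K (position z i))

theorem positionFiltration_le_succ (z : Fin N → K) (k : ℕ) :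
    positionFiltration z k ≤ positionFiltration z (k + 1) := le_sup_left

theorem positionFiltration_mono (z : Fin N → K) : Monotone (positionFiltration z) :=
  monotone_nat_of_le_succ (positionFiltration_le_succ z)

theorem position_mul_mem {z : Fin N → K} {k : ℕ} {f : Equiv.Perm (Fin N) → K}
    (hf : f ∈ positionFiltration z k) (i : Fin N) :
    position z i * f ∈ positionFiltration z (k + 1) :=
  Submodule.mem_sup_right (Submodule.mem_iSup_of_mem i ⟨f, hf, rfl⟩)

theorem positionFiltration_succ_le {z : Fin N → K} {k : ℕ}
    {S : Submodule K (Equiv.Perm (Fin N) → K)}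
    (h0 : ∀ f ∈ positionFiltration z k, f ∈ S)
    (h1 : ∀ f ∈ positionFiltration z k, ∀ i, position z i * f ∈ S) :
    positionFiltration z (k + 1) ≤ S := by
  refine sup_le h0 (iSup_le fun i => ?_)
  rintro _ ⟨f, hf, rfl⟩
  exact h1 f hf i

theorem dividedDiff_eq_zero {z : Fin N → K} {f : Equiv.Perm (Fin N) → K}
    (hf : f ∈ positionFiltration z 0) (i j : Fin N) : dividedDiff z i j f = 0 := by
  obtain ⟨c, rfl⟩ := Submodule.mem_span_singleton.mp hf
  ext τ; simp [dividedDiff_apply]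

theorem dividedDiff_mem {z : Fin N → K} (hz : Function.Injective z) (k : ℕ)
    {f : Equiv.Perm (Fin N) → K} (hf : f ∈ positionFiltration z (k + 1)) (i j : Fin N) :
    dividedDiff z i j f ∈ positionFiltration z k := by
  induction k generalizing f with
  | zero =>
    suffices h : positionFiltration z (0 + 1) ≤
        (positionFiltration z 0).comap (dividedDiff z i j) from h hf
    refine positionFiltration_succ_le (fun f hf => ?_) (fun f hf m => ?_)
    · simp [dividedDiff_eq_zero hf]
    · rw [Submodule.mem_comap, dividedDiff_position_mul hz, dividedDiff_eq_zero hf, mul_zero,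
        zero_add]
      exact Submodule.smul_mem _ _ hf
  | succ k ih =>
    suffices h : positionFiltration z (k + 1 + 1) ≤
        (positionFiltration z (k + 1)).comap (dividedDiff z i j) from h hf
    refine positionFiltration_succ_le (fun f hf => ?_) (fun f hf m => ?_)
    · exact positionFiltration_le_succ z k (ih hf)
    · rw [Submodule.mem_comap, dividedDiff_position_mul hz]
      exact add_mem (position_mul_mem (ih hf) _) (Submodule.smul_mem _ _ hf)

theorem frozenGen_eq_zero {z : Fin N → K} {f : Equiv.Perm (Fin N) → K}
    (hf : f ∈ positionFiltration z 0) : frozenGen z f = 0 := by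
  obtain ⟨c, rfl⟩ := Submodule.mem_span_singleton.mp hf
  ext τ; simp [frozenGen_apply]

/-- The generator preserves the degree filtration and acts on the quotient of degree `k` as the
scalar `-k / 2`. -/
theorem frozenGen_add_mem [CharZero K] {z : Fin N → K} (hz : IsNode z) (k : ℕ)
    {f : Equiv.Perm (Fin N) → K} (hf : f ∈ positionFiltration z (k + 1)) :
    frozenGen z f + (((k + 1 : ℕ) : K) / 2) • f ∈ positionFiltration z k := by
  induction k generalizing f with
  | zero =>
    suffices h : positionFiltration z (0 + 1) ≤ (positionFiltration z 0).comap
        (frozenGen z + (((0 + 1 : ℕ) : K) / 2) • LinearMap.id) from h hf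
    refine positionFiltration_succ_le (fun f hf => ?_) (fun f hf m => ?_)
    · rw [Submodule.mem_comap, LinearMap.add_apply, frozenGen_eq_zero hf, zero_add]
      exact Submodule.smul_mem _ _ hf
    · simp [frozenGen_position_mul hz, frozenGen_eq_zero hf, dividedDiff_eq_zero hf]
  | succ k ih =>
    suffices h : positionFiltration z (k + 1 + 1) ≤ (positionFiltration z (k + 1)).comap
        (frozenGen z + (((k + 1 + 1 : ℕ) : K) / 2) • LinearMap.id) from h hf
    refine positionFiltration_succ_le (fun f hf => ?_) (fun f hf m => ?_)
    · have e : frozenGen z f + (((k + 1 + 1 : ℕ) : K) / 2) • f =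
          (frozenGen z f + (((k + 1 : ℕ) : K) / 2) • f) + (1 / 2 : K) • f := by
        push_cast; module
      change frozenGen z f + (((k + 1 + 1 : ℕ) : K) / 2) • f ∈ positionFiltration z (k + 1)
      rw [e]
      exact add_mem (positionFiltration_le_succ z k (ih hf)) (Submodule.smul_mem _ _ hf)
    · have e : frozenGen z (position z m * f) + (((k + 1 + 1 : ℕ) : K) / 2) • (position z m * f) =
          position z m * (frozenGen z f + (((k + 1 : ℕ) : K) / 2) • f) -
            (1 / 2 : K) • ∑ j, dividedDiff z m j f := by
        rw [frozenGen_position_mul hz, mul_add, mul_smul_comm]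
        push_cast; module
      change frozenGen z (position z m * f) +
        (((k + 1 + 1 : ℕ) : K) / 2) • (position z m * f) ∈ positionFiltration z (k + 1)
      rw [e]
      exact sub_mem (position_mul_mem (ih hf) m) (Submodule.smul_mem _ _
        (positionFiltration_le_succ z k (sum_mem fun j _ => dividedDiff_mem hz.1 k hf m j)))

theorem exists_mul_mem_of_mem_adjoin {z : Fin N → K} {g : Equiv.Perm (Fin N) → K}
    (hg : g ∈ Algebra.adjoin K (Set.range (position z))) :
    ∀ f, (∃ k, f ∈ positionFiltration z k) → ∃ k, g * f ∈ positionFiltration z k := by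
  induction hg using Algebra.adjoin_induction with
  | mem x hx =>
    obtain ⟨i, rfl⟩ := hx
    rintro f ⟨k, hk⟩
    exact ⟨k + 1, position_mul_mem hk i⟩
  | algebraMap r =>
    rintro f ⟨k, hk⟩
    exact ⟨k, by rw [← Algebra.smul_def]; exact Submodule.smul_mem _ _ hk⟩
  | add x y _ _ hx hy =>
    intro f hf
    obtain ⟨k, hk⟩ := hx f hf
    obtain ⟨l, hl⟩ := hy f hf
    refine ⟨max k l, ?_⟩
    rw [add_mul]
    exact add_mem (positionFiltration_mono z (le_max_left k l) hk)
      (positionFiltration_mono z (le_max_right k l) hl)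
  | mul x y _ _ hx hy =>
    intro f hf
    rw [mul_assoc]
    exact hx _ (hy f hf)

/-- The positions separate the permutations, so every function is a polynomial in them. -/
theorem exists_mem_positionFiltration {z : Fin N → K} (hz : Function.Injective z)
    (f : Equiv.Perm (Fin N) → K) : ∃ k, f ∈ positionFiltration z k := by
  have hsingle : ∀ τ₀ : Equiv.Perm (Fin N),
      Pi.single τ₀ (1 : K) ∈ Algebra.adjoin K (Set.range (position z)) := by
    intro τ₀
    set A := Algebra.adjoin K (Set.range (position z))
    set g : Equiv.Perm (Fin N) → K :=
      ∏ i, ∏ b ∈ Finset.univ.erase (τ₀⁻¹ i), (position z i - algebraMap K _ (z b)) with hg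
    have hgA : g ∈ A := prod_mem fun i _ => prod_mem fun b _ =>
      sub_mem (Algebra.subset_adjoin ⟨i, rfl⟩) (A.algebraMap_mem _)
    have hgval : ∀ τ, g τ = ∏ i, ∏ b ∈ Finset.univ.erase (τ₀⁻¹ i), (z (τ⁻¹ i) - z b) := by
      intro τ; simp [hg, Finset.prod_apply, position]
    have h0 : g τ₀ ≠ 0 := by
      rw [hgval]
      refine Finset.prod_ne_zero_iff.mpr fun i _ => Finset.prod_ne_zero_iff.mpr fun b hb => ?_
      exact sub_ne_zero.mpr fun h => (Finset.ne_of_mem_erase hb) (hz h).symm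
    have : Pi.single τ₀ (1 : K) = (g τ₀)⁻¹ • g := by
      ext τ
      by_cases h : τ = τ₀
      · subst h; simp [h0]
      · rw [Pi.single_eq_of_ne h, Pi.smul_apply, smul_eq_mul, hgval τ]
        have : ∃ i, τ⁻¹ i ≠ τ₀⁻¹ i := by
          by_contra! hc
          exact h (inv_injective (Equiv.ext hc))
        obtain ⟨i, hi⟩ := this
        rw [Finset.prod_eq_zero (Finset.mem_univ i), mul_zero]
        exact Finset.prod_eq_zero (Finset.mem_erase.mpr ⟨hi, Finset.mem_univ _⟩) (sub_self _)
    rw [this]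
    exact A.smul_mem hgA _
  have hf : f ∈ Algebra.adjoin K (Set.range (position z)) := by
    have : f = ∑ τ, f τ • Pi.single τ (1 : K) := by
      ext τ; simp [Finset.sum_apply, Pi.single_apply]
    rw [this]
    exact sum_mem fun τ _ => Subalgebra.smul_mem _ (hsingle τ) _
  obtain ⟨k, hk⟩ := exists_mul_mem_of_mem_adjoin hf 1 ⟨0, Submodule.mem_span_singleton_self 1⟩
  exact ⟨k, by rwa [mul_one] at hk⟩

/-- By triangularity, an eigenfunction whose exact degree is `k` has the eigenvalue `-k / 2`. -/
theorem exists_level_of_frozenGen_eq [CharZero K] {z : Fin N → K} (hz : IsNode z)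
    {f : Equiv.Perm (Fin N) → K} (hf : f ≠ 0) {r : K} (h : frozenGen z f = r • f) :
    ∃ k : ℕ, r = -(k : K) / 2 ∧ f ∈ positionFiltration z k := by
  classical
  have hex := exists_mem_positionFiltration hz.1 f
  refine ⟨Nat.find hex, ?_, Nat.find_spec hex⟩
  have hmem := Nat.find_spec hex
  rcases hk : Nat.find hex with _ | k
  · rw [hk] at hmem
    rw [frozenGen_eq_zero hmem] at h
    simpa using (smul_eq_zero.mp h.symm).resolve_right hf
  · rw [hk] at hmem
    have h1 := frozenGen_add_mem hz k hmem
    rw [h, ← add_smul] at h1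
    by_contra hne
    have hne' : r + ((k + 1 : ℕ) : K) / 2 ≠ 0 := fun h0 => hne (by linear_combination h0)
    have h2 : f ∈ positionFiltration z k := by
      have := Submodule.smul_mem _ (r + ((k + 1 : ℕ) : K) / 2)⁻¹ h1
      rwa [smul_smul, inv_mul_cancel₀ hne', one_smul] at this
    exact absurd (Nat.find_min' hex h2) (by omega)

theorem frozenGen_position [CharZero K] {z : Fin N → K} (hz : IsNode z) (m : Fin N) :
    frozenGen z (position z m) = (-1 / 2 : K) • position z m := by
  have h1 : (1 : Equiv.Perm (Fin N) → K) ∈ positionFiltration z 0 :=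
    Submodule.mem_span_singleton_self 1
  have := frozenGen_position_mul hz m 1
  rw [frozenGen_eq_zero h1] at this
  simp only [dividedDiff_eq_zero h1, mul_one, mul_zero, Finset.sum_const_zero, smul_zero] at this
  rw [this]; module

theorem eigenspace_frozenGen_zero [CharZero K] {z : Fin N → K} (hz : IsNode z) :
    Module.End.eigenspace (frozenGen z) 0 = Submodule.span K {1} := by
  ext f
  rw [Module.End.mem_eigenspace_iff, zero_smul]
  refine ⟨fun h => ?_, fun h => frozenGen_eq_zero (z := z) h⟩
  by_cases hf : f = 0
  · rw [hf]; exact zero_mem _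
  obtain ⟨k, hk, hmem⟩ := exists_level_of_frozenGen_eq hz hf (r := 0) (by simpa using h)
  have : k = 0 := by
    have : (k : K) = 0 := by linear_combination 2 * hk
    exact_mod_cast this
  subst this
  exact hmem

theorem eigenspace_frozenGen_neg_half [CharZero K] {z : Fin N → K} (hz : IsNode z) :
    Module.End.eigenspace (frozenGen z) (-1 / 2) = Submodule.span K (Set.range (position z)) := by
  apply le_antisymm
  · intro f hf
    rw [Module.End.mem_eigenspace_iff] at hf
    by_cases hf0 : f = 0
    · rw [hf0]; exact zero_mem _
    obtain ⟨k, hk, hmem⟩ := exists_level_of_frozenGen_eq hz hf0 hf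
    have : k = 1 := by
      have : (k : K) = 1 := by linear_combination 2 * hk
      exact_mod_cast this
    subst this
    have hle : positionFiltration z (0 + 1) ≤
        Submodule.span K {1} ⊔ Submodule.span K (Set.range (position z)) := by
      refine positionFiltration_succ_le (fun f hf => Submodule.mem_sup_left hf) (fun f hf i => ?_)
      obtain ⟨c, rfl⟩ := Submodule.mem_span_singleton.mp hf
      refine Submodule.mem_sup_right ?_
      rw [mul_smul_comm, mul_one]
      exact Submodule.smul_mem _ _ (Submodule.subset_span ⟨i, rfl⟩)
    obtain ⟨u, hu, v, hv, rfl⟩ := Submodule.mem_sup.mp (hle hmem)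
    have hv' : frozenGen z v = (-1 / 2 : K) • v := by
      have : Submodule.span K (Set.range (position z)) ≤
          Module.End.eigenspace (frozenGen z) (-1 / 2) := by
        rw [Submodule.span_le]
        rintro _ ⟨i, rfl⟩
        exact Module.End.mem_eigenspace_iff.mpr (frozenGen_position hz i)
      exact Module.End.mem_eigenspace_iff.mp (this hv)
    rw [map_add, frozenGen_eq_zero (z := z) hu, hv', zero_add, smul_add, eq_comm,
      add_eq_right, smul_eq_zero] at hf
    have : u = 0 := hf.resolve_left (by norm_num)
    rwa [this, zero_add]
  · rw [Submodule.span_le]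
    rintro _ ⟨i, rfl⟩
    exact Module.End.mem_eigenspace_iff.mpr (frozenGen_position hz i)

theorem IsNode.sum_position [CharZero K] {z : Fin N → K} (hz : IsNode z) :
    ∑ i, position z i = 0 := by
  ext τ
  simp only [Finset.sum_apply, position, Pi.zero_apply]
  rw [Equiv.sum_comp τ⁻¹ z, hz.sum_eq_zero]

/-- The only linear relation between the positions is that their sum vanishes. -/
theorem finrank_span_position [CharZero K] {z : Fin N → K} (hz : IsNode z) :
    Module.finrank K (Submodule.span K (Set.range (position z))) = N - 1 := by
  rcases Nat.eq_zero_or_pos N with rfl | hN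
  · have : Set.range (position z) = ∅ := Set.range_eq_empty _
    rw [this]; simp
  have hrange := Fintype.range_linearCombination K (position z)
  rw [← hrange]
  have hker : LinearMap.ker (Fintype.linearCombination K (position z)) =
      Submodule.span K {(1 : Fin N → K)} := by
    ext b
    rw [LinearMap.mem_ker, Submodule.mem_span_singleton, Fintype.linearCombination_apply]
    constructor
    · intro h
      refine ⟨b ⟨0, hN⟩, ?_⟩
      ext i
      have hv : ∀ τ : Equiv.Perm (Fin N), ∑ l, b l * z (τ⁻¹ l) = 0 := by
        intro τ
        have := congrFun h τ
        simpa [Finset.sum_apply, position] using this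
      by_cases hi : i = ⟨0, hN⟩
      · subst hi; simp
      set o : Fin N := ⟨0, hN⟩
      -- compare the identity with the transposition of the two indices
      have h1 := hv 1
      have h2 := hv (Equiv.swap i o)
      have h3 : ∑ l, b l * (z ((1 : Equiv.Perm (Fin N))⁻¹ l) - z ((Equiv.swap i o)⁻¹ l)) = 0 := by
        simp only [mul_sub, Finset.sum_sub_distrib, h1, h2, sub_self]
      rw [Fintype.sum_eq_add i o hi] at h3
      · simp at h3
        have : (b i - b o) * (z i - z o) = 0 := by linear_combination h3
        rcases mul_eq_zero.mp this with h | h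
        · simp; linear_combination -h
        · exact absurd (hz.1 (sub_eq_zero.mp h)) hi
      · rintro x ⟨hx1, hx2⟩
        simp [Equiv.swap_apply_of_ne_of_ne hx1 hx2]
    · rintro ⟨c, rfl⟩
      simp only [Pi.smul_apply, Pi.one_apply, smul_eq_mul, mul_one]
      rw [← Finset.smul_sum, hz.sum_position, smul_zero]
  have h := LinearMap.finrank_range_add_finrank_ker (Fintype.linearCombination K (position z))
  have h1 : (1 : Fin N → K) ≠ 0 := fun h => one_ne_zero (congrFun h ⟨0, hN⟩)
  rw [hker, finrank_span_singleton h1] at h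
  simp at h
  omega

theorem exists_eq_of_hasEigenvalue_frozenGen [CharZero K] {z : Fin N → K}
    (hz : IsNode z) {r : K} (h : Module.End.HasEigenvalue (frozenGen z) r) :
    ∃ k : ℕ, r = -(k : K) / 2 := by
  obtain ⟨f, hf⟩ := h.exists_hasEigenvector
  obtain ⟨k, hk, -⟩ := exists_level_of_frozenGen_eq hz hf.2 hf.apply_eq_smul
  exact ⟨k, hk⟩

theorem isGreatest_hasEigenvalue_frozenGen {z : Fin N → ℝ} (hz : IsNode z) :
    IsGreatest {r : ℝ | Module.End.HasEigenvalue (frozenGen z) r} 0 := by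
  constructor
  · rw [Set.mem_ofPred_eq, Module.End.hasEigenvalue_iff, eigenspace_frozenGen_zero hz, Ne,
      Submodule.span_singleton_eq_bot]
    exact one_ne_zero
  · rintro r hr
    obtain ⟨k, rfl⟩ := exists_eq_of_hasEigenvalue_frozenGen hz hr
    have : (0 : ℝ) ≤ k := k.cast_nonneg
    linarith

theorem isGreatest_hasEigenvalue_ne_zero_frozenGen (hN : 2 ≤ N) {z : Fin N → ℝ}
    (hz : IsNode z) :
    IsGreatest {r : ℝ | r ≠ 0 ∧ Module.End.HasEigenvalue (frozenGen z) r} (-1 / 2) := by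
  constructor
  · refine ⟨by norm_num, ?_⟩
    rw [Module.End.hasEigenvalue_iff, eigenspace_frozenGen_neg_half hz]
    intro h
    have h1 := finrank_span_position hz
    rw [h, finrank_bot] at h1
    omega
  · rintro r ⟨hr0, hr⟩
    obtain ⟨k, rfl⟩ := exists_eq_of_hasEigenvalue_frozenGen hz hr
    have hk : 1 ≤ k := by
      rw [Nat.one_le_iff_ne_zero]
      rintro rfl
      simp at hr0
    have : (1 : ℝ) ≤ k := by exact_mod_cast hk
    linarith

end Spectrum

/-! ### Coordinates, exchange operators and one-site operators on the spin space -/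

section SpinSpace

variable {N : ℕ}

/-- The basis of the spin space that consists of the vectors `|n_1, …, n_N⟩`. -/
noncomputable def ketBasis (N : ℕ) : Module.Basis (Fin N → Fin N) ℂ (SpinSpace N) :=
  Basis.piTensorProduct fun _ => Pi.basisFun ℂ (Fin N)

theorem ketBasis_apply (n : Fin N → Fin N) : ketBasis N n = ket n := by
  simp [ketBasis, ket, Basis.piTensorProduct_apply]

/-- The coordinate `⟨ν_1, …, ν_N | ·⟩` of a vector in the basis of kets. -/
noncomputable def coord (ν : Fin N → Fin N) : SpinSpace N →ₗ[ℂ] ℂ := (ketBasis N).coord ν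

theorem coord_tprod (ν : Fin N → Fin N) (x : Fin N → Fin N → ℂ) :
    coord ν (PiTensorProduct.tprod ℂ x) = ∏ i, x i (ν i) := by
  simp [coord, ketBasis, Basis.piTensorProduct_repr_tprod_apply]

theorem coord_ket (ν n : Fin N → Fin N) : coord ν (ket n) = if n = ν then 1 else 0 := by
  rw [← ketBasis_apply, coord, Module.Basis.coord_apply, Module.Basis.repr_self,
    Finsupp.single_apply]

theorem ext_coord {u v : SpinSpace N} (h : ∀ ν, coord ν u = coord ν v) : u = v :=
  (ketBasis N).ext_elem h

theorem coord_siteOp (ν : Fin N → Fin N) (m : Fin N) (A : Matrix (Fin N) (Fin N) ℂ)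
    (v : SpinSpace N) :
    coord ν (siteOp m A v) = ∑ k, A (ν m) k * coord (Function.update ν m k) v := by
  suffices h : coord ν ∘ₗ siteOp m A = ∑ k, A (ν m) k • coord (Function.update ν m k) by
    have := LinearMap.congr_fun h v
    simpa [LinearMap.sum_apply] using this
  refine PiTensorProduct.ext (MultilinearMap.ext fun x => ?_)
  simp only [LinearMap.compMultilinearMap_apply, LinearMap.comp_apply, siteOp,
    PiTensorProduct.map_tprod, coord_tprod, LinearMap.sum_apply, LinearMap.smul_apply,
    smul_eq_mul]
  have h1 : ∀ k, ∏ i, x i (Function.update ν m k i) =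
      x m k * ∏ i ∈ Finset.univ.erase m, x i (ν i) := by
    intro k
    rw [← Finset.mul_prod_erase _ _ (Finset.mem_univ m), Function.update_self]
    congr 1
    exact Finset.prod_congr rfl fun i hi => by
      rw [Function.update_of_ne (Finset.ne_of_mem_erase hi)]
  rw [← Finset.mul_prod_erase _ _ (Finset.mem_univ m), if_pos rfl]
  simp only [h1, ← mul_assoc, ← Finset.sum_mul]
  congr 1
  exact Finset.prod_congr rfl fun i hi => by rw [if_neg (Finset.ne_of_mem_erase hi)]; rfl

theorem exchange_tprod (m n : Fin N) (x : Fin N → Fin N → ℂ) :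
    exchange m n (PiTensorProduct.tprod ℂ x) =
      PiTensorProduct.tprod ℂ fun i => x (Equiv.swap m n i) := by
  rw [exchange, LinearEquiv.coe_coe, PiTensorProduct.reindex_tprod, Equiv.symm_swap]

theorem coord_exchange (ν : Fin N → Fin N) (m n : Fin N) (v : SpinSpace N) :
    coord ν (exchange m n v) = coord (ν ∘ Equiv.swap m n) v := by
  suffices h : coord ν ∘ₗ exchange m n = coord (ν ∘ Equiv.swap m n) from
    LinearMap.congr_fun h v
  refine PiTensorProduct.ext (MultilinearMap.ext fun x => ?_)
  simp only [LinearMap.compMultilinearMap_apply, LinearMap.comp_apply, exchange_tprod,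
    coord_tprod, Function.comp_apply]
  rw [← Equiv.prod_comp (Equiv.swap m n)]
  simp

theorem exchange_comm (m n : Fin N) : exchange m n = exchange n m := by
  rw [exchange, exchange, Equiv.swap_comm]

/-- Exchange operators intertwine the action of a matrix on the sites. -/
theorem exchange_mul_siteOp (i j m : Fin N) (A : Matrix (Fin N) (Fin N) ℂ) :
    exchange i j * siteOp m A = siteOp (Equiv.swap i j m) A * exchange i j := by
  refine LinearMap.ext fun v => ext_coord fun ν => ?_
  simp only [Module.End.mul_apply, coord_exchange, coord_siteOp, Function.comp_apply]
  refine Finset.sum_congr rfl fun k _ => ?_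
  congr 2
  rw [Function.update_comp_equiv, Equiv.symm_swap]
  simp

theorem exchange_mul_exchange (i j m n : Fin N) :
    exchange i j * exchange m n =
      exchange (Equiv.swap i j m) (Equiv.swap i j n) * exchange i j := by
  refine LinearMap.ext fun v => ext_coord fun ν => ?_
  simp only [Module.End.mul_apply, coord_exchange]
  congr 2
  funext k
  have : Equiv.swap i j * Equiv.swap m n =
    Equiv.swap (Equiv.swap i j m) (Equiv.swap i j n) * Equiv.swap i j :=
    Equiv.mul_swap_eq_swap_mul _ _ _
  exact congrArg (fun e : Equiv.Perm (Fin N) => ν (e k)) this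

theorem exchange_mul_self (i j : Fin N) : exchange i j * exchange i j = 1 := by
  refine LinearMap.ext fun v => ext_coord fun ν => ?_
  simp only [Module.End.mul_apply, coord_exchange, Function.comp_assoc]
  congr 2
  funext k; simp

theorem siteOp_add (m : Fin N) (A B : Matrix (Fin N) (Fin N) ℂ) :
    siteOp m (A + B) = siteOp m A + siteOp m B := by
  refine LinearMap.ext fun v => ext_coord fun ν => ?_
  simp [coord_siteOp, add_mul, Finset.sum_add_distrib]

theorem siteOp_smul (m : Fin N) (c : ℂ) (A : Matrix (Fin N) (Fin N) ℂ) :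
    siteOp m (c • A) = c • siteOp m A := by
  refine LinearMap.ext fun v => ext_coord fun ν => ?_
  simp [coord_siteOp, mul_assoc, Finset.mul_sum]

/-- The action on the tensor factor `m`, as a linear map in the acting matrix. -/
def siteLin (m : Fin N) : Matrix (Fin N) (Fin N) ℂ →ₗ[ℂ] Module.End ℂ (SpinSpace N) where
  toFun := siteOp m
  map_add' := siteOp_add m
  map_smul' := siteOp_smul m

theorem siteOp_mul (m : Fin N) (A B : Matrix (Fin N) (Fin N) ℂ) :
    siteOp m (A * B) = siteOp m A * siteOp m B := by
  refine LinearMap.ext fun v => ext_coord fun ν => ?_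
  simp only [Module.End.mul_apply, coord_siteOp, Matrix.mul_apply, Function.update_self,
    Function.update_idem, Finset.sum_mul, Finset.mul_sum]
  rw [Finset.sum_comm]
  simp only [mul_assoc]

theorem siteOp_commute {m n : Fin N} (hmn : m ≠ n) (A B : Matrix (Fin N) (Fin N) ℂ) :
    siteOp m A * siteOp n B = siteOp n B * siteOp m A := by
  refine LinearMap.ext fun v => ext_coord fun ν => ?_
  simp only [Module.End.mul_apply, coord_siteOp, Function.update_of_ne hmn,
    Function.update_of_ne hmn.symm, Finset.mul_sum]
  rw [Finset.sum_comm]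
  refine Finset.sum_congr rfl fun k _ => Finset.sum_congr rfl fun l _ => ?_
  rw [Function.update_comm hmn]; ring

end SpinSpace

/-! ### The span of the permutation kets -/

section PermSpace

variable {N : ℕ}

theorem funKet_apply (f : Equiv.Perm (Fin N) → ℂ) :
    funKet N f = ∑ ρ, f ρ • ket (ρ : Fin N → Fin N) := by
  simp [funKet, Fintype.linearCombination_apply]

theorem coord_funKet_perm (f : Equiv.Perm (Fin N) → ℂ) (τ : Equiv.Perm (Fin N)) :
    coord (τ : Fin N → Fin N) (funKet N f) = f τ := by
  rw [funKet_apply, map_sum]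
  simp only [map_smul, coord_ket, smul_eq_mul, mul_ite, mul_one, mul_zero]
  have : ∀ ρ : Equiv.Perm (Fin N), ((ρ : Fin N → Fin N) = τ) ↔ ρ = τ := fun ρ =>
    DFunLike.coe_injective.eq_iff
  simp [this]

theorem coord_funKet_of_not_injective (f : Equiv.Perm (Fin N) → ℂ) {ν : Fin N → Fin N}
    (hν : ¬ Function.Injective ν) : coord ν (funKet N f) = 0 := by
  rw [funKet_apply, map_sum]
  refine Finset.sum_eq_zero fun ρ _ => ?_
  rw [map_smul, coord_ket, if_neg, smul_zero]
  rintro rfl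
  exact hν ρ.injective

theorem funKet_injective : Function.Injective (funKet N) := by
  intro f g h
  ext τ
  rw [← coord_funKet_perm f, h, coord_funKet_perm]

theorem range_funKet : LinearMap.range (funKet N) = permSpace N :=
  Fintype.range_linearCombination ℂ _

theorem mem_permSpace_iff {v : SpinSpace N} : v ∈ permSpace N ↔ ∃ f, funKet N f = v := by
  rw [← range_funKet, LinearMap.mem_range]

/-- The span of the kets `|ρ⟩` is cut out by the vanishing of the coordinates in which two sites
carry the same label. -/
theorem mem_permSpace_iff_coord {v : SpinSpace N} :
    v ∈ permSpace N ↔ ∀ ν, ¬ Function.Injective ν → coord ν v = 0 := by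
  rw [mem_permSpace_iff]
  constructor
  · rintro ⟨f, rfl⟩ ν hν
    exact coord_funKet_of_not_injective f hν
  · intro h
    refine ⟨fun ρ => coord ρ v, ext_coord fun ν => ?_⟩
    by_cases hν : Function.Injective ν
    · obtain ⟨ρ, rfl⟩ : ∃ ρ : Equiv.Perm (Fin N), (ρ : Fin N → Fin N) = ν :=
        ⟨Equiv.ofBijective ν (Finite.injective_iff_bijective.mp hν), rfl⟩
      rw [coord_funKet_perm]
    · rw [coord_funKet_of_not_injective _ hν, h ν hν]

theorem exchange_funKet (i j : Fin N) (f : Equiv.Perm (Fin N) → ℂ) :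
    exchange i j (funKet N f) = funKet N fun τ => f (τ * Equiv.swap i j) := by
  refine ext_coord fun ν => ?_
  rw [coord_exchange]
  by_cases hν : Function.Injective ν
  · obtain ⟨ρ, rfl⟩ : ∃ ρ : Equiv.Perm (Fin N), (ρ : Fin N → Fin N) = ν :=
      ⟨Equiv.ofBijective ν (Finite.injective_iff_bijective.mp hν), rfl⟩
    rw [coord_funKet_perm, ← Equiv.Perm.coe_mul, coord_funKet_perm]
  · rw [coord_funKet_of_not_injective _ hν, coord_funKet_of_not_injective]
    intro h
    exact hν ((Equiv.injective_comp (Equiv.swap i j) ν).mp h)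

theorem siteOp_diagonal_funKet (m : Fin N) (d : Fin N → ℂ) (f : Equiv.Perm (Fin N) → ℂ) :
    siteOp m (Matrix.diagonal d) (funKet N f) = funKet N fun τ => d (τ m) * f τ := by
  refine ext_coord fun ν => ?_
  rw [coord_siteOp, Finset.sum_eq_single (ν m), Matrix.diagonal_apply_eq,
    Function.update_eq_self]
  · by_cases hν : Function.Injective ν
    · obtain ⟨ρ, rfl⟩ : ∃ ρ : Equiv.Perm (Fin N), (ρ : Fin N → Fin N) = ν :=
        ⟨Equiv.ofBijective ν (Finite.injective_iff_bijective.mp hν), rfl⟩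
      rw [coord_funKet_perm, coord_funKet_perm]
    · rw [coord_funKet_of_not_injective _ hν, coord_funKet_of_not_injective _ hν, mul_zero]
  · intro k _ hk
    rw [Matrix.diagonal_apply_ne _ hk.symm, zero_mul]
  · simp

end PermSpace

/-! ### Completeness of the `su(N)` generators -/

section Generators

variable {N : ℕ}

/-- The diagonal of the generator `J^{(j,j)}`, as a function of the index of the entry. -/
noncomputable def cartanDiag (j : Fin N) : Fin N → ℂ :=
  if (j : ℕ) + 1 < N then fun m =>
    ((1 / Real.sqrt (2 * ((j : ℝ) + 1) * ((j : ℝ) + 2)) : ℝ) : ℂ) *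
      (if (m : ℕ) ≤ j then (1 : ℂ) else if (m : ℕ) = j + 1 then -(((j : ℕ) : ℂ) + 1) else 0)
  else 0

theorem suGen_diag (j : Fin N) : suGen (j, j) = Matrix.diagonal (cartanDiag j) := by
  by_cases h : (j : ℕ) + 1 < N
  · simp only [suGen, cartanDiag, lt_irrefl, if_false, h, if_true]
    rw [← Matrix.diagonal_smul]
    rfl
  · simp [suGen, cartanDiag, h]

theorem suGen_apply_of_lt {p q : Fin N} (h : p < q) (r k : Fin N) :
    suGen (p, q) r k =
      1 / 2 * ((if p = r ∧ q = k then 1 else 0) + if q = r ∧ p = k then 1 else 0) := by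
  simp [suGen, h, Matrix.single_apply]

theorem suGen_apply_of_gt {p q : Fin N} (h : p < q) (r k : Fin N) :
    suGen (q, p) r k =
      Complex.I / 2 * ((if p = r ∧ q = k then 1 else 0) - if q = r ∧ p = k then 1 else 0) := by
  simp [suGen, h, h.not_gt, Matrix.single_apply]

/-- Partial sums of the completeness relation of the diagonal generators; entries are counted from
zero, and the induction adds one generator at a time. -/
theorem sum_cartan_aux (r s M : ℕ) :
    ∑ j ∈ Finset.range M, (1 / (2 * ((j : ℂ) + 1) * ((j : ℂ) + 2))) *
      (if r ≤ j then (1 : ℂ) else if r = j + 1 then -((j : ℂ) + 1) else 0) *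
      (if s ≤ j then (1 : ℂ) else if s = j + 1 then -((j : ℂ) + 1) else 0) =
    1 / 2 * ((if r = s ∧ r ≤ M then 1 else 0) -
      (if r ≤ M ∧ s ≤ M then 1 else 0) / ((M : ℂ) + 1)) := by
  induction M with
  | zero =>
    by_cases hr : r = 0 <;> by_cases hs : s = 0 <;> simp [hr, hs]
    intro h; omega
  | succ M ih =>
    rw [Finset.sum_range_succ, ih]
    have h1 : ((M : ℂ) + 1) ≠ 0 := by exact_mod_cast Nat.succ_ne_zero M
    have h2 : ((M : ℂ) + 2) ≠ 0 := by exact_mod_cast Nat.succ_ne_zero (M + 1)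
    have h3 : ((M : ℂ) + 1 + 1) ≠ 0 := by rw [add_assoc, one_add_one_eq_two]; exact h2
    push_cast
    rcases lt_trichotomy r (M + 1) with hr | hr | hr <;>
    rcases lt_trichotomy s (M + 1) with hs | hs | hs
    · have a1 : r ≤ M := by omega
      have a2 : s ≤ M := by omega
      have a3 : r ≤ M + 1 := by omega
      have a4 : s ≤ M + 1 := by omega
      simp only [a1, a2, a3, a4, and_true, if_true]
      field_simp; ring
    · have a1 : r ≤ M := by omega
      have a2 : ¬ s ≤ M := by omega
      have a3 : r ≤ M + 1 := by omega
      have a5 : r ≠ s := by omega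
      subst hs
      simp [a1, a3, a5]
      field_simp; ring
    · have a2 : ¬ s ≤ M := by omega
      have a3 : ¬ s ≤ M + 1 := by omega
      have a5 : r ≠ s := by omega
      have a6 : s ≠ M + 1 := by omega
      simp [a2, a3, a5, a6]
    · have a1 : s ≤ M := by omega
      have a2 : ¬ r ≤ M := by omega
      have a3 : s ≤ M + 1 := by omega
      have a5 : r ≠ s := by omega
      subst hr
      simp [a1, a3, a5]
      field_simp; ring
    · subst hr; subst hs
      simp
      field_simp; ring
    · have a2 : ¬ s ≤ M := by omega
      have a3 : ¬ s ≤ M + 1 := by omega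
      have a5 : r ≠ s := by omega
      have a6 : s ≠ M + 1 := by omega
      simp [a2, a3, a5, a6]
    all_goals
      have a1 : ¬ r ≤ M := by omega
      have a2 : ¬ r ≤ M + 1 := by omega
      have a3 : r ≠ M + 1 := by omega
      simp [a1, a2, a3]

/-- Completeness of the diagonal generators. -/
theorem sum_cartanDiag (r s : Fin N) :
    ∑ j, cartanDiag j r * cartanDiag j s = 1 / 2 * ((if r = s then 1 else 0) - 1 / (N : ℂ)) := by
  obtain ⟨M, rfl⟩ : ∃ M, N = M + 1 := ⟨N - 1, by have := r.pos; omega⟩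
  rw [Fin.sum_univ_castSucc]
  have hlast : cartanDiag (Fin.last M) = 0 := by simp [cartanDiag]
  rw [hlast, Pi.zero_apply, zero_mul, add_zero]
  have hr : (r : ℕ) ≤ M := by omega
  have hs : (s : ℕ) ≤ M := by omega
  have h := sum_cartan_aux r s M
  rw [Finset.sum_range] at h
  have e : ((r : ℕ) = s) ↔ r = s := Fin.val_inj
  simp only [hr, hs, and_self, and_true, if_true, e] at h
  push_cast
  rw [← h]
  refine Finset.sum_congr rfl fun j _ => ?_
  have hsq : ((1 / Real.sqrt (2 * ((j : ℝ) + 1) * ((j : ℝ) + 2)) : ℝ) : ℂ) *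
      ((1 / Real.sqrt (2 * ((j : ℝ) + 1) * ((j : ℝ) + 2)) : ℝ) : ℂ) =
      1 / (2 * ((j : ℂ) + 1) * ((j : ℂ) + 2)) := by
    rw [← Complex.ofReal_mul, ← sq, div_pow, one_pow, Real.sq_sqrt (by positivity)]
    push_cast; rfl
  rw [← hsq]
  have hj : ((j.castSucc : Fin (M + 1)) : ℕ) + 1 < M + 1 := by simp
  rw [cartanDiag, if_pos hj]
  simp only [Fin.val_castSucc]
  ring

/-- The Fierz identity: the generators are orthogonal for the trace form and complete among the
traceless matrices. -/
theorem sum_suGen_mul_suGen (r k s l : Fin N) :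
    ∑ c, suGen c r k * suGen c s l =
      1 / 2 * ((if r = l ∧ s = k then 1 else 0) -
        (if r = k ∧ s = l then 1 else 0) / (N : ℂ)) := by
  set F : Fin N × Fin N → ℂ := fun c => suGen c r k * suGen c s l with hF
  have hoff : ∀ p q : Fin N, p < q → F (p, q) + F (q, p) =
      1 / 2 * ((if p = r ∧ q = k ∧ q = s ∧ p = l then 1 else 0) +
        (if q = r ∧ p = k ∧ p = s ∧ q = l then 1 else 0)) := by
    intro p q h
    simp only [hF, suGen_apply_of_lt h, suGen_apply_of_gt h]
    have e : ∀ u v x y : ℂ, 1 / 2 * (u + v) * (1 / 2 * (x + y)) +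
        Complex.I / 2 * (u - v) * (Complex.I / 2 * (x - y)) = 1 / 2 * (u * y + v * x) := by
      intro u v x y
      linear_combination ((u - v) * (x - y) / 4) * Complex.I_mul_I
    rw [e]
    simp only [ite_zero_mul_ite_zero, mul_one, and_assoc]
  have hpair : ∀ p q : Fin N, F (p, q) + F (q, p) =
      1 / 2 * ((if p = r ∧ q = k ∧ q = s ∧ p = l ∧ p ≠ q then 1 else 0) +
        (if q = r ∧ p = k ∧ p = s ∧ q = l ∧ p ≠ q then 1 else 0)) +
      if p = q then 2 * F (p, p) else 0 := by
    intro p q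
    rcases lt_trichotomy p q with h | h | h
    · simp only [hoff p q h, h.ne, ne_eq, not_false_eq_true, and_true, if_false, add_zero]
    · subst h; simp; ring
    · rw [add_comm, hoff q p h, if_neg h.ne', add_zero]
      simp only [h.ne', ne_eq, not_false_eq_true, and_true]
      ring
  have hdiag : ∀ p, F (p, p) =
      (if r = k ∧ s = l then 1 else 0) * (cartanDiag p r * cartanDiag p s) := by
    intro p
    simp only [hF, suGen_diag, Matrix.diagonal_apply]
    by_cases h1 : r = k <;> by_cases h2 : s = l <;> simp [h1, h2]
  have hsum : 2 * ∑ c, F c = ∑ p, ∑ q, (F (p, q) + F (q, p)) := by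
    simp only [Finset.sum_add_distrib]
    rw [Finset.sum_comm (f := fun p q => F (q, p)), Fintype.sum_prod_type, two_mul]
  have hs1 : ∑ p : Fin N, ∑ q : Fin N,
      (if p = r ∧ q = k ∧ q = s ∧ p = l ∧ p ≠ q then (1 : ℂ) else 0) =
      if r = l ∧ s = k ∧ r ≠ k then 1 else 0 := by
    rw [Finset.sum_eq_single r, Finset.sum_eq_single k]
    · congr 1
      simp only [true_and, eq_iff_iff]
      tauto
    · intro q _ hq; simp [hq]
    · simp
    · intro p _ hp; simp [hp]
    · simp
  have hs2 : ∑ p : Fin N, ∑ q : Fin N,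
      (if q = r ∧ p = k ∧ p = s ∧ q = l ∧ p ≠ q then (1 : ℂ) else 0) =
      if r = l ∧ s = k ∧ r ≠ k then 1 else 0 := by
    rw [Finset.sum_comm, ← hs1]
    simp only [ne_comm]
  have hmain : 2 * ∑ c, F c = (if r = l ∧ s = k ∧ r ≠ k then 1 else 0) +
      2 * ((if r = k ∧ s = l then 1 else 0) *
        (1 / 2 * ((if r = s then 1 else 0) - 1 / (N : ℂ)))) := by
    rw [hsum, ← sum_cartanDiag r s, Finset.mul_sum, Finset.mul_sum]
    simp only [hpair, Finset.sum_add_distrib, ← Finset.mul_sum, hs1, hs2, Finset.sum_ite_eq,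
      Finset.mem_univ, if_true, hdiag]
    ring
  have : ∑ c, F c = 1 / 2 * ((if r = l ∧ s = k ∧ r ≠ k then 1 else 0) +
      2 * ((if r = k ∧ s = l then 1 else 0) *
        (1 / 2 * ((if r = s then 1 else 0) - 1 / (N : ℂ))))) := by
    rw [← hmain]; ring
  rw [this]
  by_cases h1 : r = k
  · subst h1
    by_cases h2 : s = l
    · subst h2
      by_cases h3 : r = s
      · subst h3; simp
      · simp [h3]
    · have : ¬ (r = l ∧ s = r) := fun ⟨h, h'⟩ => h2 (h'.trans h)
      simp [h2, this]
  · simp [h1]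

/-- The generators span the traceless matrices, with the dual basis given by the trace form. -/
theorem sum_trace_smul_suGen (A : Matrix (Fin N) (Fin N) ℂ) (hA : A.trace = 0) :
    ∑ c, (2 * (A * suGen c).trace) • suGen c = A := by
  ext r k
  have h1 : ∀ c : Fin N × Fin N, ((2 * (A * suGen c).trace) • suGen c) r k =
      ∑ l, ∑ s, 2 * A l s * (suGen c r k * suGen c s l) := by
    intro c
    simp only [Matrix.smul_apply, smul_eq_mul, Matrix.trace, Matrix.diag_apply, Matrix.mul_apply,
      Finset.mul_sum, Finset.sum_mul]
    exact Finset.sum_congr rfl fun l _ => Finset.sum_congr rfl fun s _ => by ring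
  rw [Matrix.sum_apply]
  simp only [h1]
  rw [Finset.sum_comm]
  have h2 : ∀ l, ∑ c : Fin N × Fin N, ∑ s, 2 * A l s * (suGen c r k * suGen c s l) =
      ∑ s, (A l s * (if r = l ∧ s = k then 1 else 0) -
        A l s * ((if r = k ∧ s = l then 1 else 0) / (N : ℂ))) := by
    intro l
    rw [Finset.sum_comm]
    refine Finset.sum_congr rfl fun s _ => ?_
    rw [← Finset.mul_sum, sum_suGen_mul_suGen]; ring
  simp only [h2, Finset.sum_sub_distrib]
  have h3 : ∑ l, ∑ s, A l s * (if r = l ∧ s = k then (1 : ℂ) else 0) = A r k := by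
    rw [Finset.sum_eq_single r, Finset.sum_eq_single k]
    · simp
    · intro s _ hs; simp [hs]
    · simp
    · intro l _ hl; simp [hl.symm]
    · simp
  have h4 : ∑ l, ∑ s, A l s * ((if r = k ∧ s = l then (1 : ℂ) else 0) / (N : ℂ)) = 0 := by
    by_cases hrk : r = k
    · have : ∑ l, ∑ s, A l s * ((if r = k ∧ s = l then (1 : ℂ) else 0) / (N : ℂ)) =
          A.trace / N := by
        simp [hrk, Matrix.trace, div_eq_mul_inv, Finset.sum_mul]
      rw [this, hA, zero_div]
    · simp [hrk]
  rw [h3, h4, sub_zero]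

theorem lie_suGen (a b : Fin N × Fin N) :
    ⁅suGen a, suGen b⁆ = ∑ c, structConst a b c • suGen c := by
  refine (sum_trace_smul_suGen _ ?_).symm
  rw [Ring.lie_def, Matrix.trace_sub, Matrix.trace_mul_comm, sub_self]

/-- On two sites the Fierz identity says that `∑_b J^b_m J^b_n` is half the exchange operator, up
to a scalar. -/
theorem sum_siteOp_suGen_mul {m n : Fin N} (hmn : m ≠ n) :
    ∑ b : Fin N × Fin N, siteOp m (suGen b) * siteOp n (suGen b) =
      (1 / 2 : ℂ) • (exchange m n - (1 / (N : ℂ)) • 1) := by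
  refine LinearMap.ext fun v => ext_coord fun ν => ?_
  simp only [LinearMap.sum_apply, map_sum, Module.End.mul_apply, coord_siteOp,
    Function.update_of_ne hmn.symm, LinearMap.smul_apply, LinearMap.sub_apply, map_smul, map_sub,
    coord_exchange, Module.End.one_apply, smul_eq_mul]
  set G : Fin N → Fin N → ℂ := fun k l =>
    coord (Function.update (Function.update ν m k) n l) v with hG
  have h1 : ∑ b : Fin N × Fin N, ∑ k, suGen b (ν m) k * ∑ l, suGen b (ν n) l * G k l =
      ∑ k, ∑ l, 1 / 2 * ((if ν m = l ∧ ν n = k then 1 else 0) -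
        (if ν m = k ∧ ν n = l then 1 else 0) / (N : ℂ)) * G k l := by
    rw [Finset.sum_comm]
    refine Finset.sum_congr rfl fun k _ => ?_
    simp only [Finset.mul_sum]
    rw [Finset.sum_comm]
    refine Finset.sum_congr rfl fun l _ => ?_
    rw [← sum_suGen_mul_suGen, Finset.sum_mul]
    exact Finset.sum_congr rfl fun b _ => by ring
  have h2 : ∀ k l, 1 / 2 * ((if ν m = l ∧ ν n = k then 1 else 0) -
        (if ν m = k ∧ ν n = l then 1 else 0) / (N : ℂ)) * G k l =
      (if ν n = k then if ν m = l then 1 / 2 * G k l else 0 else 0) -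
        (if ν m = k then if ν n = l then 1 / 2 * (1 / (N : ℂ)) * G k l else 0 else 0) := by
    intro k l
    simp only [ite_and]
    split_ifs <;> ring
  change ∑ b : Fin N × Fin N, ∑ k, suGen b (ν m) k * ∑ l, suGen b (ν n) l * G k l = _
  rw [h1]
  simp only [h2, Finset.sum_sub_distrib]
  have h3 : ∀ (x y : Fin N) (H : Fin N → Fin N → ℂ),
      ∑ k, ∑ l, (if x = k then if y = l then H k l else 0 else 0) = H x y := by
    intro x y H
    rw [Finset.sum_eq_single x]
    · simp
    · intro k _ hk; simp [hk.symm]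
    · simp
  rw [h3, h3]
  have e1 : G (ν n) (ν m) = coord (ν ∘ Equiv.swap m n) v := by
    simp only [hG]
    congr 2
    rw [Equiv.comp_swap_eq_update, Function.update_comm hmn.symm]
  have e2 : G (ν m) (ν n) = coord ν v := by
    simp only [hG, Function.update_eq_self]
  rw [e1, e2]; ring

end Generators

/-! ### Commutators of the Hamiltonian with the ladder operators -/

section Ladder

variable {N : ℕ}

theorem exchange_self (m : Fin N) : exchange m m = 1 := by
  refine LinearMap.ext fun v => ext_coord fun ν => ?_
  rw [coord_exchange, Equiv.swap_self]; rfl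

/-- The Hamiltonian as a sum over all ordered pairs; the diagonal terms vanish because `0⁻¹ = 0`. -/
theorem hatM_eq (z : Fin N → ℝ) :
    hatM z = (1 / 4 : ℂ) • ∑ i, ∑ j, (((z i : ℂ) - z j)⁻¹) ^ 2 • exchange i j := by
  rw [← sum_posPairs_add_self (fun i j => (((z i : ℂ) - z j)⁻¹) ^ 2 • exchange i j)]
  · rw [hatM, pfHamiltonian, ← two_smul ℂ (∑ p ∈ posPairs N, _), smul_smul]
    congr 1
    · norm_num
    · refine Finset.sum_congr rfl fun p _ => ?_
      rw [exchange_comm, inv_sub_antisymm (fun i => (z i : ℂ))]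
      push_cast
      congr 1
      rw [neg_sq, inv_pow, one_div]
  · intro i j
    rw [exchange_comm, inv_sub_antisymm (fun i => (z i : ℂ)), neg_sq]
  · intro i; simp

/-- The relations between exchange operators `P` and one-site operators `T` on which the ladder
algebra rests. The computations take place in an abstract algebra `A` with these relations, which
spares the elaborator the tensor product. -/
structure IsSpinRep {A : Type*} [Ring A] [Algebra ℂ A] (P : Fin N → Fin N → A)
    (T : Fin N → Matrix (Fin N) (Fin N) ℂ →ₗ[ℂ] A) : Prop where
  comm : ∀ i j, P i j = P j i
  self : ∀ i, P i i = 1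
  mul_self : ∀ i j, P i j * P i j = 1
  mul_exchange : ∀ i j m n, P i j * P m n = P (Equiv.swap i j m) (Equiv.swap i j n) * P i j
  mul_site : ∀ i j m B, P i j * T m B = T (Equiv.swap i j m) B * P i j
  site_mul : ∀ m B C, T m (B * C) = T m B * T m C
  site_commute : ∀ {m n}, m ≠ n → ∀ B C, T m B * T n C = T n C * T m B
  fierz : ∀ {m n}, m ≠ n → ∑ b : Fin N × Fin N, T m (suGen b) * T n (suGen b) =
    (1 / 2 : ℂ) • (P m n - (1 / (N : ℂ)) • 1)

theorem isSpinRep : IsSpinRep (N := N) exchange siteLin where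
  comm := exchange_comm
  self := exchange_self
  mul_self := exchange_mul_self
  mul_exchange := exchange_mul_exchange
  mul_site := exchange_mul_siteOp
  site_mul := siteOp_mul
  site_commute := siteOp_commute
  fierz := sum_siteOp_suGen_mul

namespace IsSpinRep

variable {A : Type*} [Ring A] [Algebra ℂ A] {P : Fin N → Fin N → A}
  {T : Fin N → Matrix (Fin N) (Fin N) ℂ →ₗ[ℂ] A}

theorem braid (h : IsSpinRep P T) {m n k : Fin N} (hmn : m ≠ n) (hkn : k ≠ n) :
    P m k * P k n = P m n * P m k := by
  rw [h.mul_exchange, Equiv.swap_apply_right, Equiv.swap_apply_of_ne_of_ne hmn.symm hkn.symm]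

/-- The operator with the structure constants is a hopping operator: contracting
`f^{[a,b,c]} J^b_m J^c_n` by the Fierz identity leaves a commutator of `J^a_n` with an exchange
operator. -/
theorem sum_structConst_smul (h : IsSpinRep P T) (z : Fin N → ℂ) (a : Fin N × Fin N) :
    (∑ b, ∑ c, ∑ m, ∑ n ∈ Finset.univ.erase m,
      (structConst a b c / (z m - z n)) • (T m (suGen b) * T n (suGen c))) =
      -∑ m, ∑ n, (z m - z n)⁻¹ • (T m (suGen a) * P m n) := by
  set J : Fin N → A := fun m => T m (suGen a) with hJ
  set w : Fin N → Fin N → ℂ := fun m n => (z m - z n)⁻¹ with hw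
  have hanti : ∀ m n, w m n = -w n m := fun m n => inv_sub_antisymm z m n
  -- contract the structure constants with the Fierz identity
  have hterm : ∀ m n, m ≠ n → ∑ b, ∑ c,
      (structConst a b c / (z m - z n)) • (T m (suGen b) * T n (suGen c)) =
      (1 / 2 : ℂ) • w m n • (J n * P m n - J m * P m n) := by
    intro m n hmn
    have h1 : ∀ b, ∑ c, (structConst a b c / (z m - z n)) •
        (T m (suGen b) * T n (suGen c)) =
        w m n • (J n * (T m (suGen b) * T n (suGen b)) -
          (T m (suGen b) * T n (suGen b)) * J n) := by
      intro b
      have h2 : T n ⁅suGen a, suGen b⁆ = ∑ c, structConst a b c • T n (suGen c) := by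
        rw [lie_suGen, map_sum]
        simp only [map_smul]
      have h3 : T n ⁅suGen a, suGen b⁆ =
          J n * T n (suGen b) - T n (suGen b) * J n := by
        rw [Ring.lie_def, map_sub, h.site_mul, h.site_mul]
      have h4 : J n * (T m (suGen b) * T n (suGen b)) -
          (T m (suGen b) * T n (suGen b)) * J n =
          T m (suGen b) * T n ⁅suGen a, suGen b⁆ := by
        rw [h3, mul_sub, ← mul_assoc, ← mul_assoc, ← mul_assoc, hJ,
          h.site_commute hmn.symm]
      rw [h4, h2, Finset.mul_sum, Finset.smul_sum]
      refine Finset.sum_congr rfl fun c _ => ?_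
      rw [mul_smul_comm, smul_smul, hw]
      congr 1
      rw [div_eq_mul_inv, mul_comm]
    simp only [h1]
    rw [← Finset.smul_sum, Finset.sum_sub_distrib, ← Finset.mul_sum, ← Finset.sum_mul,
      h.fierz hmn]
    have h5 : P m n * J n = J m * P m n := by
      rw [hJ, h.mul_site, Equiv.swap_apply_right]
    rw [mul_smul_comm, smul_mul_assoc, mul_sub, sub_mul, h5, mul_smul_comm, smul_mul_assoc,
      mul_one, one_mul]
    module
  have h1 : (∑ b, ∑ c, ∑ m, ∑ n ∈ Finset.univ.erase m,
      (structConst a b c / (z m - z n)) • (T m (suGen b) * T n (suGen c))) =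
      ∑ m, ∑ n, (1 / 2 : ℂ) • w m n • (J n * P m n - J m * P m n) := by
    calc _ = ∑ m, ∑ n ∈ Finset.univ.erase m, ∑ b, ∑ c,
        (structConst a b c / (z m - z n)) •
          (T m (suGen b) * T n (suGen c)) := by
          have hc : ∀ b, ∑ c, ∑ m, ∑ n ∈ Finset.univ.erase m,
              (structConst a b c / (z m - z n)) •
                (T m (suGen b) * T n (suGen c)) =
              ∑ m, ∑ n ∈ Finset.univ.erase m, ∑ c,
              (structConst a b c / (z m - z n)) •
                (T m (suGen b) * T n (suGen c)) := by
            intro b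
            rw [Finset.sum_comm]
            exact Finset.sum_congr rfl fun m _ => Finset.sum_comm
          simp only [hc]
          rw [Finset.sum_comm]
          exact Finset.sum_congr rfl fun m _ => Finset.sum_comm
      _ = _ := by
          refine Finset.sum_congr rfl fun m _ => ?_
          rw [← Finset.add_sum_erase Finset.univ _ (Finset.mem_univ m)]
          have : w m m = 0 := by simp [hw]
          rw [this, zero_smul, smul_zero, zero_add]
          exact Finset.sum_congr rfl fun n hn => hterm m n (Finset.ne_of_mem_erase hn).symm
  have h2 : ∑ m, ∑ n, w m n • (J n * P m n) = -∑ m, ∑ n, w m n • (J m * P m n) := by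
    rw [Finset.sum_comm, ← Finset.sum_neg_distrib]
    refine Finset.sum_congr rfl fun m _ => ?_
    rw [← Finset.sum_neg_distrib]
    refine Finset.sum_congr rfl fun n _ => ?_
    rw [hanti n m, h.comm, neg_smul]
  rw [h1]
  simp only [smul_sub, Finset.sum_sub_distrib, ← Finset.smul_sum]
  rw [h2]
  change _ = -∑ m, ∑ n, w m n • (J m * P m n)
  module

/-- Commuting an exchange of the sites `i` and `j` with `∑ z_m J_m` gives a factor `z_i - z_j`,
which lowers the inverse square to an inverse. -/
theorem lie_hamiltonian_position (h : IsSpinRep P T) (z : Fin N → ℂ) (hz : IsNode z)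
    (B : Matrix (Fin N) (Fin N) ℂ) :
    ⁅(1 / 4 : ℂ) • ∑ i, ∑ j, ((z i - z j)⁻¹) ^ 2 • P i j, ∑ m, z m • T m B⁆ =
      (1 / 2 : ℂ) • -∑ m, ∑ n, (z m - z n)⁻¹ • (T m B * P m n) := by
  set X : A := ∑ m, z m • T m B with hX
  set J : Fin N → A := fun m => T m B with hJ
  set w : Fin N → Fin N → ℂ := fun m n => (z m - z n)⁻¹ with hw
  have hanti : ∀ m n, w m n = -w n m := fun m n => inv_sub_antisymm z m n
  have hcomm : ∀ i j, w i j ^ 2 • ⁅P i j, X⁆ =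
      -(w i j • (J i * P i j)) - w j i • (J j * P j i) := by
    intro i j
    have h1 : P i j * X =
        ∑ m, z (Equiv.swap i j m) • (J m * P i j) := by
      rw [hX, Finset.mul_sum, ← Equiv.sum_comp (Equiv.swap i j)]
      refine Finset.sum_congr rfl fun m _ => ?_
      rw [mul_smul_comm, h.mul_site, Equiv.swap_apply_self]
    rw [Ring.lie_def, h1, hX, Finset.sum_mul, ← Finset.sum_sub_distrib]
    by_cases hij : i = j
    · subst hij
      simp [hw]
    have hne : z i - z j ≠ 0 := sub_ne_zero.mpr fun h => hij (hz.1 h)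
    rw [Fintype.sum_eq_add i j hij]
    · rw [Equiv.swap_apply_left, Equiv.swap_apply_right, smul_mul_assoc, smul_mul_assoc,
        ← sub_smul, ← sub_smul, smul_add, smul_smul, smul_smul, h.comm j i, hanti j i]
      have e1 : w i j ^ 2 * (z j - z i) = -w i j := by
        simp only [hw]; field_simp; ring
      have e2 : w i j ^ 2 * (z i - z j) = w i j := by
        simp only [hw]; field_simp
      rw [e1, e2]
      module
    · rintro m ⟨hmi, hmj⟩
      rw [Equiv.swap_apply_of_ne_of_ne hmi hmj, smul_mul_assoc, sub_self]
  have hsum : ⁅(1 / 4 : ℂ) • ∑ i, ∑ j, ((z i - z j)⁻¹) ^ 2 • P i j, X⁆ =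
      (1 / 4 : ℂ) • ∑ i, ∑ j, w i j ^ 2 • ⁅P i j, X⁆ := by
    rw [Ring.lie_def]
    simp only [Ring.lie_def, smul_sub, Finset.sum_sub_distrib, smul_mul_assoc, mul_smul_comm,
      Finset.sum_mul, Finset.mul_sum, hw]
  rw [hsum]
  simp only [hcomm, Finset.sum_sub_distrib, Finset.sum_neg_distrib]
  rw [Finset.sum_comm (f := fun i j => w j i • (J j * P j i))]
  change _ = (1 / 2 : ℂ) • -∑ m, ∑ n, w m n • (J m * P m n)
  module

/-- The change of the hopping part at the site `m` under conjugation by the exchange operators of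
the Hamiltonian: the three-site terms cancel, and the cubes `1 / (z_m - z_n) ^ 3` of the two-site
terms add up to a multiple of `z_m`. -/
theorem sum_inv_sq_smul_exchange_mul (h : IsSpinRep P T) (z : Fin N → ℂ) (hz : IsNode z)
    (m : Fin N) :
    ∑ i, ∑ j, ∑ n, (((z i - z j)⁻¹) ^ 2 *
        ((z (Equiv.swap i j m) - z (Equiv.swap i j n))⁻¹ - (z m - z n)⁻¹)) •
      (P m n * P i j) = (-2 * z m) • 1 := by
  set w : Fin N → Fin N → ℂ := fun m n => (z m - z n)⁻¹ with hw
  have hanti : ∀ m n, w m n = -w n m := fun m n => inv_sub_antisymm z m n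
  have hself : ∀ m, w m m = 0 := fun m => by simp [hw]
  have hne : ∀ i j, i ≠ j → z i - z j ≠ 0 := fun i j hij =>
    sub_ne_zero.mpr fun h => hij (hz.1 h)
  set Q : Fin N → Fin N → A := fun n k =>
    (w m k ^ 2 * (w k n - w m n)) • (P m n * P m k) with hQ
  set B : Fin N → Fin N → A := fun n k =>
    (w n k ^ 2 * (w m k - w m n)) • (P m n * P n k) with hB
  have key : ∀ i j n, (w i j ^ 2 * (w (Equiv.swap i j m) (Equiv.swap i j n) - w m n)) •
      (P m n * P i j) =
      (if i = m then Q n j else 0) + (if j = m then Q n i else 0) +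
        ((if i = n then B n j else 0) + (if j = n then B n i else 0)) := by
    intro i j n
    by_cases hij : i = j
    · subst hij
      by_cases him : i = m
      · subst him
        by_cases hin : i = n
        · subst hin; simp [hQ, hB, hself]
        · simp [hin, hQ, hself]
      · by_cases hin : i = n
        · subst hin; simp [him, hB, hself]
        · simp [him, hin, hself]
    by_cases hmn : m = n
    · subst hmn
      by_cases him : i = m
      · subst him
        simp [hQ, hB, hself, Ne.symm hij]
        rw [hanti j i]; module
      by_cases hjm : j = m
      · subst hjm
        simp [hQ, hB, hself, him]
        rw [hanti i j]; module
      · simp [him, hjm, hself]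
    by_cases him : i = m
    · subst him
      by_cases hjn : j = n
      · subst hjn
        simp only [if_true, Ne.symm hij, hij, if_false, Equiv.swap_apply_left,
          Equiv.swap_apply_right, hQ, hB, hself, h.comm j i]
        rw [hanti j i]; module
      · rw [Equiv.swap_apply_left, Equiv.swap_apply_of_ne_of_ne (Ne.symm hmn) (Ne.symm hjn)]
        simp [hQ, Ne.symm hij, hmn, hjn]
    by_cases hjm : j = m
    · subst hjm
      by_cases hin : i = n
      · subst hin
        simp only [if_true, hij, if_false, Equiv.swap_apply_left, hmn,
          Equiv.swap_apply_right, hQ, hB, hself, h.comm j i]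
        rw [hanti j i]; module
      · rw [Equiv.swap_apply_right, Equiv.swap_apply_of_ne_of_ne (Ne.symm hin) (Ne.symm hmn)]
        simp [hQ, him, hmn, hin, h.comm i j, hanti i j]
    rw [Equiv.swap_apply_of_ne_of_ne (Ne.symm him) (Ne.symm hjm)]
    by_cases hin : i = n
    · subst hin
      rw [Equiv.swap_apply_left]
      simp [hB, him, hjm, Ne.symm hij]
    by_cases hjn : j = n
    · subst hjn
      rw [Equiv.swap_apply_right]
      simp [hB, him, hjm, hij, h.comm i j, hanti i j]
    · rw [Equiv.swap_apply_of_ne_of_ne (Ne.symm hin) (Ne.symm hjn)]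
      simp [him, hjm, hin, hjn]
  have key2 : ∀ n k, Q n k + B k n =
      -(if n = k then w m n ^ 3 • (1 : A) else 0) -
        (if n = m then w m k ^ 3 • (P m k + 1) else 0) +
        (if k = m then w m n ^ 3 • P m n else 0) := by
    intro n k
    by_cases hnk : n = k
    · subst hnk
      by_cases hnm : n = m
      · subst hnm; simp [hQ, hB, hself]
      · simp [hQ, hB, hself, hnm, h.mul_self]; module
    by_cases hnm : n = m
    · subst hnm
      simp [hQ, hB, hself, hnk, Ne.symm hnk, h.self, h.comm k n, h.mul_self]
      rw [hanti k n]; module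
    by_cases hkm : k = m
    · subst hkm
      simp [hQ, hB, hself, hnk, h.self]; module
    · have e : P m k * P k n = P m n * P m k :=
        h.braid (Ne.symm hnm) (Ne.symm hnk)
      simp only [hQ, hB, e, hnk, hnm, hkm, if_false, ← add_smul]
      have h1 := hne m n (Ne.symm hnm)
      have h2 := hne m k (Ne.symm hkm)
      have h3 := hne k n (Ne.symm hnk)
      have : w m k ^ 2 * (w k n - w m n) + w k n ^ 2 * (w m n - w m k) = 0 := by
        simp only [hw]; field_simp; ring
      rw [this]; simp
  have hQB : ∑ n, ∑ k, (Q n k + B n k) = -z m • 1 := by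
    have : ∑ n, ∑ k, (Q n k + B n k) = ∑ n, ∑ k, (Q n k + B k n) := by
      simp only [Finset.sum_add_distrib]
      rw [Finset.sum_comm (f := fun n k => B k n)]
    rw [this]
    simp only [key2, Finset.sum_add_distrib, Finset.sum_sub_distrib, Finset.sum_neg_distrib,
      Finset.sum_ite_eq, Finset.sum_ite_eq', Finset.mem_univ, if_true]
    rw [Finset.sum_comm (f := fun n k => if n = m then w m k ^ 3 • (P m k + 1) else 0)]
    simp only [Finset.sum_ite_eq', Finset.mem_univ, if_true, smul_add, Finset.sum_add_distrib,
      ← Finset.sum_smul]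
    have h3 : ∑ n, w m n ^ 3 = z m / 2 := hz.sum_inv_cube m
    rw [h3]; module
  have hfin : ∑ i, ∑ j, ∑ n, (w i j ^ 2 * (w (Equiv.swap i j m) (Equiv.swap i j n) - w m n)) •
      (P m n * P i j) = (2 : ℂ) • ∑ n, ∑ k, (Q n k + B n k) := by
    simp only [key, Finset.sum_add_distrib]
    have s1 : ∑ i, ∑ j, ∑ n, (if i = m then Q n j else 0) = ∑ n, ∑ k, Q n k := by
      rw [Finset.sum_eq_single m _ (by simp)]
      · simp only [if_true]; exact Finset.sum_comm
      · intro i _ hi; simp [hi]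
    have s2 : ∑ i, ∑ j, ∑ n, (if j = m then Q n i else 0) = ∑ n, ∑ k, Q n k := by
      rw [Finset.sum_comm, s1]
    have s3 : ∑ i, ∑ j, ∑ n, (if i = n then B n j else 0) = ∑ n, ∑ k, B n k := by
      simp
    have s4 : ∑ i, ∑ j, ∑ n, (if j = n then B n i else 0) = ∑ n, ∑ k, B n k := by
      rw [Finset.sum_comm, s3]
    rw [s1, s2, s3, s4]
    module
  change ∑ i, ∑ j, ∑ n, (w i j ^ 2 * (w (Equiv.swap i j m) (Equiv.swap i j n) - w m n)) •
      (P m n * P i j) = _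
  rw [hfin, hQB]; module

theorem lie_hamiltonian_hopping (h : IsSpinRep P T) (z : Fin N → ℂ) (hz : IsNode z)
    (B : Matrix (Fin N) (Fin N) ℂ) :
    ⁅(1 / 4 : ℂ) • ∑ i, ∑ j, ((z i - z j)⁻¹) ^ 2 • P i j,
        -∑ m, ∑ n, (z m - z n)⁻¹ • (T m B * P m n)⁆ =
      (1 / 2 : ℂ) • ∑ m, z m • T m B := by
  set Y : A := -∑ m, ∑ n, (z m - z n)⁻¹ • (T m B * P m n) with hY
  set J : Fin N → A := fun m => T m B with hJ
  set w : Fin N → Fin N → ℂ := fun m n => (z m - z n)⁻¹ with hw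
  have hcomm : ∀ i j, w i j ^ 2 • ⁅P i j, Y⁆ =
      -∑ m, J m * ∑ n, (w i j ^ 2 * (w (Equiv.swap i j m) (Equiv.swap i j n) - w m n)) •
        (P m n * P i j) := by
    intro i j
    have h1 : P i j * ∑ m, ∑ n, w m n • (J m * P m n) =
        ∑ m, ∑ n, w (Equiv.swap i j m) (Equiv.swap i j n) •
          (J m * (P m n * P i j)) := by
      rw [Finset.mul_sum, ← Equiv.sum_comp (Equiv.swap i j)]
      refine Finset.sum_congr rfl fun m _ => ?_
      rw [Finset.mul_sum, ← Equiv.sum_comp (Equiv.swap i j)]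
      refine Finset.sum_congr rfl fun n _ => ?_
      rw [mul_smul_comm, ← mul_assoc, hJ, h.mul_site, Equiv.swap_apply_self, mul_assoc,
        h.mul_exchange, Equiv.swap_apply_self, Equiv.swap_apply_self]
    have hneg : ∀ S : A, P i j * -S - -S * P i j = -(P i j * S - S * P i j) := by
      intro S; noncomm_ring
    rw [hY, Ring.lie_def, hneg]
    change w i j ^ 2 • -(P i j * ∑ m, ∑ n, w m n • (J m * P m n) -
      (∑ m, ∑ n, w m n • (J m * P m n)) * P i j) = _
    rw [h1, smul_neg, Finset.sum_mul, ← Finset.sum_sub_distrib, Finset.smul_sum]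
    congr 1
    refine Finset.sum_congr rfl fun m _ => ?_
    rw [Finset.sum_mul, ← Finset.sum_sub_distrib, Finset.smul_sum, Finset.mul_sum]
    refine Finset.sum_congr rfl fun n _ => ?_
    rw [smul_mul_assoc, mul_assoc, ← sub_smul, smul_smul, mul_smul_comm]
  have hsum : ⁅(1 / 4 : ℂ) • ∑ i, ∑ j, ((z i - z j)⁻¹) ^ 2 • P i j, Y⁆ =
      (1 / 4 : ℂ) • ∑ i, ∑ j, w i j ^ 2 • ⁅P i j, Y⁆ := by
    rw [Ring.lie_def]
    simp only [Ring.lie_def, smul_sub, Finset.sum_sub_distrib, smul_mul_assoc, mul_smul_comm,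
      Finset.sum_mul, Finset.mul_sum, hw]
  have h2 : ∑ i, ∑ j, ∑ m, J m * ∑ n, (w i j ^ 2 *
        (w (Equiv.swap i j m) (Equiv.swap i j n) - w m n)) • (P m n * P i j) =
      ∑ m, J m * ∑ i, ∑ j, ∑ n, (w i j ^ 2 *
        (w (Equiv.swap i j m) (Equiv.swap i j n) - w m n)) • (P m n * P i j) := by
    calc _ = ∑ i, ∑ m, ∑ j, J m * ∑ n, (w i j ^ 2 *
        (w (Equiv.swap i j m) (Equiv.swap i j n) - w m n)) • (P m n * P i j) :=
          Finset.sum_congr rfl fun i _ => Finset.sum_comm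
      _ = _ := by
        rw [Finset.sum_comm]
        refine Finset.sum_congr rfl fun m _ => ?_
        rw [Finset.mul_sum]
        exact Finset.sum_congr rfl fun i _ => by rw [Finset.mul_sum]
  rw [hsum]
  simp only [hcomm, Finset.sum_neg_distrib]
  rw [h2]
  simp only [hw, h.sum_inv_sq_smul_exchange_mul z hz, mul_smul_comm, mul_one]
  rw [← Finset.sum_neg_distrib, Finset.smul_sum, Finset.smul_sum]
  refine Finset.sum_congr rfl fun m _ => ?_
  simp only [hJ]
  module

end IsSpinRep

theorem ladderL_eq (z : Fin N → ℝ) (a : Fin N × Fin N) :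
    ladderL z a = -∑ m, ∑ n, ((z m : ℂ) - z n)⁻¹ • (siteOp m (suGen a) * exchange m n) :=
  isSpinRep.sum_structConst_smul (fun i => (z i : ℂ)) a

theorem lie_hatM_ladderK {z : Fin N → ℝ} (hz : IsNode fun i => (z i : ℂ)) (a : Fin N × Fin N) :
    ⁅hatM z, ladderK z a⁆ = (1 / 2 : ℂ) • ladderL z a := by
  rw [hatM_eq, ladderL_eq]
  exact isSpinRep.lie_hamiltonian_position _ hz (suGen a)

theorem lie_hatM_ladderL {z : Fin N → ℝ} (hz : IsNode fun i => (z i : ℂ)) (a : Fin N × Fin N) :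
    ⁅hatM z, ladderL z a⁆ = (1 / 2 : ℂ) • ladderK z a := by
  rw [hatM_eq, ladderL_eq]
  exact isSpinRep.lie_hamiltonian_hopping _ hz (suGen a)

theorem hatM_ladder {z : Fin N → ℝ} (hz : IsNode fun i => (z i : ℂ)) (a : Fin N × Fin N) (r : ℂ)
    (φ : SpinSpace N) (hφ : hatM z φ = r • φ) :
    hatM z ((ladderK z a + ladderL z a) φ) = (r + 1 / 2) • (ladderK z a + ladderL z a) φ ∧
      hatM z ((ladderK z a - ladderL z a) φ) = (r - 1 / 2) • (ladderK z a - ladderL z a) φ := by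
  have hK := LinearMap.congr_fun (lie_hatM_ladderK hz a) φ
  have hL := LinearMap.congr_fun (lie_hatM_ladderL hz a) φ
  rw [Ring.lie_def, LinearMap.sub_apply, Module.End.mul_apply, Module.End.mul_apply, hφ, map_smul,
    LinearMap.smul_apply, sub_eq_iff_eq_add] at hK hL
  constructor
  · rw [LinearMap.add_apply, map_add, hK, hL]
    module
  · have aux : ∀ {V : Type} [AddCommGroup V] [Module ℂ V] (k l : V),
        (1 / 2 : ℂ) • l + r • k - ((1 / 2 : ℂ) • k + r • l) = (r - 1 / 2) • (k - l) := by
      intros; module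
    rw [LinearMap.sub_apply, map_sub, hK, hL]
    exact aux _ _

end Ladder

/-! ### The frozen matrix and the spin chain -/

section FrozenMatrix

variable {N : ℕ}

theorem transitionMatrix_map_mulVec {K : Type*} [Field K] (φ : ℝ →+* K)
    (rate : Fin N → Fin N → ℝ) (f : Equiv.Perm (Fin N) → K) (τ : Equiv.Perm (Fin N)) :
    ((transitionMatrix rate).map φ).mulVec f τ =
      ∑ p ∈ posPairs N, φ (rate p.2 p.1) * (f (τ * Equiv.swap p.2 p.1) - f τ) := by
  simp only [Matrix.mulVec, dotProduct, Matrix.map_apply, transitionMatrix, Matrix.of_apply,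
    map_sub, map_mul, map_sum, apply_ite φ, map_one, map_zero, sub_mul, Finset.sum_sub_distrib,
    Finset.sum_mul, mul_sub]
  congr 1
  · rw [Finset.sum_comm]
    refine Finset.sum_congr rfl fun p _ => ?_
    simp
  · rw [Finset.sum_comm]
    refine Finset.sum_congr rfl fun p _ => ?_
    simp

theorem frozenMatrix_map_mulVec {K : Type*} [Field K] [CharZero K] (φ : ℝ →+* K)
    (z : Fin N → ℝ) (f : Equiv.Perm (Fin N) → K) :
    ((frozenMatrix z).map φ).mulVec f = frozenGen (fun i => φ (z i)) f := by
  ext τ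
  rw [frozenMatrix, transitionMatrix_map_mulVec, frozenGen_apply_eq_sum_posPairs, Finset.mul_sum]
  refine Finset.sum_congr rfl fun p _ => ?_
  rw [map_div₀, map_mul, map_pow, map_sub, map_one, map_ofNat]
  rw [inv_pow, one_div, one_div, mul_inv]; ring

theorem toLin_frozenMatrix (z : Fin N → ℝ) :
    Matrix.toLin' (frozenMatrix z) = frozenGen z := by
  refine LinearMap.ext fun f => ?_
  rw [Matrix.toLin'_apply]
  have := frozenMatrix_map_mulVec (RingHom.id ℝ) z f
  simpa using this

theorem frozenMatrix_mulVec {z : Fin N → ℝ} (hz : IsNode z) (f : Equiv.Perm (Fin N) → ℝ)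
    (τ : Equiv.Perm (Fin N)) : (frozenMatrix z).mulVec f τ =
      1 / 2 * ∑ p ∈ posPairs N, f (τ * Equiv.swap p.2 p.1) / (z p.2 - z p.1) ^ 2 -
        (N : ℝ) * ((N : ℝ) - 1) / 8 * f τ := by
  rw [← Matrix.toLin'_apply, toLin_frozenMatrix, frozenGen_apply_eq_sum_posPairs]
  simp only [mul_sub, Finset.sum_sub_distrib]
  rw [← Finset.sum_mul, hz.sum_posPairs]
  have : ∀ p : Fin N × Fin N, ((z p.2 - z p.1)⁻¹) ^ 2 * f (τ * Equiv.swap p.2 p.1) =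
      f (τ * Equiv.swap p.2 p.1) / (z p.2 - z p.1) ^ 2 := fun p => by
    rw [inv_pow, div_eq_inv_mul]
  simp only [this]
  ring

theorem tendsto_transitionMatrix {ι : Type*} {l : Filter ι} {rate : ι → Fin N → Fin N → ℝ}
    {rate₀ : Fin N → Fin N → ℝ}
    (h : ∀ p ∈ posPairs N, Tendsto (fun t => rate t p.2 p.1) l (𝓝 (rate₀ p.2 p.1))) :
    Tendsto (fun t => transitionMatrix (rate t)) l (𝓝 (transitionMatrix rate₀)) := by
  refine tendsto_pi_nhds.mpr fun τ => tendsto_pi_nhds.mpr fun ν => ?_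
  refine Tendsto.sub (tendsto_finsetSum _ fun p hp => (h p hp).mul_const _) ?_
  exact (tendsto_finsetSum _ h).mul_const _

theorem hatM_funKet {z : Fin N → ℝ} (hz : IsNode fun i => (z i : ℂ))
    (f : Equiv.Perm (Fin N) → ℂ) :
    hatM z (funKet N f) = funKet N (frozenGen (fun i => (z i : ℂ)) f) +
      ((N : ℂ) * ((N : ℂ) - 1) / 8) • funKet N f := by
  have h : pfHamiltonian z (funKet N f) = funKet N (∑ p ∈ posPairs N,
      ((((z p.2 : ℂ) - z p.1)⁻¹) ^ 2) • fun τ => f (τ * Equiv.swap p.2 p.1)) := by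
    rw [pfHamiltonian, LinearMap.sum_apply, map_sum]
    refine Finset.sum_congr rfl fun p _ => ?_
    rw [LinearMap.smul_apply, exchange_funKet, map_smul]
    push_cast
    rw [one_div, inv_pow]
  rw [hatM, LinearMap.smul_apply, h, ← map_smul, ← map_smul, ← map_add]
  congr 1
  ext τ
  have h4 := hz.sum_posPairs
  rw [Pi.add_apply, frozenGen_apply_eq_sum_posPairs]
  simp only [Pi.smul_apply, Finset.sum_apply, smul_eq_mul, mul_sub, Finset.sum_sub_distrib]
  rw [← Finset.sum_mul, h4]
  ring

theorem funKet_frozenMatrix_mulVec {z : Fin N → ℝ} (hz : IsNode fun i => (z i : ℂ))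
    (f : Equiv.Perm (Fin N) → ℂ) :
    funKet N (((frozenMatrix z).map (fun r : ℝ => (r : ℂ))).mulVec f) =
      (1 / 2 : ℂ) • pfHamiltonian z (funKet N f) -
        ((N : ℂ) * ((N : ℂ) - 1) / 8) • funKet N f := by
  have h := hatM_funKet hz f
  rw [hatM, LinearMap.smul_apply] at h
  rw [h]
  have := frozenMatrix_map_mulVec Complex.ofRealHom z f
  exact (congrArg (funKet N) this).trans (add_sub_cancel_right _ _).symm

theorem pfHamiltonian_mem (z : Fin N → ℝ) {v : SpinSpace N} (hv : v ∈ permSpace N) :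
    pfHamiltonian z v ∈ permSpace N := by
  obtain ⟨f, rfl⟩ := mem_permSpace_iff.mp hv
  rw [pfHamiltonian, LinearMap.sum_apply]
  refine Submodule.sum_mem _ fun p _ => ?_
  rw [LinearMap.smul_apply, exchange_funKet]
  exact Submodule.smul_mem _ _ (mem_permSpace_iff.mpr ⟨_, rfl⟩)

end FrozenMatrix

/-! ### Ladder operators with diagonal labels -/

section DiagonalLadder

variable {N : ℕ}

/-- A diagonal label makes `K` a multiplication operator by a linear function of the positions. -/
theorem ladderK_diag_funKet (z : Fin N → ℝ) (j : Fin N) (f : Equiv.Perm (Fin N) → ℂ) :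
    ladderK z (j, j) (funKet N f) =
      funKet N ((∑ i, cartanDiag j i • position (fun i => (z i : ℂ)) i) * f) := by
  rw [ladderK, LinearMap.sum_apply]
  simp only [LinearMap.smul_apply, suGen_diag, siteOp_diagonal_funKet, ← map_smul]
  rw [← map_sum]
  congr 1
  ext τ
  simp only [Finset.sum_apply, Pi.smul_apply, Pi.mul_apply, smul_eq_mul, position]
  rw [Finset.sum_mul]
  conv_rhs => rw [← Equiv.sum_comp τ]
  refine Finset.sum_congr rfl fun m _ => ?_
  have : τ⁻¹ (τ m) = m := τ.symm_apply_apply m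
  rw [this]; ring

theorem ladderK_diag_mem (z : Fin N → ℝ) (j : Fin N) {v : SpinSpace N} (hv : v ∈ permSpace N) :
    ladderK z (j, j) v ∈ permSpace N := by
  obtain ⟨f, rfl⟩ := mem_permSpace_iff.mp hv
  rw [ladderK_diag_funKet]
  exact mem_permSpace_iff.mpr ⟨_, rfl⟩

theorem ladderL_diag_mem (z : Fin N → ℝ) (j : Fin N) {v : SpinSpace N} (hv : v ∈ permSpace N) :
    ladderL z (j, j) v ∈ permSpace N := by
  obtain ⟨f, rfl⟩ := mem_permSpace_iff.mp hv
  rw [ladderL_eq, LinearMap.neg_apply, LinearMap.sum_apply]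
  refine Submodule.neg_mem _ (Submodule.sum_mem _ fun m _ => ?_)
  rw [LinearMap.sum_apply]
  refine Submodule.sum_mem _ fun n _ => ?_
  rw [LinearMap.smul_apply, Module.End.mul_apply, exchange_funKet, suGen_diag,
    siteOp_diagonal_funKet]
  exact Submodule.smul_mem _ _ (mem_permSpace_iff.mpr ⟨_, rfl⟩)

theorem hatM_symState {z : Fin N → ℝ} (hz : IsNode fun i => (z i : ℂ)) :
    hatM z (symState N) = ((N : ℂ) * ((N : ℂ) - 1) / 8) • symState N := by
  rw [symState, hatM_funKet hz, frozenGen_eq_zero, map_zero, zero_add]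
  refine Submodule.mem_span_singleton.mpr ⟨((1 / Real.sqrt (Nat.factorial N) : ℝ) : ℂ), ?_⟩
  ext; simp

theorem exchange_symState (m n : Fin N) : exchange m n (symState N) = symState N := by
  rw [symState, exchange_funKet]

/-- On the symmetric state the hopping part acts like the position part, so lowering doubles. -/
theorem ladder_sub_symState {z : Fin N → ℝ} (hz : IsNode fun i => (z i : ℂ))
    (a : Fin N × Fin N) :
    (ladderK z a - ladderL z a) (symState N) = (2 : ℂ) • ladderK z a (symState N) := by
  have hL : ladderL z a (symState N) = -ladderK z a (symState N) := by
    rw [ladderL_eq, LinearMap.neg_apply, LinearMap.sum_apply, ladderK, LinearMap.sum_apply]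
    congr 1
    refine Finset.sum_congr rfl fun m _ => ?_
    simp only [LinearMap.sum_apply, LinearMap.smul_apply, Module.End.mul_apply, exchange_symState]
    rw [← Finset.sum_smul]
    exact congrArg (· • _) (hz.2 m)
  rw [LinearMap.sub_apply, hL, sub_neg_eq_add, two_smul]

theorem ladder_sub_diag_symState {z : Fin N → ℝ} (hz : IsNode fun i => (z i : ℂ)) (j : Fin N) :
    (ladderK z (j, j) - ladderL z (j, j)) (symState N) =
      (2 * ((1 / Real.sqrt (Nat.factorial N) : ℝ) : ℂ)) •
        funKet N (∑ i, cartanDiag j i • position (fun i => (z i : ℂ)) i) := by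
  rw [ladder_sub_symState hz, symState, ladderK_diag_funKet, ← map_smul, ← map_smul]
  congr 1
  ext τ
  simp only [Pi.smul_apply, Pi.mul_apply, smul_eq_mul]
  ring

/-- Under `f ↦ |f⟩` the span of the positions becomes the eigenspace just below the symmetric
state. -/
theorem map_span_position {z : Fin N → ℝ} (hz : IsNode fun i => (z i : ℂ)) :
    (Submodule.span ℂ (Set.range (position fun i => (z i : ℂ)))).map (funKet N) =
      permSpace N ⊓ Module.End.eigenspace (hatM z) ((N : ℂ) * ((N : ℂ) - 1) / 8 - 1 / 2) := by
  rw [← eigenspace_frozenGen_neg_half hz]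
  ext v
  rw [Submodule.mem_inf, Module.End.mem_eigenspace_iff]
  constructor
  · rintro ⟨f, hf, rfl⟩
    refine ⟨mem_permSpace_iff.mpr ⟨f, rfl⟩, ?_⟩
    rw [hatM_funKet hz, Module.End.mem_eigenspace_iff.mp hf, map_smul, ← add_smul]
    congr 1
    ring
  · rintro ⟨hv, h⟩
    obtain ⟨f, rfl⟩ := mem_permSpace_iff.mp hv
    refine ⟨f, Module.End.mem_eigenspace_iff.mpr (funKet_injective ?_), rfl⟩
    rw [hatM_funKet hz] at h
    rw [map_smul, eq_sub_of_add_eq h, ← sub_smul]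
    congr 1
    ring

theorem sqrt_factorial_ne_zero (N : ℕ) :
    (2 * ((1 / Real.sqrt (Nat.factorial N) : ℝ) : ℂ)) ≠ 0 := by
  have : (0 : ℝ) < Real.sqrt (Nat.factorial N) :=
    Real.sqrt_pos.mpr (by exact_mod_cast Nat.factorial_pos N)
  refine mul_ne_zero two_ne_zero ?_
  exact_mod_cast (one_div_pos.mpr this).ne'

theorem span_loweredState {z : Fin N → ℝ} (hz : IsNode fun i => (z i : ℂ)) :
    Submodule.span ℂ (Set.range (loweredState z)) =
      permSpace N ⊓ Module.End.eigenspace (hatM z) ((N : ℂ) * ((N : ℂ) - 1) / 8 - 1 / 2) := by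
  rw [← map_span_position hz]
  set X := position fun i => (z i : ℂ)
  set c : ℂ := 2 * ((1 / Real.sqrt (Nat.factorial N) : ℝ) : ℂ)
  have hc0 : c ≠ 0 := sqrt_factorial_ne_zero N
  have hl : ∀ j, loweredState z j =
      c • funKet N (∑ i, cartanDiag (j.castLE (Nat.sub_le N 1)) i • X i) := fun j =>
    ladder_sub_diag_symState hz _
  apply le_antisymm
  · rw [Submodule.span_le]
    rintro _ ⟨j, rfl⟩
    rw [hl]
    refine Submodule.smul_mem _ _ (Submodule.mem_map_of_mem ?_)
    exact Submodule.sum_mem _ fun i _ => Submodule.smul_mem _ _ (Submodule.subset_span ⟨i, rfl⟩)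
  · rw [Submodule.map_span, Submodule.span_le]
    rintro _ ⟨_, ⟨r, rfl⟩, rfl⟩
    have hmem : ∀ j, funKet N (∑ i, cartanDiag j i • X i) ∈
        Submodule.span ℂ (Set.range (loweredState z)) := by
      intro j
      by_cases hj : (j : ℕ) + 1 < N
      · have : funKet N (∑ i, cartanDiag j i • X i) =
            c⁻¹ • loweredState z ⟨j, by omega⟩ := by
          rw [hl, smul_smul, inv_mul_cancel₀ hc0, one_smul]
          rfl
        rw [this]
        exact Submodule.smul_mem _ _ (Submodule.subset_span ⟨_, rfl⟩)
      · have : cartanDiag j = 0 := by simp [cartanDiag, hj]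
        simp [this]
    -- the completeness relation of the diagonal generators recovers each position
    have hr : X r = ∑ j, (2 * cartanDiag j r) • ∑ i, cartanDiag j i • X i := by
      have h1 : ∑ j, (2 * cartanDiag j r) • ∑ i, cartanDiag j i • X i =
          ∑ i, (2 * ∑ j, cartanDiag j r * cartanDiag j i) • X i := by
        simp only [Finset.smul_sum, Finset.mul_sum, Finset.sum_smul]
        rw [Finset.sum_comm]
        refine Finset.sum_congr rfl fun i _ => Finset.sum_congr rfl fun j _ => ?_
        rw [smul_smul, mul_assoc]
      rw [h1]
      simp only [sum_cartanDiag]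
      have h2 : ∀ i, ((2 : ℂ) * (1 / 2 * ((if r = i then 1 else 0) - 1 / (N : ℂ)))) • X i =
          (if r = i then X i else 0) - (1 / (N : ℂ)) • X i := by
        intro i
        split_ifs <;> module
      simp only [h2, Finset.sum_sub_distrib, ← Finset.smul_sum]
      rw [hz.sum_position]
      simp
    rw [hr, map_sum]
    refine Submodule.sum_mem _ fun j _ => ?_
    rw [map_smul]
    exact Submodule.smul_mem _ _ (hmem j)

/-- There are as many lowered states as dimensions in the space that they span. -/
theorem linearIndependent_loweredState {z : Fin N → ℝ} (hz : IsNode fun i => (z i : ℂ)) :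
    LinearIndependent ℂ (loweredState z) := by
  rw [linearIndependent_iff_card_eq_finrank_span, Set.finrank, span_loweredState hz,
    ← map_span_position hz,
    ← (Submodule.equivMapOfInjective (funKet N) funKet_injective _).finrank_eq,
    finrank_span_position hz, Fintype.card_fin]

end DiagonalLadder

/-! ### Ladder operators with off-diagonal labels -/

section OffDiagonalLadder

variable {N : ℕ}

theorem coord_ladderK (z : Fin N → ℝ) (a : Fin N × Fin N) (ν : Fin N → Fin N) (v : SpinSpace N) :
    coord ν (ladderK z a v) =
      ∑ m, ∑ k, (z m : ℂ) * suGen a (ν m) k * coord (Function.update ν m k) v := by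
  rw [ladderK, LinearMap.sum_apply, map_sum]
  refine Finset.sum_congr rfl fun m _ => ?_
  rw [LinearMap.smul_apply, map_smul, coord_siteOp, smul_eq_mul, Finset.mul_sum]
  exact Finset.sum_congr rfl fun k _ => by ring

theorem coord_ladderL (z : Fin N → ℝ) (a : Fin N × Fin N) (ν : Fin N → Fin N) (v : SpinSpace N) :
    coord ν (ladderL z a v) = -∑ m, ∑ n, ∑ k, ((z m : ℂ) - z n)⁻¹ * suGen a (ν m) k *
        coord (Function.update ν m k ∘ Equiv.swap m n) v := by
  rw [ladderL_eq, LinearMap.neg_apply, LinearMap.sum_apply, map_neg, map_sum]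
  congr 1
  refine Finset.sum_congr rfl fun m _ => ?_
  rw [LinearMap.sum_apply, map_sum]
  refine Finset.sum_congr rfl fun n _ => ?_
  rw [LinearMap.smul_apply, map_smul, Module.End.mul_apply, coord_siteOp, smul_eq_mul,
    Finset.mul_sum]
  exact Finset.sum_congr rfl fun k _ => by rw [coord_exchange]; ring

theorem suGen_apply_self {j l : Fin N} (hjl : j ≠ l) (r : Fin N) : suGen (j, l) r r = 0 := by
  rcases lt_or_gt_of_ne hjl with h | h
  · rw [suGen_apply_of_lt h, if_neg, if_neg]
    · simp
    · rintro ⟨rfl, h'⟩; exact hjl h'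
    · rintro ⟨rfl, h'⟩; exact hjl h'.symm
  · rw [suGen_apply_of_gt h, if_neg, if_neg]
    · simp
    · rintro ⟨rfl, h'⟩; exact hjl h'.symm
    · rintro ⟨rfl, h'⟩; exact hjl h'

theorem suGen_apply_ne_zero {j l : Fin N} (hjl : j ≠ l) : suGen (j, l) l j ≠ 0 := by
  rcases lt_or_gt_of_ne hjl with h | h
  · rw [suGen_apply_of_lt h]; simp [hjl]
  · rw [suGen_apply_of_gt h]; simp [hjl]

theorem not_injective_update {ν : Fin N → Fin N} (hν : Function.Injective ν) {m k : Fin N}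
    (hk : k ≠ ν m) : ¬ Function.Injective (Function.update ν m k) := by
  obtain ⟨m', rfl⟩ := (Finite.injective_iff_surjective.mp hν) k
  have hm : m' ≠ m := fun h => hk (by rw [h])
  intro h
  refine hm (h ?_)
  rw [Function.update_of_ne hm, Function.update_self]

/-- An off-diagonal generator changes one label, so that from a permutation ket no permutation ket
is reached. -/
theorem coord_ladder_eq_zero (z : Fin N → ℝ) {j l : Fin N} (hjl : j ≠ l) {v : SpinSpace N}
    (hv : v ∈ permSpace N) {ν : Fin N → Fin N} (hν : Function.Injective ν) :
    coord ν (ladderK z (j, l) v) = 0 ∧ coord ν (ladderL z (j, l) v) = 0 := by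
  rw [mem_permSpace_iff_coord] at hv
  constructor
  · rw [coord_ladderK]
    refine Finset.sum_eq_zero fun m _ => Finset.sum_eq_zero fun k _ => ?_
    by_cases hk : k = ν m
    · rw [hk, suGen_apply_self hjl]; simp
    · rw [hv _ (not_injective_update hν hk), mul_zero]
  · rw [coord_ladderL, neg_eq_zero]
    refine Finset.sum_eq_zero fun m _ => Finset.sum_eq_zero fun n _ =>
      Finset.sum_eq_zero fun k _ => ?_
    by_cases hk : k = ν m
    · rw [hk, suGen_apply_self hjl]; simp
    · rw [hv, mul_zero]
      intro h
      exact not_injective_update hν hk ((Equiv.injective_comp (Equiv.swap m n) _).mp h)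

/-- The matrix element of the ladder operators that turns the color `j` at the site `a` into a
second `l`. -/
theorem coord_ladder_ket (z : Fin N → ℝ) {j l : Fin N} (hjl : j ≠ l) (ρ : Equiv.Perm (Fin N))
    {a b : Fin N} (ha : ρ a = j) (hb : ρ b = l) :
    coord (Function.update ρ a l) (ladderK z (j, l) (ket ρ)) = (z a : ℂ) * suGen (j, l) l j ∧
    coord (Function.update ρ a l) (ladderL z (j, l) (ket ρ)) =
      ((z a : ℂ) - z b)⁻¹ * suGen (j, l) l j := by
  have hab : a ≠ b := by rintro rfl; exact hjl (ha.symm.trans hb)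
  set ν : Fin N → Fin N := Function.update ρ a l with hν
  have hνa : ν a = l := by simp [hν]
  have hνne : ∀ i, i ≠ a → ν i = ρ i := fun i hi => by simp [hν, hi]
  have hνb : ν b = l := by rw [hνne b hab.symm, hb]
  constructor
  · rw [coord_ladderK, Finset.sum_eq_single a _ (by simp), Finset.sum_eq_single j _ (by simp)]
    · rw [coord_ket, if_pos, mul_one, hνa]
      rw [hν, Function.update_idem, ← ha, Function.update_eq_self]
    · intro k _ hk
      rw [coord_ket, if_neg, mul_zero]
      intro h
      have := congrFun h a
      rw [Function.update_self, ha] at this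
      exact hk this.symm
    · intro m _ hm
      refine Finset.sum_eq_zero fun k _ => ?_
      rw [coord_ket, if_neg, mul_zero]
      intro h
      have := congrFun h a
      rw [Function.update_of_ne hm.symm, ha, hνa] at this
      exact hjl this
  · rw [coord_ladderL, Finset.sum_eq_single b _ (by simp), Finset.sum_eq_single a _ (by simp),
      Finset.sum_eq_single j _ (by simp)]
    · rw [coord_ket, if_pos, mul_one, hνb, inv_sub_antisymm (fun i => (z i : ℂ)) b a]
      · ring
      · funext i
        rw [Function.comp_apply]
        by_cases hia : i = a
        · subst hia; rw [Equiv.swap_apply_right, Function.update_self, ha]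
        by_cases hib : i = b
        · subst hib; rw [Equiv.swap_apply_left, Function.update_of_ne hab, hνa, hb]
        · rw [Equiv.swap_apply_of_ne_of_ne hib hia, Function.update_of_ne hib, hνne i hia]
    · intro k _ hk
      rw [coord_ket, if_neg, mul_zero]
      intro h
      have := congrFun h a
      rw [Function.comp_apply, Equiv.swap_apply_right, Function.update_self, ha] at this
      exact hk this.symm
    · intro n _ hn
      refine Finset.sum_eq_zero fun k _ => ?_
      rw [coord_ket, if_neg, mul_zero]
      intro h
      have := congrFun h a
      rw [Function.comp_apply, Equiv.swap_apply_of_ne_of_ne hab (Ne.symm hn),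
        Function.update_of_ne hab, ha, hνa] at this
      exact hjl this
    · intro m _ hm
      refine Finset.sum_eq_zero fun n _ => Finset.sum_eq_zero fun k _ => ?_
      by_cases hmn : m = n
      · subst hmn; simp
      rw [coord_ket, if_neg, mul_zero]
      intro h
      by_cases hma : m = a
      · subst hma
        have := congrFun h m
        rw [Function.comp_apply, Equiv.swap_apply_left, Function.update_of_ne (Ne.symm hmn),
          hνne n (Ne.symm hmn)] at this
        exact hmn (ρ.injective this)
      by_cases hna : n = a
      · subst hna
        have := congrFun h m
        rw [Function.comp_apply, Equiv.swap_apply_left, Function.update_of_ne (Ne.symm hmn),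
          hνa, ← hb] at this
        exact hm (ρ.injective this)
      · have := congrFun h a
        rw [Function.comp_apply, Equiv.swap_apply_of_ne_of_ne (Ne.symm hma) (Ne.symm hna),
          Function.update_of_ne (Ne.symm hma), ha, hνa] at this
        exact hjl this

theorem exists_perm_apply_pair {a b j l : Fin N} (hab : a ≠ b) (hjl : j ≠ l) :
    ∃ ρ : Equiv.Perm (Fin N), ρ a = j ∧ ρ b = l := by
  refine ⟨Equiv.swap (Equiv.swap a j b) l * Equiv.swap a j, ?_, ?_⟩
  · rw [Equiv.Perm.mul_apply, Equiv.swap_apply_left, Equiv.swap_apply_of_ne_of_ne _ hjl]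
    intro h
    exact hab ((Equiv.swap a j).injective (by rw [Equiv.swap_apply_left, ← h]))
  · rw [Equiv.Perm.mul_apply, Equiv.swap_apply_left]

theorem not_injective_update_perm (ρ : Equiv.Perm (Fin N)) {a b : Fin N} (hab : a ≠ b) :
    ¬ Function.Injective (Function.update (ρ : Fin N → Fin N) a (ρ b)) := by
  refine not_injective_update ρ.injective fun h => hab (ρ.injective h).symm

theorem ket_mem_permSpace (ρ : Equiv.Perm (Fin N)) : ket (ρ : Fin N → Fin N) ∈ permSpace N :=
  Submodule.subset_span ⟨ρ, rfl⟩

theorem exists_ladder_add_not_mem (hN : 2 ≤ N) {z : Fin N → ℝ}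
    (hz : IsNode fun i => (z i : ℂ)) {j l : Fin N} (hjl : j ≠ l) :
    ∃ v ∈ permSpace N, (ladderK z (j, l) + ladderL z (j, l)) v ∉ permSpace N := by
  by_contra! hcon
  have h : ∀ a b : Fin N, a ≠ b → (z a : ℂ) + ((z a : ℂ) - z b)⁻¹ = 0 := by
    intro a b hab
    obtain ⟨ρ, ha, hb⟩ := exists_perm_apply_pair hab hjl
    have h1 := mem_permSpace_iff_coord.mp (hcon _ (ket_mem_permSpace ρ)) _
      (not_injective_update_perm ρ hab)
    obtain ⟨hK, hL⟩ := coord_ladder_ket z hjl ρ ha hb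
    rw [hb, LinearMap.add_apply, map_add, hK, hL, ← add_mul] at h1
    exact (mul_eq_zero.mp h1).resolve_right (suGen_apply_ne_zero hjl)
  have h0 : ∀ a, (z a : ℂ) = 0 := by
    intro a
    have h2 : ∑ b ∈ Finset.univ.erase a, ((z a : ℂ) + ((z a : ℂ) - z b)⁻¹) = 0 :=
      Finset.sum_eq_zero fun b hb => h a b (Finset.ne_of_mem_erase hb).symm
    have h3 : ∑ b ∈ Finset.univ.erase a, ((z a : ℂ) - z b)⁻¹ = z a := by
      have := hz.2 a
      rw [← Finset.add_sum_erase Finset.univ _ (Finset.mem_univ a)] at this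
      simpa using this
    rw [Finset.sum_add_distrib, h3, Finset.sum_const, Finset.card_erase_of_mem (Finset.mem_univ a),
      Finset.card_univ, Fintype.card_fin, nsmul_eq_mul, Nat.cast_sub (by omega)] at h2
    have h4 : (N : ℂ) * z a = 0 := by linear_combination h2
    exact (mul_eq_zero.mp h4).resolve_left (by exact_mod_cast (by omega : N ≠ 0))
  have : (⟨0, by omega⟩ : Fin N) = ⟨1, by omega⟩ := hz.1 ((h0 _).trans (h0 _).symm)
  simp at this

theorem exists_ladder_sub_not_mem (hN : 3 ≤ N) {z : Fin N → ℝ}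
    (hz : IsNode fun i => (z i : ℂ)) {j l : Fin N} (hjl : j ≠ l) :
    ∃ v ∈ permSpace N, (ladderK z (j, l) - ladderL z (j, l)) v ∉ permSpace N := by
  by_contra! hcon
  have h : ∀ a b : Fin N, a ≠ b → (z a : ℂ) - ((z a : ℂ) - z b)⁻¹ = 0 := by
    intro a b hab
    obtain ⟨ρ, ha, hb⟩ := exists_perm_apply_pair hab hjl
    have h1 := mem_permSpace_iff_coord.mp (hcon _ (ket_mem_permSpace ρ)) _
      (not_injective_update_perm ρ hab)
    obtain ⟨hK, hL⟩ := coord_ladder_ket z hjl ρ ha hb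
    rw [hb, LinearMap.sub_apply, map_sub, hK, hL, ← sub_mul] at h1
    exact (mul_eq_zero.mp h1).resolve_right (suGen_apply_ne_zero hjl)
  set a : Fin N := ⟨0, by omega⟩
  set b : Fin N := ⟨1, by omega⟩
  set c : Fin N := ⟨2, by omega⟩
  have h1 := h a b (by simp [a, b])
  have h2 := h a c (by simp [a, c])
  have h3 : ((z a : ℂ) - z b)⁻¹ = ((z a : ℂ) - z c)⁻¹ := by linear_combination h2 - h1
  have h4 : (z b : ℂ) = z c := by linear_combination -(inv_injective h3)
  have : b = c := hz.1 h4
  simp [b, c] at this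

theorem ladder_sub_symState_mem_iff {z : Fin N → ℝ} (hz : IsNode fun i => (z i : ℂ))
    (j l : Fin N) :
    ((ladderK z (j, l) - ladderL z (j, l)) (symState N) ∈ permSpace N ∧
        (ladderK z (j, l) - ladderL z (j, l)) (symState N) ≠ 0) ↔
      j = l ∧ (j : ℕ) + 1 < N := by
  have hsym : symState N ∈ permSpace N := mem_permSpace_iff.mpr ⟨_, rfl⟩
  constructor
  · rintro ⟨hmem, hne⟩
    by_cases hjl : j = l
    · subst hjl
      refine ⟨rfl, ?_⟩
      by_contra hj
      refine hne ?_
      have : cartanDiag j = 0 := by simp [cartanDiag, hj]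
      rw [ladder_sub_diag_symState hz, this]
      simp
    · refine absurd (ext_coord fun ν => ?_) hne
      rw [map_zero]
      by_cases hν : Function.Injective ν
      · obtain ⟨hK, hL⟩ := coord_ladder_eq_zero z hjl hsym hν
        rw [LinearMap.sub_apply, map_sub, hK, hL, sub_zero]
      · exact mem_permSpace_iff_coord.mp hmem ν hν
  · rintro ⟨rfl, hj⟩
    refine ⟨?_, ?_⟩
    · rw [LinearMap.sub_apply]
      exact Submodule.sub_mem _ (ladderK_diag_mem z j hsym) (ladderL_diag_mem z j hsym)
    · have hj' : (j : ℕ) < N - 1 := by omega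
      have h := (linearIndependent_loweredState hz).ne_zero ⟨j, hj'⟩
      unfold loweredState at h
      exact h

end OffDiagonalLadder

/-! ### Equilibrium points are zeros of Hermite polynomials -/

section Hermite

open Polynomial

theorem integrable_eval_mul_gaussian (p : ℝ[X]) :
    Integrable fun x : ℝ => p.eval x * Real.exp (-x ^ 2) := by
  induction p using Polynomial.induction_on' with
  | add p q hp hq =>
    simp only [eval_add, add_mul]
    exact hp.add hq
  | monomial n a =>
    have h := integrable_rpow_mul_exp_neg_mul_sq (b := 1) one_pos (s := n)
      (lt_of_lt_of_le (by norm_num) n.cast_nonneg)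
    have h2 := h.const_mul a
    refine h2.congr (ae_of_all _ fun x => ?_)
    simp only [Real.rpow_natCast, eval_monomial]
    rw [neg_mul, one_mul, mul_assoc]

/-- The integral of a polynomial against the weight `exp (-x ^ 2)`. -/
noncomputable def gaussFunctional : ℝ[X] →ₗ[ℝ] ℝ where
  toFun p := ∫ x : ℝ, p.eval x * Real.exp (-x ^ 2)
  map_add' p q := by
    simp only [eval_add, add_mul]
    exact integral_add (integrable_eval_mul_gaussian p) (integrable_eval_mul_gaussian q)
  map_smul' c p := by
    simp only [eval_smul, smul_eq_mul, mul_assoc, RingHom.id_apply]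
    exact integral_const_mul _ _

/-- The integrand is the derivative of `p(x) exp (-x ^ 2)`. -/
theorem gaussFunctional_derivative (p : ℝ[X]) :
    gaussFunctional (derivative p - 2 * X * p) = 0 := by
  refine integral_eq_zero_of_hasDerivAt_of_integrable (f := fun x => p.eval x * Real.exp (-x ^ 2))
    (fun x => ?_) (integrable_eval_mul_gaussian _) (integrable_eval_mul_gaussian _)
  have h2 : HasDerivAt (fun x : ℝ => Real.exp (-x ^ 2)) (Real.exp (-x ^ 2) * -(2 * x)) x := by
    have := ((hasDerivAt_pow 2 x).neg).exp
    simpa using this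
  refine ((p.hasDerivAt x).mul h2).congr_deriv ?_
  simp
  ring

/-- The Hermite operator `p'' - 2 x p'` is symmetric for the Gaussian weight. -/
theorem gaussFunctional_hermite_symm (p q : ℝ[X]) :
    gaussFunctional (p * (derivative (derivative q) - 2 * X * derivative q)) =
      gaussFunctional (q * (derivative (derivative p) - 2 * X * derivative p)) := by
  have h : ∀ p q : ℝ[X], gaussFunctional (p * (derivative (derivative q) - 2 * X * derivative q)) =
      -gaussFunctional (derivative p * derivative q) := by
    intro p q
    rw [eq_neg_iff_add_eq_zero, ← map_add, ← gaussFunctional_derivative (p * derivative q)]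
    congr 1
    rw [derivative_mul]; ring
  rw [h p q, h q p, mul_comm]

theorem eq_zero_of_gaussFunctional_sq {p : ℝ[X]} (h : gaussFunctional (p * p) = 0) : p = 0 := by
  have h0 : (fun x : ℝ => (p * p).eval x * Real.exp (-x ^ 2)) =ᵐ[volume] 0 := by
    refine (integral_eq_zero_iff_of_nonneg (fun x => ?_) (integrable_eval_mul_gaussian _)).mp h
    simp only [eval_mul, Pi.zero_apply]
    exact mul_nonneg (mul_self_nonneg _) (Real.exp_pos _).le
  have hc : Continuous fun x : ℝ => (p * p).eval x * Real.exp (-x ^ 2) := by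
    have := (p * p).continuous
    fun_prop
  have h1 := (hc.ae_eq_iff_eq volume continuous_zero).mp h0
  refine Polynomial.funext fun x => ?_
  have h2 := congrFun h1 x
  simp only [eval_mul, Pi.zero_apply, mul_eq_zero, or_self, (Real.exp_pos _).ne', or_false] at h2
  simpa using h2

/-- The monic polynomial whose zeros are the given points. -/
noncomputable def nodePoly {N : ℕ} (z : Fin N → ℝ) : ℝ[X] := ∏ i, (X - C (z i))

theorem nodePoly_monic {N : ℕ} (z : Fin N → ℝ) : (nodePoly z).Monic :=
  monic_prod_of_monic _ _ fun i _ => monic_X_sub_C (z i)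

theorem natDegree_nodePoly {N : ℕ} (z : Fin N → ℝ) : (nodePoly z).natDegree = N := by
  rw [nodePoly, natDegree_finsetProd_X_sub_C_eq_card]; simp

/-- The polynomial with zeros in equilibrium solves the Hermite differential equation: the
difference of the two sides has degree less than `N`, and it vanishes at the `N` points because
`p''(z_i) = 2 z_i p'(z_i)` there. -/
theorem nodePoly_ode {N : ℕ} {z : Fin N → ℝ} (hz : IsNode z) :
    derivative (derivative (nodePoly z)) - 2 * X * derivative (nodePoly z) =
      -(2 * (N : ℝ[X])) * nodePoly z := by
  set p := nodePoly z with hp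
  rw [← sub_eq_zero]
  set R := derivative (derivative p) - 2 * X * derivative p - -(2 * (N : ℝ[X])) * p with hR
  have hdeg : p.natDegree = N := natDegree_nodePoly z
  have hroot : ∀ i, R.eval (z i) = 0 := by
    intro i
    set r : ℝ[X] := ∏ j ∈ Finset.univ.erase i, (X - C (z j)) with hr
    have hpr : p = (X - C (z i)) * r := by
      rw [hp, nodePoly, ← Finset.mul_prod_erase _ _ (Finset.mem_univ i)]
    have hr' : (derivative r).eval (z i) = r.eval (z i) * z i := by
      rw [hr, derivative_prod_finset, eval_finsetSum, eval_prod]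
      have h1 := hz.2 i
      rw [← Finset.add_sum_erase Finset.univ _ (Finset.mem_univ i), sub_self, inv_zero,
        zero_add] at h1
      refine Eq.trans ?_ (congrArg _ h1)
      rw [Finset.mul_sum]
      refine Finset.sum_congr rfl fun j hj => ?_
      have hne : z i - z j ≠ 0 :=
        sub_ne_zero.mpr fun h => (Finset.ne_of_mem_erase hj) (hz.1 h).symm
      have hm := Finset.mul_prod_erase (Finset.univ.erase i)
        (fun j => eval (z i) (X - C (z j) : ℝ[X])) hj
      rw [← hm]
      simp only [derivative_X_sub_C, mul_one, eval_prod, eval_sub, eval_X, eval_C]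
      field_simp
    have e1 : derivative p = r + (X - C (z i)) * derivative r := by
      rw [hpr, derivative_mul, derivative_X_sub_C, one_mul]
    have e2 : derivative (derivative p) =
        2 * derivative r + (X - C (z i)) * derivative (derivative r) := by
      rw [e1, derivative_add, derivative_mul, derivative_X_sub_C]; ring
    rw [hR, e2, e1, hpr]
    simp only [eval_sub, eval_add, eval_mul, eval_X, eval_C, sub_self, zero_mul, add_zero,
      mul_zero, hr', eval_ofNat]
    ring
  have hlt : R.natDegree < N ∨ R = 0 := by
    by_cases hR0 : R = 0
    · exact Or.inr hR0
    left
    have hle : R.natDegree ≤ N := by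
      refine (natDegree_sub_le _ _).trans (max_le ((natDegree_sub_le _ _).trans (max_le ?_ ?_)) ?_)
      · exact (natDegree_derivative_le _).trans
          ((Nat.sub_le _ _).trans ((natDegree_derivative_le _).trans
            ((Nat.sub_le _ _).trans hdeg.le)))
      · rcases Nat.eq_zero_or_pos N with hN | hN
        · have : derivative p = 0 := by
            rw [derivative_of_natDegree_zero (hdeg.trans hN)]
          simp [this]
        · refine natDegree_mul_le.trans ?_
          have h1 : (2 * X : ℝ[X]).natDegree ≤ 1 := by
            refine natDegree_mul_le.trans ?_
            simp
          have h2 := natDegree_derivative_le p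
          omega
      · refine natDegree_mul_le.trans ?_
        have h1 : (-(2 * (N : ℝ[X]))).natDegree = 0 := by
          rw [natDegree_neg]
          have : (2 * (N : ℝ[X])) = C (2 * (N : ℝ)) := by simp [map_ofNat C 2]
          rw [this, natDegree_C]
        omega
    refine lt_of_le_of_ne hle fun heq => hR0 ?_
    rw [← leadingCoeff_eq_zero, leadingCoeff, heq]
    rcases Nat.eq_zero_or_pos N with hN | hN
    · subst hN
      have hd : derivative p = 0 := derivative_of_natDegree_zero hdeg
      simp [hR, hd]
    obtain ⟨M, rfl⟩ : ∃ M, N = M + 1 := ⟨N - 1, by omega⟩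
    have hlead : p.coeff (M + 1) = 1 := by
      have := (nodePoly_monic z).coeff_natDegree
      rwa [natDegree_nodePoly] at this
    have hbig : ∀ k, M + 1 < k → p.coeff k = 0 := fun k hk =>
      coeff_eq_zero_of_natDegree_lt (hdeg.le.trans_lt hk)
    have c1 : (derivative (derivative p)).coeff (M + 1) = 0 := by
      rw [coeff_derivative, coeff_derivative, hbig _ (by omega)]; ring
    have c2 : (2 * X * derivative p).coeff (M + 1) = 2 * ((M : ℝ) + 1) := by
      rw [mul_assoc, ← map_ofNat C 2, coeff_C_mul, coeff_X_mul, coeff_derivative, hlead]; ring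
    have c3 : (-(2 * ((M + 1 : ℕ) : ℝ[X])) * p).coeff (M + 1) = -(2 * (M + 1)) := by
      have : -(2 * ((M + 1 : ℕ) : ℝ[X])) = C (-(2 * ((M : ℝ) + 1))) := by
        simp [map_ofNat C 2]
      rw [this, coeff_C_mul, hlead, mul_one]
    rw [hR, coeff_sub, coeff_sub, c1, c2, c3]; ring
  rcases hlt with hlt | h0
  · exact eq_zero_of_natDegree_lt_card_of_eval_eq_zero R hz.1 hroot (by simpa using hlt)
  · exact h0

/-- By the symmetry of the Hermite operator, `nodePoly z` is orthogonal to `X ^ d`: the eigenvalues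
`-2 N` and `-2 d` differ, and `X ^ d` is an eigenvector up to the lower power `X ^ (d - 2)`. -/
theorem gaussFunctional_nodePoly_mul_X_pow {N : ℕ} {z : Fin N → ℝ} (hz : IsNode z) (d : ℕ)
    (hd : d < N) : gaussFunctional (nodePoly z * X ^ d) = 0 := by
  induction d using Nat.strong_induction_on with
  | _ d ih =>
    have h := gaussFunctional_hermite_symm (X ^ d) (nodePoly z)
    have h1 : X ^ d * (-(2 * (N : ℝ[X])) * nodePoly z) =
        (-(2 * (N : ℝ))) • (nodePoly z * X ^ d) := by
      rw [smul_eq_C_mul]; simp [map_ofNat C 2]; ring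
    have h2 : nodePoly z * (derivative (derivative (X ^ d)) - 2 * X * derivative (X ^ d)) =
        ((d : ℝ) * ((d - 1 : ℕ) : ℝ)) • (nodePoly z * X ^ (d - 1 - 1)) -
          (2 * (d : ℝ)) • (nodePoly z * X ^ d) := by
      rw [smul_eq_C_mul, smul_eq_C_mul]
      rcases d with _ | d
      · simp
      · simp only [derivative_X_pow, derivative_mul, derivative_natCast, zero_mul, zero_add,
          Nat.add_sub_cancel, C_mul, map_natCast, map_ofNat]
        ring
    rw [nodePoly_ode hz, h1, h2, map_sub, map_smul, map_smul, map_smul, smul_eq_mul, smul_eq_mul,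
      smul_eq_mul] at h
    have h3 :
        ((d : ℝ) * ((d - 1 : ℕ) : ℝ)) * gaussFunctional (nodePoly z * X ^ (d - 1 - 1)) = 0 := by
      rcases Nat.lt_or_ge d 2 with hd2 | hd2
      · have : d * (d - 1) = 0 := by interval_cases d <;> rfl
        rw [← Nat.cast_mul, this]; simp
      · rw [ih _ (by omega) (by omega), mul_zero]
    rw [h3] at h
    have h4 : (2 * ((d : ℝ) - N)) * gaussFunctional (nodePoly z * X ^ d) = 0 := by
      linear_combination h
    have h5 : (d : ℝ) < N := by exact_mod_cast hd
    exact (mul_eq_zero.mp h4).resolve_left (by intro h; linarith)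

theorem gaussFunctional_nodePoly_mul {N : ℕ} {z : Fin N → ℝ} (hz : IsNode z) {q : ℝ[X]}
    (hq : q.degree < N) : gaussFunctional (nodePoly z * q) = 0 := by
  rw [q.as_sum_range_C_mul_X_pow, Finset.mul_sum, map_sum]
  refine Finset.sum_eq_zero fun d hd => ?_
  by_cases hq0 : q = 0
  · simp [hq0]
  have hdN : d < N := by
    have : q.natDegree < N := (natDegree_lt_iff_degree_lt hq0).mpr hq
    have := Finset.mem_range.mp hd
    omega
  have : nodePoly z * (C (q.coeff d) * X ^ d) = q.coeff d • (nodePoly z * X ^ d) := by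
    rw [smul_eq_C_mul]; ring
  rw [this, map_smul, gaussFunctional_nodePoly_mul_X_pow hz d hdN, smul_zero]

theorem IsHermiteFamily.gaussFunctional_mul {H : ℕ → ℝ[X]} (hH : IsHermiteFamily H) {N : ℕ}
    {q : ℝ[X]} (hq : q.degree < N) : gaussFunctional (H N * q) = 0 := by
  suffices h : ∀ d ≤ N, ∀ q : ℝ[X], q.degree < d → gaussFunctional (H N * q) = 0 from
    h N le_rfl q hq
  intro d
  induction d with
  | zero =>
    intro _ q hq
    have : q = 0 := by
      by_contra h
      rw [degree_eq_natDegree h] at hq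
      exact absurd (Nat.cast_lt.mp hq) (Nat.not_lt_zero _)
    simp [this]
  | succ d ih =>
    intro hd q hq
    by_cases hqd : q.degree < d
    · exact ih (by omega) q hqd
    have hq0 : q ≠ 0 := by rintro rfl; simp at hqd
    have hqe : q.degree = d := by
      rw [degree_eq_natDegree hq0] at hq hqd ⊢
      have h1 : q.natDegree < d + 1 := by exact_mod_cast hq
      have h2 : ¬ q.natDegree < d := by exact_mod_cast hqd
      have : q.natDegree = d := by omega
      rw [this]
    have hHd0 : (H d).leadingCoeff ≠ 0 := by
      rw [Ne, leadingCoeff_eq_zero]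
      intro h
      have := hH.1 d
      rw [h, degree_zero] at this
      exact absurd this.symm (WithBot.natCast_ne_bot d)
    set a := q.leadingCoeff / (H d).leadingCoeff with ha
    have ha0 : a ≠ 0 := div_ne_zero (leadingCoeff_ne_zero.mpr hq0) hHd0
    have hlt : (q - C a * H d).degree < d := by
      rw [← hqe]
      refine degree_sub_lt_left ?_ hq0 ?_
      · rw [degree_C_mul ha0, hH.1, hqe]
      · rw [leadingCoeff_mul, leadingCoeff_C, ha, div_mul_cancel₀ _ hHd0]
    have h1 := ih (by omega) _ hlt
    have h2 : gaussFunctional (H N * H d) = 0 := by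
      have := hH.2 N d (by omega)
      simpa [gaussFunctional] using this
    have e : H N * q = H N * (q - C a * H d) + a • (H N * H d) := by
      rw [smul_eq_C_mul]; ring
    rw [e, map_add, map_smul, h1, h2, smul_zero, add_zero]

/-- Two polynomials of degree `N` orthogonal to all smaller degrees are proportional. -/
theorem IsHermiteFamily.eq_nodePoly {H : ℕ → ℝ[X]} (hH : IsHermiteFamily H) {N : ℕ}
    {z : Fin N → ℝ} (hz : IsNode z) : H N = C (H N).leadingCoeff * nodePoly z := by
  have hH0 : H N ≠ 0 := by
    intro h
    have := hH.1 N
    rw [h, degree_zero] at this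
    exact absurd this.symm (WithBot.natCast_ne_bot N)
  have hc : (H N).leadingCoeff ≠ 0 := leadingCoeff_ne_zero.mpr hH0
  rw [← sub_eq_zero]
  set D := H N - C (H N).leadingCoeff * nodePoly z with hD
  have hlt : D.degree < N := by
    rw [← hH.1 N]
    refine degree_sub_lt_left ?_ hH0 ?_
    · rw [degree_C_mul hc, hH.1, degree_eq_natDegree (nodePoly_monic z).ne_zero,
        natDegree_nodePoly]
    · rw [leadingCoeff_mul, leadingCoeff_C, (nodePoly_monic z).leadingCoeff, mul_one]
  refine eq_zero_of_gaussFunctional_sq ?_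
  have e : D * D = H N * D - (H N).leadingCoeff • (nodePoly z * D) := by
    rw [smul_eq_C_mul]
    nth_rewrite 1 [hD]
    ring
  rw [e, map_sub, map_smul, hH.gaussFunctional_mul hlt, gaussFunctional_nodePoly_mul hz hlt,
    smul_zero, sub_zero]

theorem IsHermiteFamily.isRoot_iff {H : ℕ → ℝ[X]} (hH : IsHermiteFamily H) {N : ℕ}
    {z : Fin N → ℝ} (hz : IsNode z) (x : ℝ) : (H N).IsRoot x ↔ ∃ i, z i = x := by
  have hc : (H N).leadingCoeff ≠ 0 := by
    rw [Ne, leadingCoeff_eq_zero]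
    intro h
    have := hH.1 N
    rw [h, degree_zero] at this
    exact absurd this.symm (WithBot.natCast_ne_bot N)
  rw [IsRoot.def, hH.eq_nodePoly hz, eval_mul, eval_C, mul_eq_zero, or_iff_right hc, nodePoly,
    eval_prod, Finset.prod_eq_zero_iff]
  simp only [Finset.mem_univ, true_and, eval_sub, eval_X, eval_C, sub_eq_zero, eq_comm]

/-- The ordered equilibrium configuration is unique: it lists the zeros of a Hermite polynomial. -/
theorem IsHermiteFamily.node_unique {H : ℕ → ℝ[X]} (hH : IsHermiteFamily H) {N : ℕ}
    {z z' : Fin N → ℝ} (hz : IsNode z) (hz' : IsNode z') (hm : StrictMono z)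
    (hm' : StrictMono z') : z = z' := by
  refine (hm.range_inj hm').mp (Set.ext fun x => ?_)
  rw [Set.mem_range, Set.mem_range, ← hH.isRoot_iff hz, hH.isRoot_iff hz']

end Hermite

/-! ### The Gaussian weight on the Weyl chamber and its maximizer -/

section Chamber

variable {N : ℕ}

theorem inner_root (j i : Fin N) (x : EuclideanSpace ℝ (Fin N)) :
    inner ℝ (root j i) x = x j - x i := by
  simp [root, inner_sub_left, EuclideanSpace.inner_single_left]

theorem norm_root_sq {j i : Fin N} (h : i ≠ j) : ‖root j i‖ ^ 2 = 2 := by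
  rw [← real_inner_self_eq_norm_sq, inner_root]
  simp [root, h, h.symm]
  norm_num

theorem mem_weylChamber_iff (x : EuclideanSpace ℝ (Fin N)) :
    x ∈ weylChamber N ↔ Monotone (fun i => x i) := by
  simp only [weylChamber, Set.mem_ofPred_eq, inner_root, sub_nonneg, posPairs, Finset.mem_filter,
    Finset.mem_univ, true_and, Prod.forall]
  constructor
  · intro h a b hab
    rcases hab.eq_or_lt with rfl | hlt
    · exact le_rfl
    · exact h a b hlt
  · intro h a b hab
    exact h hab.le

theorem isClosed_weylChamber : IsClosed (weylChamber N) := by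
  have : weylChamber N = ⋂ p ∈ posPairs N, {x | 0 ≤ inner ℝ (root p.2 p.1) x} := by
    ext; simp [weylChamber]
  rw [this]
  refine isClosed_biInter fun p _ => isClosed_le continuous_const ?_
  fun_prop

/-- The function `exp (-‖x‖ ^ 2 / 2) ∏_{i < j} |x_j - x_i|`. After the substitution `x = √β y` the
density of the process is a multiple of its power `β`. -/
noncomputable def gaussWeight (x : EuclideanSpace ℝ (Fin N)) : ℝ :=
  Real.exp (-‖x‖ ^ 2 / 2) * ∏ p ∈ posPairs N, |x p.2 - x p.1|

theorem gaussWeight_nonneg (x : EuclideanSpace ℝ (Fin N)) : 0 ≤ gaussWeight x :=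
  mul_nonneg (Real.exp_pos _).le (Finset.prod_nonneg fun _ _ => abs_nonneg _)

theorem continuous_gaussWeight : Continuous (gaussWeight (N := N)) := by
  unfold gaussWeight
  fun_prop

theorem gaussWeight_eq_zero {x : EuclideanSpace ℝ (Fin N)}
    (hx : ¬ Function.Injective fun i => x i) : gaussWeight x = 0 := by
  simp only [Function.Injective] at hx
  push Not at hx
  obtain ⟨a, b, hab, hne⟩ := hx
  refine mul_eq_zero_of_right _ ?_
  rcases lt_or_gt_of_ne hne with h | h
  · refine Finset.prod_eq_zero (i := (a, b)) (by simp [posPairs, h]) ?_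
    simp [hab]
  · refine Finset.prod_eq_zero (i := (b, a)) (by simp [posPairs, h]) ?_
    simp [hab]

theorem gaussWeight_pos {x : EuclideanSpace ℝ (Fin N)} (hx : Function.Injective fun i => x i) :
    0 < gaussWeight x := by
  refine mul_pos (Real.exp_pos _) (Finset.prod_pos fun p hp => abs_pos.mpr (sub_ne_zero.mpr ?_))
  intro h
  have h2 : p.1 < p.2 := (Finset.mem_filter.mp hp).2
  exact h2.ne (hx h).symm

/-- At the scale `√β` the density is, up to a constant, the power `β` of `gaussWeight`. -/
theorem exp_mul_weight_smul {β s : ℝ} (hs : 0 < s) (hβ : β = s ^ 2)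
    (x : EuclideanSpace ℝ (Fin N)) :
    Real.exp (-‖s • x‖ ^ 2 / 2) * weight β (s • x) =
      (s ^ β) ^ (posPairs N).card * gaussWeight x ^ β := by
  rw [gaussWeight, Real.mul_rpow (Real.exp_pos _).le (Finset.prod_nonneg fun _ _ => abs_nonneg _),
    ← Real.exp_mul, ← Real.finsetProd_rpow _ _ fun _ _ => abs_nonneg _, weight]
  have h1 : ∀ p : Fin N × Fin N, |inner ℝ (root p.2 p.1) (s • x)| ^ β =
      s ^ β * |x p.2 - x p.1| ^ β := by
    intro p
    rw [inner_smul_right, inner_root, abs_mul, abs_of_pos hs,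
      Real.mul_rpow hs.le (abs_nonneg _)]
  simp only [h1, Finset.prod_mul_distrib, Finset.prod_const]
  have h2 : -‖s • x‖ ^ 2 / 2 = -‖x‖ ^ 2 / 2 * β := by
    rw [norm_smul, mul_pow, Real.norm_eq_abs, sq_abs, hβ]; ring
  rw [h2]; ring

theorem pow_mul_exp_neg_le (k : ℕ) {r : ℝ} :
    r ^ (2 * k) * Real.exp (-r ^ 2) ≤ 2 ^ k * k.factorial * Real.exp (-(1 / 2) * r ^ 2) := by
  have h := Real.pow_div_factorial_le_exp (r ^ 2 / 2) (by positivity) k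
  rw [div_le_iff₀ (by positivity), div_pow, div_le_iff₀ (by positivity), ← pow_mul] at h
  have e : Real.exp (-r ^ 2) = Real.exp (-(1 / 2) * r ^ 2) * Real.exp (-(1 / 2) * r ^ 2) := by
    rw [← Real.exp_add]; ring_nf
  have e1 : Real.exp (r ^ 2 / 2) * Real.exp (-(1 / 2) * r ^ 2) = 1 := by
    rw [← Real.exp_add]; ring_nf; simp
  calc r ^ (2 * k) * Real.exp (-r ^ 2)
      ≤ (Real.exp (r ^ 2 / 2) * k.factorial * 2 ^ k) * Real.exp (-r ^ 2) :=
        mul_le_mul_of_nonneg_right h (Real.exp_pos _).le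
    _ = 2 ^ k * k.factorial * Real.exp (-(1 / 2) * r ^ 2) *
          (Real.exp (r ^ 2 / 2) * Real.exp (-(1 / 2) * r ^ 2)) := by rw [e]; ring
    _ = _ := by rw [e1, mul_one]

theorem abs_apply_sub_le (x : EuclideanSpace ℝ (Fin N)) (a b : Fin N) :
    |x a - x b| ≤ 2 * ‖x‖ := by
  have h : ∀ i, |x i| ≤ ‖x‖ := fun i => by
    simpa using PiLp.norm_apply_le x i
  calc |x a - x b| ≤ |x a| + |x b| := abs_sub _ _
    _ ≤ 2 * ‖x‖ := by linarith [h a, h b]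

/-- Any partial product of the factors of the squared weight is dominated by a Gaussian. -/
theorem exists_gaussian_bound (S : Finset (Fin N × Fin N)) :
    ∃ C : ℝ, ∀ x : EuclideanSpace ℝ (Fin N),
      Real.exp (-‖x‖ ^ 2) * (∏ p ∈ S, |x p.2 - x p.1|) ^ 2 ≤
        C * Real.exp (-(1 / 2) * ‖x‖ ^ 2) := by
  refine ⟨4 ^ S.card * (2 ^ S.card * S.card.factorial), fun x => ?_⟩
  have h1 : (∏ p ∈ S, |x p.2 - x p.1|) ≤ (2 * ‖x‖) ^ S.card := by
    rw [← Finset.prod_const]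
    exact Finset.prod_le_prod (fun _ _ => abs_nonneg _) fun p _ => abs_apply_sub_le x _ _
  have h0 : 0 ≤ ∏ p ∈ S, |x p.2 - x p.1| := Finset.prod_nonneg fun _ _ => abs_nonneg _
  have h2 : (∏ p ∈ S, |x p.2 - x p.1|) ^ 2 ≤ 4 ^ S.card * ‖x‖ ^ (2 * S.card) := by
    refine (pow_le_pow_left₀ h0 h1 2).trans (le_of_eq ?_)
    rw [mul_pow, mul_pow, ← pow_mul, ← pow_mul, mul_comm S.card 2, pow_mul 2 2]
    norm_num
  calc Real.exp (-‖x‖ ^ 2) * (∏ p ∈ S, |x p.2 - x p.1|) ^ 2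
      ≤ Real.exp (-‖x‖ ^ 2) * (4 ^ S.card * ‖x‖ ^ (2 * S.card)) :=
        mul_le_mul_of_nonneg_left h2 (Real.exp_pos _).le
    _ = 4 ^ S.card * (‖x‖ ^ (2 * S.card) * Real.exp (-‖x‖ ^ 2)) := by ring
    _ ≤ 4 ^ S.card * (2 ^ S.card * S.card.factorial * Real.exp (-(1 / 2) * ‖x‖ ^ 2)) :=
        mul_le_mul_of_nonneg_left (pow_mul_exp_neg_le _) (by positivity)
    _ = _ := by ring

theorem gaussWeight_sq (x : EuclideanSpace ℝ (Fin N)) :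
    gaussWeight x ^ 2 = Real.exp (-‖x‖ ^ 2) * (∏ p ∈ posPairs N, |x p.2 - x p.1|) ^ 2 := by
  rw [gaussWeight, mul_pow, ← Real.exp_nat_mul]
  congr 2
  push_cast; ring

theorem integrable_gaussian :
    Integrable fun x : EuclideanSpace ℝ (Fin N) => Real.exp (-(1 / 2) * ‖x‖ ^ 2) := by
  have h := (GaussianFourier.integrable_cexp_neg_mul_sq_norm_add (V := EuclideanSpace ℝ (Fin N))
    (b := 1 / 2) (by norm_num) 0 0).norm
  refine h.congr (ae_of_all _ fun x => ?_)
  simp only [zero_mul, add_zero]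
  rw [Complex.norm_exp]
  congr 1
  have : (-(1 / 2 : ℂ) * (‖x‖ : ℂ) ^ 2) = ((-(1 / 2) * ‖x‖ ^ 2 : ℝ) : ℂ) := by push_cast; rfl
  rw [this, Complex.ofReal_re]

theorem integrable_gaussWeight_sq :
    Integrable fun x : EuclideanSpace ℝ (Fin N) => gaussWeight x ^ 2 := by
  obtain ⟨C, hC⟩ := exists_gaussian_bound (posPairs N)
  refine (integrable_gaussian.const_mul C).mono'
    (continuous_gaussWeight.pow 2).aestronglyMeasurable (ae_of_all _ fun x => ?_)
  rw [Real.norm_eq_abs, abs_of_nonneg (sq_nonneg _), gaussWeight_sq]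
  exact hC x

/-- Dividing by one root removes one factor of the weight, so no singularity is left. -/
theorem integrable_gaussWeight_sq_div {i j : Fin N} (hij : i < j) :
    Integrable fun x : EuclideanSpace ℝ (Fin N) => gaussWeight x ^ 2 * (1 / (x j - x i) ^ 2) := by
  obtain ⟨C, hC⟩ := exists_gaussian_bound ((posPairs N).erase (i, j))
  refine (integrable_gaussian.const_mul C).mono' ?_ (ae_of_all _ fun x => ?_)
  · refine ((continuous_gaussWeight.pow 2).measurable.mul ?_).aestronglyMeasurable
    have : Measurable fun x : EuclideanSpace ℝ (Fin N) => (x j - x i) ^ 2 := by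
      refine Continuous.measurable ?_
      fun_prop
    simp only [one_div]
    exact this.inv
  rw [Real.norm_eq_abs, abs_of_nonneg (by positivity), gaussWeight_sq]
  refine le_trans ?_ (hC x)
  have hmem : (i, j) ∈ posPairs N := by simp [posPairs, hij]
  rw [← Finset.mul_prod_erase _ _ hmem, mul_pow, sq_abs]
  set Q := (∏ p ∈ (posPairs N).erase (i, j), |x p.2 - x p.1|) ^ 2
  have hd : (x j - x i) ^ 2 * (1 / (x j - x i) ^ 2) ≤ 1 := by
    rw [mul_one_div]; exact div_self_le_one _
  calc Real.exp (-‖x‖ ^ 2) * ((x j - x i) ^ 2 * Q) * (1 / (x j - x i) ^ 2)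
      = Real.exp (-‖x‖ ^ 2) * Q * ((x j - x i) ^ 2 * (1 / (x j - x i) ^ 2)) := by ring
    _ ≤ Real.exp (-‖x‖ ^ 2) * Q * 1 := by
        refine mul_le_mul_of_nonneg_left hd ?_
        have := Real.exp_pos (-‖x‖ ^ 2)
        positivity
    _ = _ := mul_one _

theorem tendsto_gaussWeight_cocompact :
    Tendsto (gaussWeight (N := N)) (cocompact _) (𝓝 0) := by
  obtain ⟨C, hC⟩ := exists_gaussian_bound (posPairs N)
  have h1 : Tendsto (fun x : EuclideanSpace ℝ (Fin N) => C * Real.exp (-(1 / 2) * ‖x‖ ^ 2))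
      (cocompact _) (𝓝 (C * 0)) := by
    refine Tendsto.const_mul C (Real.tendsto_exp_atBot.comp ?_)
    refine Tendsto.const_mul_atTop_of_neg (by norm_num) ?_
    exact (tendsto_pow_atTop two_ne_zero).comp tendsto_norm_cocompact_atTop
  rw [mul_zero] at h1
  have h2 : Tendsto (fun x : EuclideanSpace ℝ (Fin N) => gaussWeight x ^ 2)
      (cocompact _) (𝓝 0) :=
    squeeze_zero (fun x => sq_nonneg _) (fun x => by rw [gaussWeight_sq]; exact hC x) h1
  have h3 := h2.sqrt
  rw [Real.sqrt_zero] at h3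
  refine h3.congr fun x => Real.sqrt_sq (gaussWeight_nonneg x)

theorem exists_isMaxOn_gaussWeight (N : ℕ) :
    ∃ z ∈ weylChamber N, IsMaxOn gaussWeight (weylChamber N) z ∧ 0 < gaussWeight z := by
  set e : EuclideanSpace ℝ (Fin N) := WithLp.toLp 2 fun i => (i : ℝ)
  have hei : Function.Injective fun i => e i := by
    intro a b h
    have : ((a : ℕ) : ℝ) = ((b : ℕ) : ℝ) := h
    exact Fin.ext (by exact_mod_cast this)
  have hepos := gaussWeight_pos hei
  have heC : e ∈ weylChamber N := by
    rw [mem_weylChamber_iff]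
    intro a b hab
    change ((a : ℕ) : ℝ) ≤ ((b : ℕ) : ℝ)
    exact_mod_cast hab
  obtain ⟨z, hz, hmax⟩ := continuous_gaussWeight.continuousOn.exists_isMaxOn'
    isClosed_weylChamber heC (mem_inf_of_left
      ((tendsto_gaussWeight_cocompact.eventually (gt_mem_nhds hepos)).mono fun x hx => hx.le))
  exact ⟨z, hz, hmax, hepos.trans_le (hmax heC)⟩

theorem strictMono_of_mem_weylChamber {x : EuclideanSpace ℝ (Fin N)} (hx : x ∈ weylChamber N)
    (hpos : 0 < gaussWeight x) : StrictMono fun i => x i := by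
  refine ((mem_weylChamber_iff x).mp hx).strictMono_of_injective ?_
  by_contra h
  exact hpos.ne' (gaussWeight_eq_zero h)

theorem weylChamber_mem_nhds {x : EuclideanSpace ℝ (Fin N)} (hx : StrictMono fun i => x i) :
    weylChamber N ∈ 𝓝 x := by
  have h : ∀ᶠ y in 𝓝 x, ∀ p ∈ posPairs N, 0 < y p.2 - y p.1 := by
    rw [(posPairs N).eventually_all]
    intro p hp
    have hc : Continuous fun y : EuclideanSpace ℝ (Fin N) => y p.2 - y p.1 := by fun_prop
    exact hc.continuousAt.eventually_const_lt
      (sub_pos.mpr (hx (Finset.mem_filter.mp hp).2))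
  filter_upwards [h] with y hy p hp
  rw [inner_root]
  exact (hy p hp).le

/-- A maximizer of the weight satisfies the equilibrium conditions: they say that the partial
derivatives of `log gaussWeight` vanish, and the maximizer is interior because the weight is zero
on the walls. -/
theorem isNode_of_isMaxOn {z : EuclideanSpace ℝ (Fin N)} (hzC : z ∈ weylChamber N)
    (hmax : IsMaxOn gaussWeight (weylChamber N) z) (hpos : 0 < gaussWeight z) :
    IsNode fun i => z i := by
  have hmono := strictMono_of_mem_weylChamber hzC hpos
  refine ⟨hmono.injective, fun m => ?_⟩
  set y : ℝ → EuclideanSpace ℝ (Fin N) := fun t => z + t • EuclideanSpace.single m 1 with hy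
  have hy0 : y 0 = z := by simp [hy]
  have hyc : Continuous y := by fun_prop
  have hyi : ∀ t i, y t i = z i + t * (if i = m then 1 else 0) := by
    intro t i; simp [hy]
  set L : ℝ → ℝ := fun t => -(∑ i, y t i ^ 2) / 2 + ∑ p ∈ posPairs N, Real.log (y t p.2 - y t p.1)
    with hL
  have hlog : ∀ t, 0 < gaussWeight (y t) → L t = Real.log (gaussWeight (y t)) := by
    intro t ht
    have hprod : ∏ p ∈ posPairs N, |y t p.2 - y t p.1| ≠ 0 := fun h0 => by
      rw [gaussWeight, h0, mul_zero] at ht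
      exact ht.false
    rw [gaussWeight, Real.log_mul (Real.exp_pos _).ne' hprod, Real.log_exp,
      Real.log_prod (Finset.prod_ne_zero_iff.mp hprod), EuclideanSpace.norm_sq_eq]
    simp only [hL, Real.log_abs, Real.norm_eq_abs, sq_abs]
  have hev : ∀ᶠ t in 𝓝 (0 : ℝ), y t ∈ weylChamber N ∧ 0 < gaussWeight (y t) := by
    have hz0 : Tendsto y (𝓝 0) (𝓝 z) := by
      have := hyc.tendsto 0
      rwa [hy0] at this
    refine (hz0.eventually (weylChamber_mem_nhds hmono)).and ?_
    exact (((continuous_gaussWeight.tendsto z).comp hz0).eventually (lt_mem_nhds hpos))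
  have hloc : IsLocalMax L 0 := by
    filter_upwards [hev] with t ht
    rw [hlog t ht.2, hlog 0 (by rwa [hy0]), hy0]
    exact Real.log_le_log ht.2 (hmax ht.1)
  have hder : HasDerivAt L (-z m + ∑ p ∈ posPairs N,
      ((if p.2 = m then 1 else 0) - (if p.1 = m then 1 else 0)) * (z p.2 - z p.1)⁻¹) 0 := by
    have hcoord : ∀ i, HasDerivAt (fun t => y t i) (if i = m then 1 else 0) 0 := by
      intro i
      have : (fun t => y t i) = fun t => z i + t * (if i = m then 1 else 0) :=
        funext fun t => hyi t i
      rw [this]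
      have h := ((hasDerivAt_id (0 : ℝ)).mul_const (if i = m then (1 : ℝ) else 0)).const_add (z i)
      simpa using h
    have h1 : HasDerivAt (fun t => -(∑ i, y t i ^ 2) / 2) (-z m) 0 := by
      have h :=
        ((HasDerivAt.fun_sum (u := Finset.univ) fun i _ => (hcoord i).pow 2).neg).div_const 2
      refine h.congr_deriv ?_
      simp [hy0]
      ring
    have h2 : HasDerivAt (fun t => ∑ p ∈ posPairs N, Real.log (y t p.2 - y t p.1))
        (∑ p ∈ posPairs N,
          ((if p.2 = m then 1 else 0) - (if p.1 = m then 1 else 0)) * (z p.2 - z p.1)⁻¹) 0 := by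
      refine HasDerivAt.fun_sum fun p hp => ?_
      have hne : y 0 p.2 - y 0 p.1 ≠ 0 := by
        rw [hy0]
        exact (sub_pos.mpr (hmono (Finset.mem_filter.mp hp).2)).ne'
      have h := ((hcoord p.2).sub (hcoord p.1)).log hne
      refine h.congr_deriv ?_
      rw [div_eq_mul_inv]
      simp [hy0]
    exact h1.add h2
  have h0 := hloc.hasDerivAt_eq_zero hder
  have hsum := two_mul_sum_posPairs
    (fun i j => ((if j = m then (1 : ℝ) else 0) - (if i = m then 1 else 0)) * (z j - z i)⁻¹)
    (fun i j => by rw [inv_sub_antisymm (fun i => z i) i j]; ring) (fun i => by simp)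
  have hfull : ∑ i, ∑ j, ((if j = m then (1 : ℝ) else 0) - (if i = m then 1 else 0)) *
      (z j - z i)⁻¹ = 2 * ∑ j, (z m - z j)⁻¹ := by
    have a1 : ∀ i, ∑ j, ((if j = m then (1 : ℝ) else 0) - (if i = m then 1 else 0)) *
        (z j - z i)⁻¹ = (z m - z i)⁻¹ - (if i = m then ∑ j, (z j - z m)⁻¹ else 0) := by
      intro i
      simp only [sub_mul, Finset.sum_sub_distrib]
      congr 1
      · simp
      · by_cases h : i = m
        · subst h; simp
        · simp [h]
    simp only [a1, Finset.sum_sub_distrib, Finset.sum_ite_eq', Finset.mem_univ, if_true]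
    have a2 : ∑ j, (z j - z m)⁻¹ = -∑ j, (z m - z j)⁻¹ := by
      rw [← Finset.sum_neg_distrib]
      exact Finset.sum_congr rfl fun j _ => inv_sub_antisymm (fun i => z i) j m
    rw [a2]; ring
  rw [hfull] at hsum
  have := mul_left_cancel₀ two_ne_zero hsum
  rw [this] at h0
  change ∑ j, (z m - z j)⁻¹ = z m
  linarith

end Chamber

/-! ### Concentration at the maximizer -/

section Laplace

variable {N : ℕ}

/-- Away from a unique maximizer the weight stays strictly below its maximum. -/
theorem exists_lt_of_unique_max {z : EuclideanSpace ℝ (Fin N)}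
    (hmax : IsMaxOn gaussWeight (weylChamber N) z) (hpos : 0 < gaussWeight z)
    (huniq : ∀ w ∈ weylChamber N, gaussWeight w = gaussWeight z → w = z)
    {u : Set (EuclideanSpace ℝ (Fin N))} (hu : IsOpen u) (hzu : z ∈ u) :
    ∃ M, 0 ≤ M ∧ M < gaussWeight z ∧ ∀ x ∈ weylChamber N \ u, gaussWeight x ≤ M := by
  rcases (weylChamber N \ u).eq_empty_or_nonempty with he | ⟨x₀, hx₀⟩
  · exact ⟨0, le_rfl, hpos, by simp [he]⟩
  -- cutting the weight off at half of its maximum makes every point a bound near infinity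
  set F : EuclideanSpace ℝ (Fin N) → ℝ := fun x => max (gaussWeight x) (gaussWeight z / 2) with hF
  have hFc : Continuous F := continuous_gaussWeight.max continuous_const
  have hcl : IsClosed (weylChamber N \ u) := isClosed_weylChamber.sdiff hu
  obtain ⟨w, hw, hwmax⟩ := hFc.continuousOn.exists_isMaxOn' hcl hx₀ (mem_inf_of_left
    ((tendsto_gaussWeight_cocompact.eventually (gt_mem_nhds (half_pos hpos))).mono fun x hx => by
      change F x ≤ F x₀
      rw [hF]
      simp only
      rw [max_eq_right hx.le]
      exact le_max_right _ _))
  refine ⟨F w, (gaussWeight_nonneg w).trans (le_max_left _ _), ?_, fun x hx =>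
    (le_max_left _ _).trans (hwmax hx)⟩
  refine max_lt (lt_of_le_of_ne (hmax hw.1) fun h => ?_) (half_lt_self hpos)
  have := huniq w hw.1 h
  rw [this] at hw
  exact hw.2 hzu

/-- Laplace's method: large powers of the weight concentrate at its unique maximizer. The
normalizing integral runs over a bounded part of the chamber; it cancels when two such limits are
divided. -/
theorem tendsto_laplace {z : EuclideanSpace ℝ (Fin N)} (hzC : z ∈ weylChamber N)
    (hmax : IsMaxOn gaussWeight (weylChamber N) z) (hpos : 0 < gaussWeight z)
    (huniq : ∀ w ∈ weylChamber N, gaussWeight w = gaussWeight z → w = z)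
    {g : EuclideanSpace ℝ (Fin N) → ℝ} (hg : IntegrableOn g (weylChamber N))
    (hgc : ContinuousAt g z) :
    Tendsto (fun t : ℝ => (∫ x in weylChamber N, gaussWeight x ^ t * g x) /
      ∫ x in weylChamber N ∩ Metric.closedBall z 1, gaussWeight x ^ t) atTop (𝓝 (g z)) := by
  set T := weylChamber N ∩ Metric.closedBall z 1
  set a : ℝ → ℝ := fun t => ∫ x in T, gaussWeight x ^ t with ha
  have hTc : IsCompact T := (isCompact_closedBall z 1).inter_left isClosed_weylChamber
  have hcont : ∀ t : ℝ, 0 ≤ t → Continuous fun x : EuclideanSpace ℝ (Fin N) => gaussWeight x ^ t :=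
    fun t ht => continuous_gaussWeight.rpow_const fun _ => Or.inr ht
  have hTint : ∀ t : ℝ, 0 ≤ t → IntegrableOn (fun x => gaussWeight x ^ t) T := fun t ht =>
    (hcont t ht).continuousOn.integrableOn_compact hTc
  have hlow : ∀ m, 0 ≤ m → m < gaussWeight z →
      ∃ c > 0, ∀ t : ℝ, 0 ≤ t → m ^ t * c ≤ a t := by
    intro m hm0 hm
    set V := {x | m < gaussWeight x} ∩ Metric.ball z 1 ∩ interior (weylChamber N)
    have hVo : IsOpen V := ((isOpen_lt continuous_const continuous_gaussWeight).inter
      Metric.isOpen_ball).inter isOpen_interior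
    have hzV : z ∈ V := ⟨⟨hm, Metric.mem_ball_self one_pos⟩,
      mem_interior_iff_mem_nhds.mpr (weylChamber_mem_nhds (strictMono_of_mem_weylChamber hzC hpos))⟩
    have hVT : V ⊆ T := fun x hx =>
      ⟨interior_subset hx.2, Metric.ball_subset_closedBall hx.1.2⟩
    have hVfin : volume V ≠ ⊤ :=
      ((measure_mono hVT).trans_lt hTc.measure_lt_top).ne
    have hVpos : 0 < volume.real V :=
      ENNReal.toReal_pos (hVo.measure_pos volume ⟨z, hzV⟩).ne' hVfin
    refine ⟨volume.real V, hVpos, fun t ht => ?_⟩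
    calc m ^ t * volume.real V = ∫ _ in V, m ^ t := by
          rw [setIntegral_const, smul_eq_mul, mul_comm]
      _ ≤ ∫ x in V, gaussWeight x ^ t := by
          refine setIntegral_mono_on (integrableOn_const hVfin) ((hTint t ht).mono_set hVT)
            hVo.measurableSet fun x hx => ?_
          exact Real.rpow_le_rpow hm0 (le_of_lt hx.1.1) ht
      _ ≤ a t := setIntegral_mono_set (hTint t ht)
          (ae_of_all _ fun x => Real.rpow_nonneg (gaussWeight_nonneg x) t)
          (Eventually.of_forall hVT)
  have hapos : ∀ t : ℝ, 0 ≤ t → 0 < a t := by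
    intro t ht
    obtain ⟨c, hc, h⟩ := hlow (gaussWeight z / 2) (half_pos hpos).le (half_lt_self hpos)
    exact (mul_pos (Real.rpow_pos_of_pos (half_pos hpos) t) hc).trans_le (h t ht)
  have hmain : Tendsto (fun t : ℝ => ∫ x in weylChamber N, (gaussWeight x ^ t / a t) • g x) atTop
      (𝓝 (g z)) := by
    refine tendsto_setIntegral_peak_smul_of_integrableOn_of_tendsto (t := T) (x₀ := z)
      isClosed_weylChamber.measurableSet hTc.measurableSet Set.inter_subset_left ?_
      hTc.measure_lt_top.ne ?_ ?_ ?_ ?_ hg hgc.continuousWithinAt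
    · exact inter_mem_nhdsWithin _ (Metric.closedBall_mem_nhds z one_pos)
    · filter_upwards [eventually_ge_atTop 0] with t ht x _
      exact div_nonneg (Real.rpow_nonneg (gaussWeight_nonneg x) t) (hapos t ht).le
    · intro u hu hzu
      obtain ⟨M, hM0, hM, hMle⟩ := exists_lt_of_unique_max hmax hpos huniq hu hzu
      obtain ⟨m, hMm, hm⟩ := exists_between hM
      have hm0 : 0 < m := hM0.trans_lt hMm
      obtain ⟨c, hc, hlow'⟩ := hlow m hm0.le hm
      have hlim : Tendsto (fun t : ℝ => (M / m) ^ t / c) atTop (𝓝 (0 / c)) :=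
        (tendsto_rpow_atTop_of_base_lt_one (M / m)
          (by linarith [div_nonneg hM0 hm0.le]) ((div_lt_one hm0).mpr hMm)).div_const c
      rw [zero_div] at hlim
      rw [Metric.tendstoUniformlyOn_iff]
      intro ε hε
      filter_upwards [eventually_ge_atTop 0, hlim.eventually (gt_mem_nhds hε)] with t ht hlt x hx
      rw [Pi.zero_apply, dist_zero_left, Real.norm_eq_abs,
        abs_of_nonneg (div_nonneg (Real.rpow_nonneg (gaussWeight_nonneg x) t) (hapos t ht).le)]
      refine lt_of_le_of_lt ?_ hlt
      rw [Real.div_rpow hM0 hm0.le, div_div]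
      exact div_le_div₀ (Real.rpow_nonneg hM0 t)
        (Real.rpow_le_rpow (gaussWeight_nonneg x) (hMle x hx) ht)
        (mul_pos (Real.rpow_pos_of_pos hm0 t) hc) (hlow' t ht)
    · refine tendsto_const_nhds.congr' ?_
      filter_upwards [eventually_ge_atTop 0] with t ht
      rw [integral_div]
      exact (div_self (hapos t ht).ne').symm
    · filter_upwards [eventually_ge_atTop 0] with t ht
      exact ((hcont t ht).div_const _).aestronglyMeasurable
  refine hmain.congr fun t => ?_
  rw [← integral_div]
  refine integral_congr_ae (ae_of_all _ fun x => ?_)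
  simp only [smul_eq_mul, ha]
  ring

end Laplace

/-! ### The frozen limit of the jump rates -/

section JumpRate

variable {N : ℕ}

/-- The Weyl chambers tile the space, up to walls on which the integrand vanishes. -/
theorem integral_eq_factorial_mul_setIntegral_weylChamber
    {g : EuclideanSpace ℝ (Fin N) → ℝ} (hg : Integrable g)
    (hperm : ∀ (σ : Equiv.Perm (Fin N)) x,
      g (LinearIsometryEquiv.piLpCongrLeft 2 ℝ ℝ σ x) = g x)
    (hwall : ∀ x : EuclideanSpace ℝ (Fin N), ¬ Function.Injective (fun i => x i) → g x = 0) :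
    ∫ x, g x = N.factorial * ∫ x in weylChamber N, g x := by
  have hC := isClosed_weylChamber (N := N).measurableSet
  set T : Equiv.Perm (Fin N) → EuclideanSpace ℝ (Fin N) → EuclideanSpace ℝ (Fin N) :=
    fun σ x => LinearIsometryEquiv.piLpCongrLeft 2 ℝ ℝ σ x with hT
  have hTi : ∀ σ x i, T σ x i = x (σ.symm i) := by
    intro σ x i
    simp [hT, LinearIsometryEquiv.piLpCongrLeft_apply, Equiv.piCongrLeft'_apply]
  have hpoint : ∀ x, ∑ σ, (weylChamber N).indicator g (T σ x) = g x := by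
    intro x
    by_cases hx : Function.Injective fun i => x i
    · set τ := (Tuple.sort fun i => x i).symm
      have hmono : ∀ σ : Equiv.Perm (Fin N), T σ x ∈ weylChamber N ↔
          Monotone ((fun i => x i) ∘ σ.symm) := by
        intro σ
        rw [mem_weylChamber_iff]
        simp only [hTi]
        rfl
      have hτm : Monotone ((fun i => x i) ∘ τ.symm) := Tuple.monotone_sort _
      rw [Finset.sum_eq_single τ _ (by simp)]
      · rw [Set.indicator_of_mem ((hmono τ).mpr hτm)]
        exact hperm τ x
      · intro σ _ hσ
        refine Set.indicator_of_notMem (fun h => hσ ?_) _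
        have he := Tuple.unique_monotone ((hmono σ).mp h) hτm
        have : σ.symm = τ.symm := Equiv.ext fun i => hx (congrFun he i)
        exact Equiv.symm_bijective.injective this
    · rw [hwall x hx]
      refine Finset.sum_eq_zero fun σ _ => ?_
      by_cases h : T σ x ∈ weylChamber N
      · rw [Set.indicator_of_mem h]
        exact (hperm σ x).trans (hwall x hx)
      · rw [Set.indicator_of_notMem h]
  have hmp : ∀ σ, MeasurePreserving (T σ) := fun σ =>
    (LinearIsometryEquiv.piLpCongrLeft 2 ℝ ℝ σ).measurePreserving
  have hemb : ∀ σ, MeasurableEmbedding (T σ) := fun σ =>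
    (LinearIsometryEquiv.piLpCongrLeft 2 ℝ ℝ σ).toHomeomorph.measurableEmbedding
  calc ∫ x, g x = ∫ x, ∑ σ, (weylChamber N).indicator g (T σ x) := by simp only [hpoint]
    _ = ∑ σ, ∫ x, (weylChamber N).indicator g (T σ x) := by
        refine integral_finsetSum _ fun σ _ => ?_
        exact ((hmp σ).integrable_comp_emb (hemb σ)).mpr (hg.indicator hC)
    _ = ∑ _σ : Equiv.Perm (Fin N), ∫ x in weylChamber N, g x := by
        refine Finset.sum_congr rfl fun σ _ => ?_
        rw [(hmp σ).integral_comp (hemb σ), integral_indicator hC]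
    _ = N.factorial * ∫ x in weylChamber N, g x := by
        rw [Finset.sum_const, Finset.card_univ, Fintype.card_perm, Fintype.card_fin, nsmul_eq_mul]

theorem gaussWeight_perm (σ : Equiv.Perm (Fin N)) (x : EuclideanSpace ℝ (Fin N)) :
    gaussWeight (LinearIsometryEquiv.piLpCongrLeft 2 ℝ ℝ σ x) = gaussWeight x := by
  have hi : ∀ i, LinearIsometryEquiv.piLpCongrLeft 2 ℝ ℝ σ x i = x (σ.symm i) := by
    intro i
    simp [LinearIsometryEquiv.piLpCongrLeft_apply, Equiv.piCongrLeft'_apply]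
  have hsq : ∀ y : EuclideanSpace ℝ (Fin N), (∏ p ∈ posPairs N, |y p.2 - y p.1|) ^ 2 =
      ∏ p ∈ (Finset.univ : Finset (Fin N × Fin N)) with p.1 ≠ p.2, |y p.2 - y p.1| := by
    intro y
    rw [← Finset.prod_filter_mul_prod_filter_not
      (Finset.univ.filter fun p : Fin N × Fin N => p.1 ≠ p.2) (fun p => p.1 < p.2),
      Finset.filter_filter, Finset.filter_filter, sq]
    congr 1
    · refine Finset.prod_congr ?_ fun _ _ => rfl
      ext p
      simp only [posPairs, Finset.mem_filter, Finset.mem_univ, true_and]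
      exact ⟨fun h => ⟨h.ne, h⟩, fun h => h.2⟩
    · refine Finset.prod_nbij' Prod.swap Prod.swap ?_ ?_ ?_ ?_ ?_
      · intro p hp
        have h : p.1 < p.2 := (Finset.mem_filter.mp hp).2
        simp [h.ne', h.le]
      · intro p hp
        simp only [Finset.mem_filter, Finset.mem_univ, true_and, not_lt] at hp
        simp only [posPairs, Finset.mem_filter, Finset.mem_univ, true_and, Prod.fst_swap,
          Prod.snd_swap]
        exact lt_of_le_of_ne hp.2 hp.1.symm
      · simp
      · simp
      · intro p _
        exact abs_sub_comm _ _
  have hprod : (∏ p ∈ posPairs N, |LinearIsometryEquiv.piLpCongrLeft 2 ℝ ℝ σ x p.2 -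
      LinearIsometryEquiv.piLpCongrLeft 2 ℝ ℝ σ x p.1|) = ∏ p ∈ posPairs N, |x p.2 - x p.1| := by
    refine (pow_left_inj₀ (Finset.prod_nonneg fun _ _ => abs_nonneg _)
      (Finset.prod_nonneg fun _ _ => abs_nonneg _) two_ne_zero).mp ?_
    rw [hsq, hsq]
    simp only [hi]
    refine Finset.prod_equiv (σ.symm.prodCongr σ.symm) ?_ ?_
    · intro p; simp
    · intro p _; simp
  rw [gaussWeight, gaussWeight, hprod, LinearIsometryEquiv.norm_map]

theorem integrable_gaussWeight_rpow {β : ℝ} (hβ : 2 ≤ β) :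
    Integrable fun x : EuclideanSpace ℝ (Fin N) => gaussWeight x ^ β := by
  obtain ⟨C, hC⟩ := exists_gaussian_bound (posPairs N)
  -- the weight is bounded, and its square is integrable
  have hbdd : ∀ x : EuclideanSpace ℝ (Fin N), gaussWeight x ≤ Real.sqrt (max C 0) := by
    intro x
    refine Real.le_sqrt_of_sq_le ?_
    rw [gaussWeight_sq]
    refine (hC x).trans ((mul_le_mul_of_nonneg_right (le_max_left C 0)
      (Real.exp_pos _).le).trans ?_)
    refine mul_le_of_le_one_right (le_max_right _ _) (Real.exp_le_one_iff.mpr ?_)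
    nlinarith [sq_nonneg ‖x‖]
  have hcont : Continuous fun x : EuclideanSpace ℝ (Fin N) => gaussWeight x ^ β :=
    continuous_gaussWeight.rpow_const fun _ => Or.inr (by linarith)
  refine (integrable_gaussWeight_sq.const_mul (Real.sqrt (max C 0) ^ (β - 2))).mono'
    hcont.aestronglyMeasurable (ae_of_all _ fun x => ?_)
  have h0 := gaussWeight_nonneg x
  rw [Real.norm_eq_abs, abs_of_nonneg (Real.rpow_nonneg h0 β)]
  have : gaussWeight x ^ β = gaussWeight x ^ (β - 2) * gaussWeight x ^ 2 := by
    rw [← Real.rpow_two, ← Real.rpow_add_of_nonneg h0 (by linarith) (by norm_num)]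
    congr 1; ring
  rw [this]
  exact mul_le_mul_of_nonneg_right (Real.rpow_le_rpow h0 (hbdd x) (by linarith)) (sq_nonneg _)

theorem smul_mem_weylChamber_iff {s : ℝ} (hs : 0 < s) (x : EuclideanSpace ℝ (Fin N)) :
    s • x ∈ weylChamber N ↔ x ∈ weylChamber N := by
  simp only [weylChamber, Set.mem_ofPred_eq, inner_smul_right, mul_nonneg_iff_of_pos_left hs]

/-- The jump rate as a quotient of integrals of powers of the weight: the substitution `x = √β y`
absorbs the factor `β` of the rate into `1 / (α · x) ^ 2`, and the symmetry of the weight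
identifies `N!` with the number of chambers. -/
theorem jumpRate_eq {β : ℝ} (hβ : 2 ≤ β) {i j : Fin N} (hij : i < j)
    (hpos : ∫ x in weylChamber N, gaussWeight x ^ β ≠ 0) :
    jumpRate β 1 (root j i) = 1 / 2 *
      ((∫ x in weylChamber N, gaussWeight x ^ β * (1 / (x j - x i) ^ 2)) /
        ∫ x in weylChamber N, gaussWeight x ^ β) := by
  have hβ0 : 0 < β := by linarith
  set s := Real.sqrt β
  have hs0 : 0 < s := Real.sqrt_pos.mpr hβ0
  have hsβ : β = s ^ 2 := (Real.sq_sqrt hβ0.le).symm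
  set κ : ℝ := (s ^ β) ^ (posPairs N).card with hκ
  have hκ0 : κ ≠ 0 := (pow_pos (Real.rpow_pos_of_pos hs0 β) _).ne'
  set D : ℝ := |(s ^ Module.finrank ℝ (EuclideanSpace ℝ (Fin N)))⁻¹| with hD
  have hD0 : D ≠ 0 := abs_ne_zero.mpr (inv_ne_zero (pow_ne_zero _ hs0.ne'))
  have hC := isClosed_weylChamber (N := N).measurableSet
  -- the normalization constant, by the substitution `x = √β y` and the symmetry of the weight
  have hnorm : D * normConst N β = κ * (N.factorial * ∫ x in weylChamber N, gaussWeight x ^ β) := by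
    have h := Measure.integral_comp_smul (volume : Measure (EuclideanSpace ℝ (Fin N)))
      (fun x => Real.exp (-‖x‖ ^ 2 / 2) * weight β x) s
    simp only [exp_mul_weight_smul hs0 hsβ] at h
    rw [integral_const_mul, integral_eq_factorial_mul_setIntegral_weylChamber
      (integrable_gaussWeight_rpow hβ) (fun σ x => by rw [gaussWeight_perm])
      (fun x hx => by rw [gaussWeight_eq_zero hx, Real.zero_rpow hβ0.ne'])] at h
    rw [normConst, hκ, h]
    rfl
  have hI : D * ∫ x in weylChamber N, 1 / (inner ℝ (root j i) x) ^ 2 *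
        (Real.exp (-‖x‖ ^ 2 / 2) * weight β x) =
      κ / β * ∫ x in weylChamber N, gaussWeight x ^ β * (1 / (x j - x i) ^ 2) := by
    have h := Measure.integral_comp_smul (volume : Measure (EuclideanSpace ℝ (Fin N)))
      ((weylChamber N).indicator fun x => 1 / (inner ℝ (root j i) x) ^ 2 *
        (Real.exp (-‖x‖ ^ 2 / 2) * weight β x)) s
    rw [integral_indicator hC] at h
    rw [hD, ← smul_eq_mul, ← h, ← integral_const_mul, ← integral_indicator hC]
    congr 1
    funext x
    by_cases hx : x ∈ weylChamber N
    · rw [Set.indicator_of_mem ((smul_mem_weylChamber_iff hs0 x).mpr hx), Set.indicator_of_mem hx,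
        exp_mul_weight_smul hs0 hsβ, inner_smul_right, inner_root, mul_pow, ← hsβ]
      rw [one_div, mul_inv]
      ring
    · rw [Set.indicator_of_notMem (fun h => hx ((smul_mem_weylChamber_iff hs0 x).mp h)),
        Set.indicator_of_notMem hx]
  have hrad : ∀ x : EuclideanSpace ℝ (Fin N), radialDensity β 1 x =
      N.factorial / normConst N β * (Real.exp (-‖x‖ ^ 2 / 2) * weight β x) := by
    intro x
    rw [radialDensity, Finset.sum_const, Finset.card_univ, Fintype.card_perm, Fintype.card_fin,
      nsmul_eq_mul, originDensity, Real.sqrt_one, inv_one, one_smul, Real.one_rpow, mul_one,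
      mul_one]
    ring
  have hJ : jumpRate β 1 (root j i) = β / 2 * (N.factorial / normConst N β *
      ∫ x in weylChamber N, 1 / (inner ℝ (root j i) x) ^ 2 *
        (Real.exp (-‖x‖ ^ 2 / 2) * weight β x)) := by
    have e : ∫ x in weylChamber N, 1 / (inner ℝ (root j i) x) ^ 2 * radialDensity β 1 x =
        N.factorial / normConst N β * ∫ x in weylChamber N, 1 / (inner ℝ (root j i) x) ^ 2 *
          (Real.exp (-‖x‖ ^ 2 / 2) * weight β x) := by
      rw [← integral_const_mul]
      refine integral_congr_ae (ae_of_all _ fun x => ?_)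
      simp only [hrad]
      ring
    rw [jumpRate, norm_root_sq hij.ne, e]
    ring
  set I := ∫ x in weylChamber N, 1 / (inner ℝ (root j i) x) ^ 2 *
        (Real.exp (-‖x‖ ^ 2 / 2) * weight β x)
  set A := ∫ x in weylChamber N, gaussWeight x ^ β * (1 / (x j - x i) ^ 2)
  set B := ∫ x in weylChamber N, gaussWeight x ^ β
  have hfac : (N.factorial : ℝ) ≠ 0 := by exact_mod_cast N.factorial_ne_zero
  have hI' : I = κ / β * A / D := by rw [eq_div_iff hD0, mul_comm, hI]
  have hc' : normConst N β = κ * (N.factorial * B) / D := by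
    rw [eq_div_iff hD0, mul_comm, hnorm]
  rw [hJ, hI', hc']
  field_simp

/-- One square of the weight is set aside to make `1 / (x_j - x_i) ^ 2` integrable; the remaining
power `β - 2` concentrates. -/
theorem tendsto_jumpRate {z : EuclideanSpace ℝ (Fin N)} (hzC : z ∈ weylChamber N)
    (hmax : IsMaxOn gaussWeight (weylChamber N) z) (hpos : 0 < gaussWeight z)
    (huniq : ∀ w ∈ weylChamber N, gaussWeight w = gaussWeight z → w = z)
    {i j : Fin N} (hij : i < j) :
    Tendsto (fun β : ℝ => jumpRate β 1 (root j i)) atTop (𝓝 (1 / (2 * (z j - z i) ^ 2))) := by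
  have hne : z j - z i ≠ 0 := (sub_pos.mpr (strictMono_of_mem_weylChamber hzC hpos hij)).ne'
  have hG := tendsto_laplace hzC hmax hpos huniq (integrable_gaussWeight_sq_div hij).integrableOn
    (by
      refine (continuous_gaussWeight.pow 2).continuousAt.mul ?_
      refine ContinuousAt.div continuousAt_const ?_ (pow_ne_zero 2 hne)
      fun_prop)
  have hF := tendsto_laplace hzC hmax hpos huniq (integrable_gaussWeight_sq (N := N)).integrableOn
    (continuous_gaussWeight.pow 2).continuousAt
  have hz2 : gaussWeight z ^ 2 ≠ 0 := pow_ne_zero 2 hpos.ne'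
  have hquot := (hG.div hF hz2).const_mul (1 / 2)
  have hshift : Tendsto (fun β : ℝ => β - 2) atTop atTop :=
    tendsto_atTop_add_const_right _ _ tendsto_id
  have h := hquot.comp hshift
  have hval : 1 / 2 * (gaussWeight z ^ 2 * (1 / (z j - z i) ^ 2) / gaussWeight z ^ 2) =
      1 / (2 * (z j - z i) ^ 2) := by
    field_simp
  rw [hval] at h
  refine h.congr' ?_
  have hev := (hF.comp hshift).eventually_ne hz2
  filter_upwards [hev, eventually_ge_atTop 2] with β hβne hβ
  have hsplit : ∀ x : EuclideanSpace ℝ (Fin N),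
      gaussWeight x ^ (β - 2) * gaussWeight x ^ 2 = gaussWeight x ^ β := by
    intro x
    rw [← Real.rpow_two, ← Real.rpow_add_of_nonneg (gaussWeight_nonneg x) (by linarith)
      (by norm_num)]
    congr 1; ring
  simp only [Function.comp_apply, Pi.div_apply, hsplit, ← mul_assoc] at hβne ⊢
  rw [div_ne_zero_iff] at hβne
  rw [div_div_div_cancel_right₀ hβne.2, jumpRate_eq hβ hij hβne.1]

end JumpRate

end DunklA

open DunklA

theorem mainTheorem6 (N : ℕ) (hN : 2 ≤ N) (H : ℕ → ℝ[X]) (hH : IsHermiteFamily H) :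
    ∃ z : Fin N → ℝ,
      -- `z` lists the zeros of the Hermite polynomial `H N` in ascending order
      StrictMono z ∧ (∀ x : ℝ, (H N).IsRoot x ↔ ∃ i, z i = x) ∧
      -- frozen limit of the jump rates and of the transition matrix
      (∀ i j : Fin N, i < j →
        Tendsto (fun β : ℝ => jumpRate β 1 (root j i)) atTop (𝓝 (1 / (2 * (z j - z i) ^ 2)))) ∧
      Tendsto (fun β : ℝ => dunklMatrix N β) atTop (𝓝 (frozenMatrix z)) ∧
      (∀ (f : Equiv.Perm (Fin N) → ℝ) (τ : Equiv.Perm (Fin N)),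
        (frozenMatrix z).mulVec f τ =
          1 / 2 * ∑ p ∈ posPairs N, f (τ * Equiv.swap p.2 p.1) / (z p.2 - z p.1) ^ 2 -
            (N : ℝ) * ((N : ℝ) - 1) / 8 * f τ) ∧
      -- the frozen matrix is half the Polychronakos–Frahm Hamiltonian minus `N (N - 1) / 8`
      Function.Injective (funKet N) ∧ LinearMap.range (funKet N) = permSpace N ∧
      (∀ v ∈ permSpace N, pfHamiltonian z v ∈ permSpace N) ∧
      (∀ f : Equiv.Perm (Fin N) → ℂ,
        funKet N (((frozenMatrix z).map (fun r : ℝ => (r : ℂ))).mulVec f) =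
          (1 / 2 : ℂ) • pfHamiltonian z (funKet N f) -
            ((N : ℂ) * ((N : ℂ) - 1) / 8) • funKet N f) ∧
      -- the largest eigenvalue is zero, and it is simple
      IsGreatest {r : ℝ | Module.End.HasEigenvalue (Matrix.toLin' (frozenMatrix z)) r} 0 ∧
      Module.End.eigenspace (Matrix.toLin' (frozenMatrix z)) 0 =
        Submodule.span ℝ {fun _ : Equiv.Perm (Fin N) => (1 : ℝ)} ∧
      -- the least negative nonzero eigenvalue is `-1/2`, with multiplicity `N - 1`
      IsGreatest
        {r : ℝ | r ≠ 0 ∧ Module.End.HasEigenvalue (Matrix.toLin' (frozenMatrix z)) r} (-1 / 2) ∧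
      Module.finrank ℝ (Module.End.eigenspace (Matrix.toLin' (frozenMatrix z)) (-1 / 2)) = N - 1 ∧
      -- the `su(N)` commutators and the ladder operators
      (∀ a b : Fin N × Fin N, ⁅suGen a, suGen b⁆ = ∑ c, structConst a b c • suGen c) ∧
      (∀ a : Fin N × Fin N,
        ⁅hatM z, ladderK z a⁆ = (1 / 2 : ℂ) • ladderL z a ∧
        ⁅hatM z, ladderL z a⁆ = (1 / 2 : ℂ) • ladderK z a ∧
        ∀ (r : ℂ) (φ : SpinSpace N), hatM z φ = r • φ →
          hatM z ((ladderK z a + ladderL z a) φ) =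
              (r + 1 / 2) • (ladderK z a + ladderL z a) φ ∧
            hatM z ((ladderK z a - ladderL z a) φ) =
              (r - 1 / 2) • (ladderK z a - ladderL z a) φ) ∧
      -- which ladder operators preserve the span of the vectors `|ρ⟩`
      (∀ j : Fin N, ∀ v ∈ permSpace N,
        (ladderK z (j, j) + ladderL z (j, j)) v ∈ permSpace N ∧
          (ladderK z (j, j) - ladderL z (j, j)) v ∈ permSpace N) ∧
      (∀ j l : Fin N, j ≠ l →
        (∃ v ∈ permSpace N, (ladderK z (j, l) + ladderL z (j, l)) v ∉ permSpace N) ∧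
          (3 ≤ N →
            ∃ v ∈ permSpace N, (ladderK z (j, l) - ladderL z (j, l)) v ∉ permSpace N)) ∧
      -- lowering the symmetric state: only the diagonal labels give an eigenvector in that span
      hatM z (symState N) = ((N : ℂ) * ((N : ℂ) - 1) / 8) • symState N ∧
      (∀ j l : Fin N,
        ((ladderK z (j, l) - ladderL z (j, l)) (symState N) ∈ permSpace N ∧
            (ladderK z (j, l) - ladderL z (j, l)) (symState N) ≠ 0) ↔
          j = l ∧ (j : ℕ) + 1 < N) ∧
      -- and these `N - 1` vectors form a basis of the eigenspace of the eigenvalue `-1/2`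
      LinearIndependent ℂ (loweredState z) ∧
      Submodule.span ℂ (Set.range (loweredState z)) =
        permSpace N ⊓
          Module.End.eigenspace (hatM z) ((N : ℂ) * ((N : ℂ) - 1) / 8 - 1 / 2) := by
  obtain ⟨z, hzC, hmax, hpos⟩ := exists_isMaxOn_gaussWeight N
  have hz : IsNode fun i => z i := isNode_of_isMaxOn hzC hmax hpos
  have hmono := strictMono_of_mem_weylChamber hzC hpos
  -- every other maximizer consists of the zeros of the same Hermite polynomial
  have huniq : ∀ w ∈ weylChamber N, gaussWeight w = gaussWeight z → w = z := by
    intro w hw hwz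
    have hwpos : 0 < gaussWeight w := hwz ▸ hpos
    have hwmax : IsMaxOn gaussWeight (weylChamber N) w := fun x hx => by
      change gaussWeight x ≤ gaussWeight w
      rw [hwz]
      exact hmax hx
    have h := hH.node_unique (isNode_of_isMaxOn hw hwmax hwpos) hz
      (strictMono_of_mem_weylChamber hw hwpos) hmono
    ext i
    exact congrFun h i
  have hzc : IsNode fun i => ((z i : ℝ) : ℂ) := hz.ofReal
  have hrate : ∀ i j : Fin N, i < j →
      Tendsto (fun β : ℝ => jumpRate β 1 (root j i)) atTop (𝓝 (1 / (2 * (z j - z i) ^ 2))) :=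
    fun i j hij => tendsto_jumpRate hzC hmax hpos huniq hij
  refine ⟨fun i => z i, hmono, hH.isRoot_iff hz, hrate, tendsto_transitionMatrix ?_,
    fun f τ => ?_, funKet_injective, range_funKet, fun v hv => pfHamiltonian_mem _ hv,
    funKet_frozenMatrix_mulVec hzc, ?_, ?_, ?_, ?_, lie_suGen, fun a =>
    ⟨lie_hatM_ladderK hzc a, lie_hatM_ladderL hzc a, hatM_ladder hzc a⟩, fun j v hv => ?_,
    fun j l hjl => ⟨exists_ladder_add_not_mem hN hzc hjl,
      fun h3 => exists_ladder_sub_not_mem h3 hzc hjl⟩,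
    hatM_symState hzc, ladder_sub_symState_mem_iff hzc, linearIndependent_loweredState hzc,
    span_loweredState hzc⟩
  · intro p hp
    exact hrate p.1 p.2 (Finset.mem_filter.mp hp).2
  · exact frozenMatrix_mulVec hz f τ
  · rw [toLin_frozenMatrix]
    exact isGreatest_hasEigenvalue_frozenGen hz
  · rw [toLin_frozenMatrix]
    exact eigenspace_frozenGen_zero hz
  · rw [toLin_frozenMatrix]
    exact isGreatest_hasEigenvalue_ne_zero_frozenGen hN hz
  · rw [toLin_frozenMatrix, eigenspace_frozenGen_neg_half hz, finrank_span_position hz]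
  · rw [LinearMap.add_apply, LinearMap.sub_apply]
    exact ⟨add_mem (ladderK_diag_mem _ j hv) (ladderL_diag_mem _ j hv),
      sub_mem (ladderK_diag_mem _ j hv) (ladderL_diag_mem _ j hv)⟩
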